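/- **Conventions.** Graphs are finite and simple. An *interval representation* $\mathcal R$ of a graph $G$ assigns to every vertex $x$ a closed interval $\langle x\rangle$ of the real line such that distinct vertices are adjacent if and only if their intervals intersect; $G$ is an *interval graph* if it has one. The maximal cliques of $G$ correspond to pairwise disjoint nonempty intersections of intervals, so $\mathcal R$ determines a left-to-right ordering of the maximal cliques, in which the cliques containing any given vertex are consecutive; orderings of all maximal cliques with the latter property are called *consecutive*. For $S\subseteq V(G)$, $\mathcal R[S]$ is the representation of $G[S]$ obtained by restriction, and $\mathcal R^{\leftrightarrow}$ is the mirror image of $\mathcal R$. Let $\nu(\mathcal R)$ be the largest number of intervals in a chain $\langle x_1\rangle\subsetneq\dots\subsetneq\langle x_k\rangle$, let $\nu(x)$ be the largest length of such a chain with $x_k=x$, and let $\nu(G)=\min_{\mathcal R}\nu(\mathcal R)$. The representation $\mathcal R$ is *cleaned* if its only nestings are those forced by its ordering of maximal cliques: $\langle x\rangle\subsetneq\langle y\rangle$ only if $y$ lies in a maximal clique to the left of all maximal cliques containing $x$ and in a maximal clique to the right of all of them. For a representation $\mathcal R$ of $G$ with leftmost and rightmost maximal cliques $C^\leftarrow$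 and $C^\rightarrow$ put $$\nu^\rightarrow(\mathcal R)=\max_{x\in V(G)\setminus C^\leftarrow}\nu(x),\qquad \nu^\leftarrow(\mathcal R)=\max_{x\in V(G)\setminus C^\rightarrow}\nu(x)\qquad(\max\emptyset=0).$$ **Triples.** The triple of an interval graph $G$ is $$\alpha=\nu(G_\alpha)-1,\quad \beta=\nu(G_\beta)-1,\quad \gamma=\nu(G_\gamma)-1,$$ where $G_\alpha$ is $G$ together with a path $a'\,a\,u\,b\,b'$ and all edges from $u$ to $V(G)$; $G_\beta$ is $G$ together with a path $a'\,a\,u$ and all edges from $u$ to $V(G)$; and $G_\gamma$ is $G$ together with a path $a'\,a\,u\,v\,b\,b'$ and all edges from $u$ and from $v$ to $V(G)$. A representation $\mathcal R$ of $G$ is *minimal* if it is cleaned, $\nu(\mathcal R)=\alpha$, $\nu^\rightarrow(\mathcal R)=\beta$ and $\nu^\leftarrow(\mathcal R)=\gamma$. **MPQ-trees.** An MPQ-tree of $G$ is a rooted ordered tree whose leaves are the maximal cliques of $G$ and whose inner nodes are P-nodes (with at least two children) and Q-nodes (with at least three), such that the consecutive orderings of the maximal cliques are exactly the leaf orders of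 the trees obtained by arbitrarily permuting the children of P-nodes and reversing the order of the children of Q-nodes. Its nodes carry sections of vertices: the section of a leaf consists of the vertices in this maximal clique and in no other; the section of a P-node consists of the vertices in all maximal cliques below it and in no other; the $i$-th section of a Q-node with subtrees $T_1,\dots,T_q$ consists of the vertices that are in all maximal cliques of $T_i$ and in some maximal clique of some $T_j$ with $j\ne i$, but in no maximal clique outside the Q-node. A *subtree* $T$ is a node together with all its descendants, and $G[T]$ is the subgraph induced by the vertices in the sections of the nodes of $T$; $\mathcal R[T]$ denotes the restriction of $\mathcal R$ to it. **Lemma.** For every interval graph $G$ and every MPQ-tree of $G$ (it is unique up to the permutations and reversals above), there exists a cleaned representation $\mathcal R$ of $G$ with $\nu(\mathcal R)=\nu(G)$ such that, for every subtree $T$ of the MPQ-tree, $\mathcal R[T]$ is a minimal representation of $G[T]$ or $\mathcal R^{\leftrightarrow}[T]$ is a minimal representation of $G[T]$. -/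

import Mathlib

/-! ### Interval representations and nesting -/

/-- A representation of `G` by closed intervals `[left v, right v]` of the real line: two distinct
vertices are adjacent if and only if their intervals intersect. -/
structure IntervalRep {V : Type*} (G : SimpleGraph V) where
  left : V → ℝ
  right : V → ℝ
  left_le_right : ∀ v, left v ≤ right v
  adj_iff : ∀ x y, x ≠ y →
    (G.Adj x y ↔ (Set.Icc (left x) (right x) ∩ Set.Icc (left y) (right y)).Nonempty)

/-- A graph is an interval graph if it has an interval representation. -/
def IsIntervalGraph {V : Type*} (G : SimpleGraph V) : Prop :=
  Nonempty (IntervalRep G)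

/-- `C` is an inclusion-maximal clique of `G`. -/
def IsMaxClique {V : Type*} (G : SimpleGraph V) (C : Set V) : Prop :=
  Maximal G.IsClique C

namespace IntervalRep

/-- The interval of the vertex `x`. -/
def interval {V : Type*} {G : SimpleGraph V} (R : IntervalRep G) (x : V) : Set ℝ :=
  Set.Icc (R.left x) (R.right x)

/-- The flipped representation: the left-to-right order of the endpoints is reversed. -/
def flip {V : Type*} {G : SimpleGraph V} (R : IntervalRep G) : IntervalRep G where
  left v := -R.right v
  right v := -R.left v
  left_le_right v := neg_le_neg (R.left_le_right v)
  adj_iff x y hxy := by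
    rw [R.adj_iff x y hxy]
    constructor
    · rintro ⟨p, ⟨h1, h2⟩, h3, h4⟩
      exact ⟨-p, ⟨neg_le_neg h2, neg_le_neg h1⟩, neg_le_neg h4, neg_le_neg h3⟩
    · rintro ⟨p, ⟨h1, h2⟩, h3, h4⟩
      exact ⟨-p, ⟨by linarith, by linarith⟩, by linarith, by linarith⟩

/-- The restriction of `R` to the intervals of the vertices in `S`; it represents the subgraph
of `G` induced by `S`. -/
def restrict {V : Type*} {G : SimpleGraph V} (R : IntervalRep G) (S : Set V) :
    IntervalRep (G.induce S) where
  left v := R.left v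
  right v := R.right v
  left_le_right v := R.left_le_right v
  adj_iff x y hxy := by
    rw [SimpleGraph.induce_adj]
    exact R.adj_iff x y (fun h => hxy (Subtype.ext h))

/-- The interval of `x` is nested in (strictly contained in) the interval of `y`. -/
def Nested {V : Type*} {G : SimpleGraph V} (R : IntervalRep G) (x y : V) : Prop :=
  R.interval x ⊂ R.interval y

/-- A chain of nested intervals, given by its finite set of vertices. -/
def IsNestedChain {V : Type*} {G : SimpleGraph V} (R : IntervalRep G) (S : Finset V) : Prop :=
  ∀ x ∈ S, ∀ y ∈ S, x ≠ y → R.Nested x y ∨ R.Nested y x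

/-- `ν(x)`: the length (number of intervals) of a longest chain of nested intervals whose largest
interval is that of `x`. -/
noncomputable def nestingAt {V : Type*} {G : SimpleGraph V} (R : IntervalRep G) (x : V) : ℕ :=
  sSup {k | ∃ S : Finset V, R.IsNestedChain S ∧ x ∈ S ∧ (∀ y ∈ S, y ≠ x → R.Nested y x) ∧
    S.card = k}

/-- `ν(R)`: the length of a longest chain of nested intervals. -/
noncomputable def nesting {V : Type*} {G : SimpleGraph V} (R : IntervalRep G) : ℕ :=
  sSup {k | ∃ S : Finset V, R.IsNestedChain S ∧ S.card = k}

/-- The points of the line that belong to all intervals of `C`. For a maximal clique `C` of a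
finite graph it is nonempty, and distinct maximal cliques have disjoint regions. -/
def cliqueRegion {V : Type*} {G : SimpleGraph V} (R : IntervalRep G) (C : Set V) : Set ℝ :=
  ⋂ v ∈ C, R.interval v

/-- The clique `C` lies to the left of the clique `D` in `R`. On the maximal cliques of a finite
graph this is the consecutive (left-to-right) ordering of maximal cliques given by `R`. -/
def Precedes {V : Type*} {G : SimpleGraph V} (R : IntervalRep G) (C D : Set V) : Prop :=
  ∀ p ∈ R.cliqueRegion C, ∀ q ∈ R.cliqueRegion D, p < q

/-- `C` is the leftmost maximal clique of `R`. -/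
def IsLeftmostClique {V : Type*} {G : SimpleGraph V} (R : IntervalRep G) (C : Set V) : Prop :=
  IsMaxClique G C ∧ ∀ D, IsMaxClique G D → D ≠ C → R.Precedes C D

/-- `C` is the rightmost maximal clique of `R`. -/
def IsRightmostClique {V : Type*} {G : SimpleGraph V} (R : IntervalRep G) (C : Set V) : Prop :=
  IsMaxClique G C ∧ ∀ D, IsMaxClique G D → D ≠ C → R.Precedes D C

/-- The right nesting: the maximum of `ν(x)` over the vertices `x` outside the leftmost maximal
clique (`0` if there are none). -/
noncomputable def rightNesting {V : Type*} {G : SimpleGraph V} (R : IntervalRep G) : ℕ :=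
  sSup {k | ∃ x, (∀ C, R.IsLeftmostClique C → x ∉ C) ∧ R.nestingAt x = k}

/-- The left nesting: the maximum of `ν(x)` over the vertices `x` outside the rightmost maximal
clique (`0` if there are none). -/
noncomputable def leftNesting {V : Type*} {G : SimpleGraph V} (R : IntervalRep G) : ℕ :=
  sSup {k | ∃ x, (∀ C, R.IsRightmostClique C → x ∉ C) ∧ R.nestingAt x = k}

/-- `R` is cleaned if it has no nestings except those forced by its ordering of the maximal
cliques: if `x` is nested in `y`, then `y` belongs to a maximal clique on the left of all maximal
cliques containing `x` and to a maximal clique on the right of all of them. (In the latter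
situation the interval of `x` is always nested in that of `y`.) -/
def IsCleaned {V : Type*} {G : SimpleGraph V} (R : IntervalRep G) : Prop :=
  ∀ x y, R.Nested x y → ∃ C D, IsMaxClique G C ∧ IsMaxClique G D ∧ y ∈ C ∧ y ∈ D ∧
    ∀ E, IsMaxClique G E → x ∈ E → R.Precedes C E ∧ R.Precedes E D

end IntervalRep

/-- `ν(G)`: the minimum of `ν(R)` over all interval representations `R` of the interval
graph `G`. -/
noncomputable def graphNesting {V : Type*} (G : SimpleGraph V) : ℕ :=
  sInf {k | ∃ R : IntervalRep G, R.nesting = k}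

/-! ### The triple of an interval graph -/

/-- The disjoint union of `G` and `H`, together with all edges between the vertices of `G` and
the set `U` of vertices of `H`. -/
def attachGraph {V W : Type*} (G : SimpleGraph V) (H : SimpleGraph W) (U : Set W) :
    SimpleGraph (V ⊕ W) where
  Adj a b := match a, b with
    | Sum.inl x, Sum.inl y => G.Adj x y
    | Sum.inr p, Sum.inr q => H.Adj p q
    | Sum.inl _, Sum.inr q => q ∈ U
    | Sum.inr p, Sum.inl _ => p ∈ U
  symm := ⟨by
    rintro (x | p) (y | q) h
    · exact h.symm
    · exact h
    · exact h
    · exact h.symm⟩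
  loopless := ⟨by
    rintro (x | p) h
    · exact G.loopless.irrefl x h
    · exact H.loopless.irrefl p h⟩

/-- `G_α`: a vertex `u` adjacent to all of `G`, with two attached paths. The added vertices form
the path `a' a u b b'`. -/
def graphAlpha {V : Type*} (G : SimpleGraph V) : SimpleGraph (V ⊕ Fin 5) :=
  attachGraph G (SimpleGraph.pathGraph 5) {2}

/-- `G_β`: a vertex `u` adjacent to all of `G`, with one attached path. The added vertices form
the path `a' a u`. -/
def graphBeta {V : Type*} (G : SimpleGraph V) : SimpleGraph (V ⊕ Fin 3) :=
  attachGraph G (SimpleGraph.pathGraph 3) {2}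

/-- `G_γ`: two adjacent vertices `u`, `v`, both adjacent to all of `G`, each with an attached path.
The added vertices form the path `a' a u v b b'`. -/
def graphGamma {V : Type*} (G : SimpleGraph V) : SimpleGraph (V ⊕ Fin 6) :=
  attachGraph G (SimpleGraph.pathGraph 6) {2, 3}

/-- `α = ν(G_α) - 1`. -/
noncomputable def tripleAlpha {V : Type*} (G : SimpleGraph V) : ℕ :=
  graphNesting (graphAlpha G) - 1

/-- `β = ν(G_β) - 1`. -/
noncomputable def tripleBeta {V : Type*} (G : SimpleGraph V) : ℕ :=
  graphNesting (graphBeta G) - 1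

/-- `γ = ν(G_γ) - 1`. -/
noncomputable def tripleGamma {V : Type*} (G : SimpleGraph V) : ℕ :=
  graphNesting (graphGamma G) - 1

/-- A minimal representation: a cleaned representation whose overall, right and left nestings
are `α`, `β` and `γ`, respectively. -/
def IntervalRep.IsMinimalRep {V : Type*} {G : SimpleGraph V} (R : IntervalRep G) : Prop :=
  R.IsCleaned ∧ R.nesting = tripleAlpha G ∧ R.rightNesting = tripleBeta G ∧
    R.leftNesting = tripleGamma G

/-! ### MPQ-trees -/

/-- A consecutive ordering of the maximal cliques of `G`: a list of all of them, without
repetition, in which the cliques containing any given vertex appear consecutively. -/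
def IsConsecutiveOrdering {V : Type*} (G : SimpleGraph V) (l : List (Set V)) : Prop :=
  l.Nodup ∧ (∀ C, C ∈ l ↔ IsMaxClique G C) ∧
    ∀ (x : V) (i j k : Fin l.length), i ≤ j → j ≤ k → x ∈ l.get i → x ∈ l.get k → x ∈ l.get j

/-- Rooted ordered trees with leaves labelled by `α` and inner nodes of two kinds: P-nodes and
Q-nodes. -/
inductive PQTree (α : Type*) where
  | leaf (a : α) : PQTree α
  | pnode (n : ℕ) (c : Fin n → PQTree α) : PQTree α
  | qnode (n : ℕ) (c : Fin n → PQTree α) : PQTree α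

namespace PQTree

/-- Every P-node has at least two children and every Q-node at least three. -/
def IsProper {α : Type*} : PQTree α → Prop
  | leaf _ => True
  | pnode n c => 2 ≤ n ∧ ∀ i, (c i).IsProper
  | qnode n c => 3 ≤ n ∧ ∀ i, (c i).IsProper

/-- The labels of the leaves of a tree. -/
def leaves {α : Type*} : PQTree α → Set α
  | leaf a => {a}
  | pnode _ c => ⋃ i, (c i).leaves
  | qnode _ c => ⋃ i, (c i).leaves

/-- The orderings represented by a tree: the left-to-right orders of the leaves of all trees
obtained from it by arbitrarily permuting the children of P-nodes and reversing the order of the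
children of Q-nodes. -/
def orderings {α : Type*} : PQTree α → Set (List α)
  | leaf a => {[a]}
  | pnode n c => {l | ∃ (σ : Equiv.Perm (Fin n)) (f : Fin n → List α),
      (∀ i, f i ∈ (c i).orderings) ∧ l = (List.ofFn fun i => f (σ i)).flatten}
  | qnode n c => {l | ∃ f : Fin n → List α, (∀ i, f i ∈ (c i).orderings) ∧
      (l = (List.ofFn f).flatten ∨ l = (List.ofFn fun i => f i.rev).flatten)}

/-- `IsSubtree T t`: the tree `T` consists of a node of `t` and all its descendants. -/
inductive IsSubtree {α : Type*} : PQTree α → PQTree α → Prop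
  | refl (t : PQTree α) : IsSubtree t t
  | pnode (T : PQTree α) (n : ℕ) (c : Fin n → PQTree α) (i : Fin n) :
      IsSubtree T (c i) → IsSubtree T (pnode n c)
  | qnode (T : PQTree α) (n : ℕ) (c : Fin n → PQTree α) (i : Fin n) :
      IsSubtree T (c i) → IsSubtree T (qnode n c)

end PQTree

/-- `t` is an MPQ-tree of `G`: its leaves are the maximal cliques of `G`, and it represents
exactly the consecutive orderings of the maximal cliques. The sections of its nodes, which are
determined by `G` and `t`, are defined below. -/
def IsMPQTree {V : Type*} (G : SimpleGraph V) (t : PQTree (Set V)) : Prop :=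
  t.IsProper ∧ ∀ l, l ∈ t.orderings ↔ IsConsecutiveOrdering G l

/-- The section of a leaf: the vertices in the maximal clique of the leaf and in no other
maximal clique. -/
def leafSection {V : Type*} (G : SimpleGraph V) (C : Set V) : Set V :=
  {x | x ∈ C ∧ ∀ D, IsMaxClique G D → x ∈ D → D = C}

/-- The section of a P-node: the vertices in all maximal cliques below the node and in no other
maximal clique. -/
def pSection {V : Type*} (G : SimpleGraph V) {n : ℕ} (c : Fin n → PQTree (Set V)) : Set V :=
  {x | (∀ i, ∀ C ∈ (c i).leaves, x ∈ C) ∧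
    ∀ D, IsMaxClique G D → x ∈ D → ∃ i, D ∈ (c i).leaves}

/-- The section of the `i`-th child of a Q-node: the vertices in all maximal cliques of the `i`-th
subtree and in some maximal clique of another subtree of the node, but in no maximal clique
outside the node. -/
def qSection {V : Type*} (G : SimpleGraph V) {n : ℕ} (c : Fin n → PQTree (Set V)) (i : Fin n) :
    Set V :=
  {x | (∀ C ∈ (c i).leaves, x ∈ C) ∧ (∃ j, j ≠ i ∧ ∃ C ∈ (c j).leaves, x ∈ C) ∧
    ∀ D, IsMaxClique G D → x ∈ D → ∃ k, D ∈ (c k).leaves}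

/-- The vertex set of `G[T]`: the union of the sections of all nodes of the subtree `T`. -/
def PQTree.vertices {V : Type*} (G : SimpleGraph V) : PQTree (Set V) → Set V
  | leaf C => leafSection G C
  | pnode _ c => pSection G c ∪ ⋃ i, (c i).vertices G
  | qnode _ c => (⋃ i, qSection G c i) ∪ ⋃ i, (c i).vertices G

/-! The problem is moved from intervals to positions of maximal cliques. Let a map `p` place the
maximal cliques on the line. In every representation with this ordering, x is nested in y as soon as
y has a clique on each side of all cliques of x; this is `Nest`. Conversely, endpoints can be spread
so that no other nesting occurs (`IsConsecutivePos.exists_rep`). Hence a chain of nested intervals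
is controlled by chains of `Nest`, and minimizing over representations becomes minimizing over
arrangements of the leaves of the tree. This also works for a subtree T on its own: a representation
of G[T] places the cliques below T in an order admitted by T (`IntervalRep.Realizes.isArr`). The
side `.left` collects vertices with a clique of the block to their left, so it measures the right
nesting.

The triple is then read off from tight representations. In the three auxiliary graphs, a neighbour
of u that has a private neighbour must stick out of u at one end. This pins down which vertices of G
are nested in u or v: all of them, those free on one side, or those free on the left for one vertex
and on the right for the other. If one tight representation simultaneously minimizes the overall
nesting, the minimum and the maximum of the two one-sided nestings, then these values are α, β and
γ, and the representation or its mirror image is minimal (`IntervalRep.IsTight.isMinimalRep`).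

It remains to find one arrangement that is optimal in these three quantities at all subtrees at once
(`PQTree.exists_isBest`), by induction on the tree. At a node, the leaves below a child form a
module of cliques: a vertex with cliques inside and outside has all those inside. A chain therefore
consists of vertices of a single child below some vertices of the sections of the node. The position
of the child relative to the lowest section vertex decides whether the vertices of the child are
unrestricted or have to avoid one end of the child. So the nestings of the node are monotone in
those of the children (`BlockOrd.contribution_le`), optimal children may be used up to mirroring,
and only their orientation and, at a P-node, their order has to be chosen.

Overall and one-sided nestings differ by at most one. At a Q-node this makes a lexicographic choice
of the orientations optimal in every coordinate (`exists_orientation`). At a P-node the section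
vertices span everything, and the only gain comes from the two ends: children with maximal overall
but smaller one-sided nesting go there, with the better side facing outwards
(`exists_arrangement_pnode`). -/

/-! ### Longest chains of a relation -/

section Chains

variable {V W : Type*}

/-- The length of a longest chain of `r` inside `U`. -/
noncomputable def chainLen (r : V → V → Prop) (U : Set V) : ℕ :=
  sSup {k | ∃ S : Finset V, IsChain r (S : Set V) ∧ (S : Set V) ⊆ U ∧ S.card = k}

theorem chainLen_bddAbove [Finite V] (r : V → V → Prop) (U : Set V) :
    BddAbove {k | ∃ S : Finset V, IsChain r (S : Set V) ∧ (S : Set V) ⊆ U ∧ S.card = k} := by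
  have := Fintype.ofFinite V
  exact ⟨Fintype.card V, by rintro k ⟨S, -, -, rfl⟩; exact S.card_le_univ⟩

theorem le_chainLen [Finite V] {r : V → V → Prop} {U : Set V} {S : Finset V}
    (hS : IsChain r (S : Set V)) (hU : (S : Set V) ⊆ U) : S.card ≤ chainLen r U :=
  le_csSup (chainLen_bddAbove r U) ⟨S, hS, hU, rfl⟩

theorem exists_chainLen [Finite V] (r : V → V → Prop) (U : Set V) :
    ∃ S : Finset V, IsChain r (S : Set V) ∧ (S : Set V) ⊆ U ∧ S.card = chainLen r U :=
  Nat.sSup_mem (s := {k | ∃ S : Finset V, IsChain r (S : Set V) ∧ (S : Set V) ⊆ U ∧ S.card = k})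
    ⟨0, ∅, by simp, by simp, by simp⟩ (chainLen_bddAbove r U)

theorem chainLen_le [Finite V] {r : V → V → Prop} {U : Set V} {k : ℕ}
    (h : ∀ S : Finset V, IsChain r (S : Set V) → (S : Set V) ⊆ U → S.card ≤ k) :
    chainLen r U ≤ k := by
  obtain ⟨S, hS, hU, hk⟩ := exists_chainLen r U
  exact hk ▸ h S hS hU

theorem chainLen_mono_rel [Finite V] {r s : V → V → Prop} {U U' : Set V} (hU : U ⊆ U')
    (h : ∀ x ∈ U, ∀ y ∈ U, r x y → s x y) : chainLen r U ≤ chainLen s U' := by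
  refine chainLen_le fun S hS hSU => le_chainLen ?_ (hSU.trans hU)
  intro x hx y hy hxy
  exact (hS hx hy hxy).imp (h x (hSU hx) y (hSU hy)) (h y (hSU hy) x (hSU hx))

theorem chainLen_mono [Finite V] {r : V → V → Prop} {U U' : Set V} (hU : U ⊆ U') :
    chainLen r U ≤ chainLen r U' :=
  chainLen_mono_rel hU fun _ _ _ _ h => h

theorem chainLen_congr [Finite V] {r s : V → V → Prop} {U U' : Set V} (hU : U = U')
    (h : ∀ x ∈ U, ∀ y ∈ U, r x y ↔ s x y) : chainLen r U = chainLen s U' := by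
  subst hU
  exact le_antisymm (chainLen_mono_rel subset_rfl fun x hx y hy => (h x hx y hy).1)
    (chainLen_mono_rel subset_rfl fun x hx y hy => (h x hx y hy).2)

/-- A nonempty finite chain of a transitive relation has a top element. -/
theorem IsChain.exists_top {r : V → V → Prop} (htr : ∀ x y z, r x y → r y z → r x z)
    {S : Finset V} (hS : IsChain r (S : Set V)) (hne : S.Nonempty) :
    ∃ x ∈ S, ∀ y ∈ S, y ≠ x → r y x := by
  classical
  induction hne using Finset.Nonempty.cons_induction with
  | singleton a => exact ⟨a, by simp, by simp⟩
  | cons a s ha hs ih =>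
    obtain ⟨x, hx, hxs⟩ := ih (hS.mono (by simp))
    have hax : a ≠ x := fun h => ha (h ▸ hx)
    rcases hS (x := a) (by simp) (y := x) (by simp [hx]) hax with h | h
    · refine ⟨x, by simp [hx], fun y hy hyx => ?_⟩
      rcases Finset.mem_cons.1 hy with rfl | hy
      · exact h
      · exact hxs y hy hyx
    · refine ⟨a, by simp, fun y hy hya => ?_⟩
      rcases Finset.mem_cons.1 hy with rfl | hy
      · exact absurd rfl hya
      · by_cases hyx : y = x
        · exact hyx ▸ h
        · exact htr _ _ _ (hxs y hy hyx) h

/-- A nonempty finite chain of a transitive relation has a bottom element. -/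
theorem IsChain.exists_bot {r : V → V → Prop} (htr : ∀ x y z, r x y → r y z → r x z)
    {S : Finset V} (hS : IsChain r (S : Set V)) (hne : S.Nonempty) :
    ∃ x ∈ S, ∀ y ∈ S, y ≠ x → r x y :=
  IsChain.exists_top (r := fun x y => r y x) (fun _ _ _ h h' => htr _ _ _ h' h)
    (fun _ hx _ hy hxy => (hS hx hy hxy).symm) hne

/-- Removing the top element of a chain. -/
theorem chainLen_le_succ [Finite V] {r : V → V → Prop} (htr : ∀ x y z, r x y → r y z → r x z)
    {U U' : Set V} (h : ∀ x ∈ U, ∀ y ∈ U, r y x → y ∈ U') :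
    chainLen r U ≤ chainLen r U' + 1 := by
  classical
  refine chainLen_le fun S hS hU => ?_
  rcases S.eq_empty_or_nonempty with rfl | hne
  · simp
  obtain ⟨x, hx, htop⟩ := hS.exists_top htr hne
  rw [← Finset.card_erase_add_one hx]
  refine Nat.add_le_add_right (le_chainLen (hS.mono (by simp)) fun y hy => ?_) 1
  rw [Finset.mem_coe, Finset.mem_erase] at hy
  exact h x (hU hx) y (hU hy.2) (htop y hy.2 hy.1)

/-- Adding a top element to the image of a chain. -/
theorem chainLen_succ_le [Finite V] [Finite W] {r : V → V → Prop} {s : W → W → Prop}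
    (f : V ↪ W) {U : Set V} {U' : Set W} {z : W} (hz : ∀ x ∈ U, f x ≠ z)
    (hr : ∀ x ∈ U, ∀ y ∈ U, r x y → s (f x) (f y)) (hU : ∀ x ∈ U, s (f x) z)
    (hzU : z ∈ U') (hfU : ∀ x ∈ U, f x ∈ U') :
    chainLen r U + 1 ≤ chainLen s U' := by
  classical
  obtain ⟨S, hS, hSU, hk⟩ := exists_chainLen r U
  have hzS : z ∉ S.map f := by
    simp only [Finset.mem_map, not_exists, not_and]
    exact fun x hx => hz x (hSU hx)
  rw [← hk, ← Finset.card_map f, ← Finset.card_insert_of_notMem hzS]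
  apply le_chainLen
  · rw [Finset.coe_insert]
    apply IsChain.insert
    · simp only [Finset.coe_map]
      rintro _ ⟨x, hx, rfl⟩ _ ⟨y, hy, rfl⟩ hxy
      exact (hS hx hy fun h => hxy (h ▸ rfl)).imp (hr x (hSU hx) y (hSU hy))
        (hr y (hSU hy) x (hSU hx))
    · simp only [Finset.coe_map]
      rintro _ ⟨x, hx, rfl⟩ -
      exact Or.inr (hU x (hSU hx))
  · rw [Finset.coe_insert, Finset.coe_map]
    rintro _ (rfl | ⟨x, hx, rfl⟩)
    · exact hzU
    · exact hfU x (hSU hx)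

/-- Chains in a subtype are chains inside the corresponding set. -/
theorem chainLen_subtype [Finite V] (r : V → V → Prop) (A : Set V) (U : Set V) :
    chainLen (fun x y : A => r x y) {x : A | (x : V) ∈ U} = chainLen r (A ∩ U) := by
  classical
  apply le_antisymm
  · refine chainLen_le fun S hS hU => ?_
    rw [← Finset.card_map (Function.Embedding.subtype _)]
    apply le_chainLen
    · simp only [Finset.coe_map]
      rintro _ ⟨x, hx, rfl⟩ _ ⟨y, hy, rfl⟩ hxy
      exact hS hx hy fun h => hxy (h ▸ rfl)
    · simp only [Finset.coe_map]
      rintro _ ⟨x, hx, rfl⟩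
      exact ⟨x.2, hU hx⟩
  · refine chainLen_le fun S hS hU => ?_
    have : S.card = (S.subtype (· ∈ A)).card := by
      rw [Finset.card_subtype, Finset.filter_true_of_mem fun x hx => (hU hx).1]
    rw [this]
    apply le_chainLen
    · intro x hx y hy hxy
      rw [Finset.mem_coe, Finset.mem_subtype] at hx hy
      exact hS hx hy fun h => hxy (Subtype.ext h)
    · intro x hx
      rw [Finset.mem_coe, Finset.mem_subtype] at hx
      exact (hU hx).2

/-- A strictly monotone function with values between `1` and `k` bounds the length of chains. -/
theorem chainLen_le_of_rank [Finite V] {r : V → V → Prop} {U : Set V} {k : ℕ} (f : V → ℕ)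
    (hf : ∀ x ∈ U, 1 ≤ f x ∧ f x ≤ k) (hr : ∀ x ∈ U, ∀ y ∈ U, r x y → f x < f y) :
    chainLen r U ≤ k := by
  classical
  refine chainLen_le fun S hS hU => ?_
  have h := Finset.card_le_card_of_injOn (s := S) (t := Finset.Icc 1 k) f
    (fun x hx => Finset.mem_coe.2 (Finset.mem_Icc.2 (hf x (hU hx)))) ?_
  · simpa using h
  · intro x hx y hy hxy
    by_contra hne
    rcases hS hx hy hne with h | h
    · exact (hr _ (hU hx) _ (hU hy) h).ne hxy
    · exact (hr _ (hU hy) _ (hU hx) h).ne' hxy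

/-- The length of a longest chain with largest element `x`. -/
noncomputable def topLen (r : V → V → Prop) (x : V) : ℕ :=
  sSup {k | ∃ S : Finset V, (∀ y ∈ S, ∀ z ∈ S, y ≠ z → r y z ∨ r z y) ∧ x ∈ S ∧
    (∀ y ∈ S, y ≠ x → r y x) ∧ S.card = k}

theorem topLen_eq [Finite V] (r : V → V → Prop) (x : V) :
    topLen r x = chainLen r {y | y = x ∨ r y x} := by
  classical
  have := Fintype.ofFinite V
  have hb : BddAbove {k | ∃ S : Finset V, (∀ y ∈ S, ∀ z ∈ S, y ≠ z → r y z ∨ r z y) ∧ x ∈ S ∧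
      (∀ y ∈ S, y ≠ x → r y x) ∧ S.card = k} :=
    ⟨Fintype.card V, by rintro k ⟨S, -, -, -, rfl⟩; exact S.card_le_univ⟩
  apply le_antisymm
  · refine csSup_le ⟨1, {x}, by simp, by simp, by simp, by simp⟩ ?_
    rintro k ⟨S, hS, hx, hS', rfl⟩
    refine le_chainLen (fun y hy z hz => hS y hy z hz) fun y hy => ?_
    by_cases h : y = x
    · exact Or.inl h
    · exact Or.inr (hS' y hy h)
  · refine chainLen_le fun S hS hU => ?_
    refine (Finset.card_le_card (Finset.subset_insert x S)).trans (le_csSup hb ?_)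
    refine ⟨insert x S, ?_, by simp, ?_, rfl⟩
    · intro y hy z hz hyz
      rcases Finset.mem_insert.1 hy with hy' | hy'
      · subst hy'
        rcases Finset.mem_insert.1 hz with hz' | hz'
        · exact absurd hz'.symm hyz
        · exact Or.inr ((hU hz').resolve_left fun h => hyz h.symm)
      · rcases Finset.mem_insert.1 hz with hz' | hz'
        · subst hz'
          exact Or.inl ((hU hy').resolve_left hyz)
        · exact hS hy' hz' hyz
    · intro y hy hyx
      rcases Finset.mem_insert.1 hy with rfl | hy
      · exact absurd rfl hyx
      · exact (hU hy).resolve_left hyx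

theorem one_le_topLen [Finite V] (r : V → V → Prop) (x : V) : 1 ≤ topLen r x := by
  rw [topLen_eq]
  exact le_chainLen (S := {x}) (by simp) (by simp)

/-- The largest element x extends every chain below y. This makes `topLen r` a strictly increasing
rank function, as needed for `chainLen_le_of_rank`. -/
theorem topLen_lt [Finite V] {r : V → V → Prop} (hirr : ∀ x, ¬ r x x)
    (htr : ∀ x y z, r x y → r y z → r x z) {x y : V} (h : r y x) : topLen r y < topLen r x := by
  rw [topLen_eq, topLen_eq, Nat.lt_iff_add_one_le]
  have hy : ∀ z, z = y ∨ r z y → r z x := by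
    rintro z (rfl | hz)
    exacts [h, htr _ _ _ hz h]
  refine chainLen_succ_le (Function.Embedding.refl V) (z := x) ?_ (fun _ _ _ _ h => h) hy
    (Or.inl rfl) fun z hz => Or.inr (hy z hz)
  rintro z hz rfl
  exact hirr _ (hy _ hz)

/-- On a downward closed set, the longest chains are the longest chains below its elements. -/
theorem sSup_topLen [Finite V] {r : V → V → Prop} (htr : ∀ x y z, r x y → r y z → r x z)
    (P : V → Prop) (hP : ∀ x y, r y x → P x → P y) :
    sSup {k | ∃ x, P x ∧ topLen r x = k} = chainLen r {x | P x} := by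
  have hle : ∀ x, P x → topLen r x ≤ chainLen r {x | P x} := by
    intro x hx
    rw [topLen_eq]
    refine chainLen_mono ?_
    rintro y (rfl | hy)
    exacts [hx, hP _ _ hy hx]
  have hb : BddAbove {k | ∃ x, P x ∧ topLen r x = k} :=
    ⟨chainLen r {x | P x}, by rintro _ ⟨x, hx, rfl⟩; exact hle x hx⟩
  apply le_antisymm
  · rcases Set.eq_empty_or_nonempty {k | ∃ x, P x ∧ topLen r x = k} with h | h
    · simp [h]
    · exact csSup_le h (by rintro _ ⟨x, hx, rfl⟩; exact hle x hx)
  · refine chainLen_le fun S hS hU => ?_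
    rcases S.eq_empty_or_nonempty with rfl | hne
    · simp
    obtain ⟨x, hx, htop⟩ := hS.exists_top htr hne
    refine le_trans ?_ (le_csSup hb ⟨x, hU hx, rfl⟩)
    rw [topLen_eq]
    refine le_chainLen hS fun y hy => ?_
    by_cases h : y = x
    · exact Or.inl h
    · exact Or.inr (htop y hy h)

theorem topLen_le [Finite V] {r : V → V → Prop} {U : Set V} {x : V} (hx : x ∈ U)
    (hU : ∀ y, r y x → y ∈ U) : topLen r x ≤ chainLen r U := by
  rw [topLen_eq]
  refine chainLen_mono ?_
  rintro y (rfl | hy)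
  exacts [hx, hU _ hy]

end Chains

/-! ### Nesting forced by positions of cliques -/

section Positions

variable {V α : Type*}

/-- The vertices avoiding the leftmost members of `L`: some member of `L` lies to the left of all
labels of the vertex. -/
def offLeft (K : V → Set α) (L : Set α) (p : α → ℝ) : Set V :=
  {x | ∃ C ∈ L, ∀ E ∈ K x, p C < p E}

/-- The mirror image of `offLeft`. -/
def offRight (K : V → Set α) (L : Set α) (p : α → ℝ) : Set V :=
  {x | ∃ C ∈ L, ∀ E ∈ K x, p E < p C}

/-- The nesting of `x` in `y` forced by the positions `p`. -/
def Nest (K : V → Set α) (p : α → ℝ) (x y : V) : Prop :=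
  x ∈ offLeft K (K y) p ∧ x ∈ offRight K (K y) p

/-- The vertices all of whose labels are in `L`. -/
def inside (K : V → Set α) (L : Set α) : Set V := {x | K x ⊆ L}

/-- The three ways of restricting chains of nested vertices. -/
inductive Side
  | all
  | left
  | right

/-- The vertices admitted on the side `s`. -/
def zone (K : V → Set α) (s : Side) (L : Set α) (p : α → ℝ) : Set V :=
  match s with
  | .all => Set.univ
  | .left => offLeft K L p
  | .right => offRight K L p

/-- The overall, right and left nesting of the block `L` in the arrangement `p`. -/
noncomputable def nu (K : V → Set α) (s : Side) (L : Set α) (p : α → ℝ) : ℕ :=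
  chainLen (Nest K p) (inside K L ∩ zone K s L p)

/-- The mirror image of a side. -/
def Side.flip : Side → Side
  | .all => .all
  | .left => .right
  | .right => .left

/-- Two assignments of positions order the members of `L` in the same way. -/
def OrdAgree (L : Set α) (p q : α → ℝ) : Prop :=
  ∀ C ∈ L, ∀ D ∈ L, p C < p D ↔ q C < q D

variable {K : V → Set α}

theorem OrdAgree.symm {L : Set α} {p q : α → ℝ} (h : OrdAgree L p q) : OrdAgree L q p :=
  fun C hC D hD => (h C hC D hD).symm

theorem OrdAgree.mono {L L' : Set α} {p q : α → ℝ} (h : OrdAgree L p q) (hL : L' ⊆ L) :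
    OrdAgree L' p q :=
  fun C hC D hD => h C (hL hC) D (hL hD)

theorem Nest.trans {p : α → ℝ} :
    ∀ x y z, Nest K p x y → Nest K p y z → Nest K p x z := by
  rintro x y z ⟨⟨C, hC, hCx⟩, D, hD, hDx⟩ ⟨⟨C', hC', hCy⟩, D', hD', hDy⟩
  exact ⟨⟨C', hC', fun E hE => (hCy C hC).trans (hCx E hE)⟩,
    D', hD', fun E hE => (hDx E hE).trans (hDy D hD)⟩

theorem Nest.irrefl {p : α → ℝ} (x : V) : ¬ Nest K p x x := by
  rintro ⟨⟨C, hC, hCx⟩, -⟩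
  exact lt_irrefl _ (hCx C hC)

theorem offLeft_neg (L : Set α) (p : α → ℝ) : offLeft K L (fun C => -p C) = offRight K L p := by
  simp [offLeft, offRight]

theorem offRight_neg (L : Set α) (p : α → ℝ) : offRight K L (fun C => -p C) = offLeft K L p := by
  simp [offLeft, offRight]

theorem zone_neg (s : Side) (L : Set α) (p : α → ℝ) :
    zone K s L (fun C => -p C) = zone K s.flip L p := by
  cases s <;> simp [zone, Side.flip, offLeft_neg, offRight_neg]

theorem nest_neg (p : α → ℝ) : Nest K (fun C => -p C) = Nest K p := by
  funext x y
  simp only [Nest, offLeft_neg, offRight_neg, and_comm]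

theorem nu_neg (s : Side) (L : Set α) (p : α → ℝ) :
    nu K s L (fun C => -p C) = nu K s.flip L p := by
  rw [nu, nu, zone_neg, nest_neg]

theorem zone_down {s : Side} {L : Set α} {p : α → ℝ} {x y : V}
    (hxs : x ∈ zone K s L p) (h : Nest K p y x) : y ∈ zone K s L p := by
  obtain ⟨⟨C, hC, hCy⟩, D, hD, hDy⟩ := h
  cases s with
  | all => trivial
  | left =>
    obtain ⟨B, hB, hBx⟩ := hxs
    exact ⟨B, hB, fun E hE => (hBx C hC).trans (hCy E hE)⟩
  | right =>
    obtain ⟨B, hB, hBx⟩ := hxs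
    exact ⟨B, hB, fun E hE => (hDy E hE).trans (hBx D hD)⟩

/-- The two cliques of x surrounding y belong to L, so y avoids both ends of L. Hence only the top
element of a chain can violate a side condition, which is why overall and one-sided nestings differ
by at most one. -/
theorem zone_of_nest {s : Side} {L : Set α} {p : α → ℝ} {x y : V} (hx : x ∈ inside K L)
    (h : Nest K p y x) : y ∈ zone K s L p := by
  obtain ⟨⟨C, hC, hCy⟩, D, hD, hDy⟩ := h
  cases s with
  | all => trivial
  | left => exact ⟨C, hx hC, hCy⟩
  | right => exact ⟨D, hx hD, hDy⟩

theorem OrdAgree.offLeft_iff {L M : Set α} {p q : α → ℝ} (h : OrdAgree L p q) (hM : M ⊆ L) {x : V}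
    (hx : x ∈ inside K L) : x ∈ offLeft K M p ↔ x ∈ offLeft K M q :=
  exists_congr fun C => and_congr_right fun hC =>
    forall₂_congr fun E hE => h C (hM hC) E (hx hE)

theorem OrdAgree.offRight_iff {L M : Set α} {p q : α → ℝ} (h : OrdAgree L p q) (hM : M ⊆ L) {x : V}
    (hx : x ∈ inside K L) : x ∈ offRight K M p ↔ x ∈ offRight K M q :=
  exists_congr fun C => and_congr_right fun hC =>
    forall₂_congr fun E hE => h E (hx hE) C (hM hC)

theorem OrdAgree.nu_eq [Finite V] {L : Set α} {p q : α → ℝ} (h : OrdAgree L p q) (s : Side) :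
    nu K s L p = nu K s L q := by
  refine chainLen_congr ?_ ?_
  · ext x
    refine and_congr_right fun hx => ?_
    cases s with
    | all => rfl
    | left => exact h.offLeft_iff subset_rfl hx
    | right => exact h.offRight_iff subset_rfl hx
  · rintro x ⟨hx, -⟩ y ⟨hy, -⟩
    exact and_congr (h.offLeft_iff hy hx) (h.offRight_iff hy hx)

theorem chainLen_zone_le [Finite V] (U : Set V) (s : Side) (L : Set α) (p : α → ℝ) :
    chainLen (Nest K p) (U ∩ zone K s L p) ≤ chainLen (Nest K p) (U ∩ zone K .all L p) := by
  apply chainLen_mono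
  rintro x ⟨hx, -⟩
  exact ⟨hx, trivial⟩

theorem chainLen_zone_succ [Finite V] {U : Set V} {L : Set α}
    (hU : U ⊆ inside K L) (s : Side) (p : α → ℝ) :
    chainLen (Nest K p) (U ∩ zone K .all L p) ≤ chainLen (Nest K p) (U ∩ zone K s L p) + 1 :=
  chainLen_le_succ Nest.trans fun _ hx _ hy h => ⟨hy.1, zone_of_nest (hU hx.1) h⟩

theorem nu_le_all [Finite V] (s : Side) (L : Set α) (p : α → ℝ) :
    nu K s L p ≤ nu K .all L p :=
  chainLen_zone_le _ _ _ _

theorem nu_all_le_succ [Finite V] (s : Side) (L : Set α) (p : α → ℝ) :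
    nu K .all L p ≤ nu K s L p + 1 :=
  chainLen_zone_succ subset_rfl _ _

/-! ### Arrangements of the children of a node -/

/-- Every vertex with labels inside and outside `M` has all labels in `M`. -/
def IsModular (K : V → Set α) (M : Set α) : Prop :=
  ∀ x, (K x ∩ M).Nonempty → ¬ K x ⊆ M → M ⊆ K x

variable {ι : Type*}

/-- The positions `p` arrange the sets `L i` as consecutive blocks. -/
def BlockOrd (L : ι → Set α) (p : α → ℝ) : Prop :=
  ∀ i j, i ≠ j → (∀ C ∈ L i, ∀ D ∈ L j, p C < p D) ∨ (∀ C ∈ L i, ∀ D ∈ L j, p D < p C)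

/-- The positions `p` and `q` compare members of different sets `L i` in the same way. -/
def CrossAgree (L : ι → Set α) (p q : α → ℝ) : Prop :=
  ∀ i j, i ≠ j → ∀ C ∈ L i, ∀ D ∈ L j, p C < p D ↔ q C < q D

/-- The vertices with labels in several of the sets `L i`. -/
def sec (K : V → Set α) (L : ι → Set α) : Set V :=
  inside K (⋃ i, L i) \ ⋃ i, inside K (L i)

variable {L : ι → Set α} {p q : α → ℝ}

theorem BlockOrd.neg (h : BlockOrd L p) : BlockOrd L (fun C => -p C) := by
  intro i j hij
  rcases h i j hij with h | h
  · exact Or.inr fun C hC D hD => neg_lt_neg (h C hC D hD)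
  · exact Or.inl fun C hC D hD => neg_lt_neg (h C hC D hD)

theorem CrossAgree.neg (h : CrossAgree L p q) :
    CrossAgree L (fun C => -p C) (fun C => -q C) := by
  intro i j hij C hC D hD
  simp only [neg_lt_neg_iff]
  exact h j i hij.symm D hD C hC

theorem BlockOrd.not_between (h : BlockOrd L p) {i j : ι} {C D E : α} (hij : i ≠ j)
    (hC : C ∈ L i) (hD : D ∈ L i) (hE : E ∈ L j) (hCE : p C < p E) (hED : p E < p D) : False := by
  rcases h i j hij with h | h
  · exact lt_asymm (h D hD E hE) hED
  · exact lt_asymm (h C hC E hE) hCE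

theorem BlockOrd.disjoint (h : BlockOrd L p) {i j : ι} (hij : i ≠ j) : Disjoint (L i) (L j) := by
  rw [Set.disjoint_left]
  intro C hC hC'
  rcases h i j hij with h | h
  · exact lt_irrefl _ (h C hC C hC')
  · exact lt_irrefl _ (h C hC C hC')

theorem sec_subset (hmod : ∀ i, IsModular K (L i)) {x : V} (hx : x ∈ sec K L) {i : ι} {C : α}
    (hC : C ∈ K x) (hCi : C ∈ L i) : L i ⊆ K x :=
  hmod i x ⟨C, hC, hCi⟩ fun h => hx.2 (Set.mem_iUnion.2 ⟨i, h⟩)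

/-- By modularity a section vertex has all or none of the labels of each block. A label strictly to
the left of all its labels thus lies in a block that it does not meet, and only comparisons between
different blocks occur. -/
theorem CrossAgree.lt_sec (h : CrossAgree L p q) (hmod : ∀ i, IsModular K (L i)) {x : V}
    (hx : x ∈ sec K L) {C : α} (hC : C ∈ ⋃ i, L i) (hCx : ∀ E ∈ K x, p C < p E) :
    ∀ E ∈ K x, q C < q E := by
  intro E hE
  obtain ⟨i, hi⟩ := Set.mem_iUnion.1 hC
  obtain ⟨j, hj⟩ := Set.mem_iUnion.1 (hx.1 hE)
  rcases eq_or_ne i j with rfl | hij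
  · exact absurd (hCx C (sec_subset hmod hx hE hj hi)) (lt_irrefl _)
  · exact (h i j hij C hi E hj).1 (hCx E hE)

theorem CrossAgree.offLeft_sec (h : CrossAgree L p q) (hmod : ∀ i, IsModular K (L i)) {x : V}
    (hx : x ∈ sec K L) {M : Set α} (hM : M ⊆ ⋃ i, L i) (hxM : x ∈ offLeft K M p) :
    x ∈ offLeft K M q := by
  obtain ⟨C, hC, hCx⟩ := hxM
  exact ⟨C, hC, h.lt_sec hmod hx (hM hC) hCx⟩

theorem CrossAgree.offRight_sec (h : CrossAgree L p q) (hmod : ∀ i, IsModular K (L i)) {x : V}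
    (hx : x ∈ sec K L) {M : Set α} (hM : M ⊆ ⋃ i, L i) (hxM : x ∈ offRight K M p) :
    x ∈ offRight K M q := by
  rw [← offLeft_neg] at hxM ⊢
  exact h.neg.offLeft_sec hmod hx hM hxM

theorem CrossAgree.zone_sec (h : CrossAgree L p q) (hmod : ∀ i, IsModular K (L i)) {x : V}
    (hx : x ∈ sec K L) {s : Side} (hxM : x ∈ zone K s (⋃ i, L i) p) :
    x ∈ zone K s (⋃ i, L i) q := by
  cases s with
  | all => trivial
  | left => exact h.offLeft_sec hmod hx subset_rfl hxM
  | right => exact h.offRight_sec hmod hx subset_rfl hxM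

theorem CrossAgree.nest_sec (h : CrossAgree L p q) (hmod : ∀ i, IsModular K (L i)) {x y : V}
    (hx : x ∈ sec K L) (hy : y ∈ sec K L) (hxy : Nest K p x y) : Nest K q x y :=
  ⟨h.offLeft_sec hmod hx hy.1 hxy.1, h.offRight_sec hmod hx hy.1 hxy.2⟩

/-- Otherwise a label of x in another block would lie between two members of the block of y. -/
theorem BlockOrd.not_nest (h : BlockOrd L p) {i : ι} {x y : V} (hy : y ∈ inside K (L i))
    (hx : x ∈ inside K (⋃ i, L i)) (hxi : x ∉ inside K (L i)) : ¬ Nest K p x y := by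
  rintro ⟨⟨C, hC, hCx⟩, D, hD, hDx⟩
  obtain ⟨E, hE, hEi⟩ := Set.not_subset.1 hxi
  obtain ⟨j, hj⟩ := Set.mem_iUnion.1 (hx hE)
  exact h.not_between (i := i) (j := j) (fun hij => hEi (hij ▸ hj)) (hy hC) (hy hD) hj (hCx E hE) (hDx E hE)

theorem BlockOrd.not_nest_of_ne (hK : ∀ x, (K x).Nonempty) (h : BlockOrd L p) {i j : ι}
    (hij : i ≠ j) {x y : V} (hx : x ∈ inside K (L i)) (hy : y ∈ inside K (L j)) :
    ¬ Nest K p x y := by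
  refine h.not_nest hy (hx.trans (Set.subset_iUnion L i)) fun hxj => ?_
  obtain ⟨C, hC⟩ := hK x
  exact Set.disjoint_left.1 (h.disjoint hij) (hx hC) (hxj hC)

theorem not_inside_of_sec {i : ι} {x : V} (hx : x ∈ sec K L) : x ∉ inside K (L i) :=
  fun h => hx.2 (Set.mem_iUnion.2 ⟨i, h⟩)

/-- A label outside `L i` to the left of some member of `L i` is to the left of all of them, also
for positions with the same order of blocks. -/
theorem BlockOrd.lt_transfer (hp : BlockOrd L p) (h : CrossAgree L p q) {i : ι} {C : α}
    (hC : C ∈ ⋃ i, L i) (hCi : C ∉ L i) {E : α} (hE : E ∈ L i) (hCE : p C < p E) :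
    ∀ E' ∈ L i, q C < q E' := by
  intro E' hE'
  obtain ⟨j, hj⟩ := Set.mem_iUnion.1 hC
  have hji : j ≠ i := fun hji => hCi (hji ▸ hj)
  rcases hp j i hji with h' | h'
  · exact (h j i hji C hj E' hE').1 (h' C hj E' hE')
  · exact absurd hCE (lt_asymm (h' C hj E hE))

theorem BlockOrd.gt_transfer (hp : BlockOrd L p) (h : CrossAgree L p q) {i : ι} {C : α}
    (hC : C ∈ ⋃ i, L i) (hCi : C ∉ L i) {E : α} (hE : E ∈ L i) (hCE : p E < p C) :
    ∀ E' ∈ L i, q E' < q C := by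
  have := hp.neg.lt_transfer h.neg hC hCi hE (neg_lt_neg hCE)
  exact fun E' hE' => neg_lt_neg_iff.1 (this E' hE')

/-- The vertices of a child that are nested in a fixed section vertex are described by a side,
in the same way for all positions with the same order of blocks. -/
theorem BlockOrd.exists_side (hK : ∀ x, (K x).Nonempty) (hp : BlockOrd L p)
    (h : CrossAgree L p q)
    (hmod : ∀ i, IsModular K (L i)) {i : ι} {x y₀ : V} (hx : x ∈ sec K L)
    (hy₀ : y₀ ∈ inside K (L i)) (hy₀x : Nest K p y₀ x) :
    ∃ s, (∀ y ∈ inside K (L i), Nest K p y x → y ∈ zone K s (L i) p) ∧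
      ∀ y ∈ inside K (L i), y ∈ zone K s (L i) q → Nest K q y x := by
  obtain ⟨E, hE⟩ := hK y₀
  obtain ⟨⟨C, hC, hCy⟩, D, hD, hDy⟩ := hy₀x
  have hEi : E ∈ L i := hy₀ hE
  have left_out : ∀ C ∈ K x, C ∉ L i → p C < p E → ∀ y ∈ inside K (L i), y ∈ offLeft K (K x) q :=
    fun C hC hCi hCE y hy => ⟨C, hC, fun E' hE' =>
      hp.lt_transfer h (hx.1 hC) hCi hEi hCE E' (hy hE')⟩
  have right_out : ∀ C ∈ K x, C ∉ L i → p E < p C →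
      ∀ y ∈ inside K (L i), y ∈ offRight K (K x) q :=
    fun C hC hCi hCE y hy => ⟨C, hC, fun E' hE' =>
      hp.gt_transfer h (hx.1 hC) hCi hEi hCE E' (hy hE')⟩
  -- The side depends on where x has labels outside the child: on both sides, no condition on y
  -- remains; on the left only, the child ends x on the right and y has to avoid the right end of
  -- the child; otherwise the mirror image.
  by_cases hCl : ∃ C ∈ K x, C ∉ L i ∧ p C < p E
  · obtain ⟨C', hC', hCi', hCE'⟩ := hCl
    by_cases hDr : ∃ D ∈ K x, D ∉ L i ∧ p E < p D
    · obtain ⟨D', hD', hDi', hDE'⟩ := hDr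
      exact ⟨.all, fun _ _ _ => trivial, fun y hy _ =>
        ⟨left_out C' hC' hCi' hCE' y hy, right_out D' hD' hDi' hDE' y hy⟩⟩
    · have hDi : D ∈ L i := by
        by_contra hDi
        exact hDr ⟨D, hD, hDi, hDy E hE⟩
      have hsub := sec_subset hmod hx hD hDi
      refine ⟨.right, ?_, ?_⟩
      · rintro y hy ⟨-, D', hD', hDy'⟩
        refine ⟨D', ?_, hDy'⟩
        by_contra hDi'
        obtain ⟨F, hF⟩ := hK y
        obtain ⟨j, hj⟩ := Set.mem_iUnion.1 (hx.1 hD')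
        have hji : j ≠ i := fun hji => hDi' (hji ▸ hj)
        rcases hp j i hji with h' | h'
        · exact lt_asymm (hDy' F hF) (h' D' hj F (hy hF))
        · exact hDr ⟨D', hD', hDi', h' D' hj E hEi⟩
      · rintro y hy ⟨D', hD', hDy'⟩
        exact ⟨left_out C' hC' hCi' hCE' y hy, D', hsub hD', hDy'⟩
  · have hCi : C ∈ L i := by
      by_contra hCi
      exact hCl ⟨C, hC, hCi, hCy E hE⟩
    have hsub := sec_subset hmod hx hC hCi
    obtain ⟨D', hD', hDi'⟩ := Set.not_subset.1 (not_inside_of_sec (i := i) hx)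
    have hDE' : p E < p D' := by
      obtain ⟨j, hj⟩ := Set.mem_iUnion.1 (hx.1 hD')
      have hji : j ≠ i := fun hji => hDi' (hji ▸ hj)
      rcases hp j i hji with h' | h'
      · exact absurd ⟨D', hD', hDi', h' D' hj E hEi⟩ hCl
      · exact h' D' hj E hEi
    refine ⟨.left, ?_, ?_⟩
    · rintro y hy ⟨⟨C', hC', hCy'⟩, -⟩
      refine ⟨C', ?_, hCy'⟩
      by_contra hCi'
      obtain ⟨F, hF⟩ := hK y
      obtain ⟨j, hj⟩ := Set.mem_iUnion.1 (hx.1 hC')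
      have hji : j ≠ i := fun hji => hCi' (hji ▸ hj)
      rcases hp j i hji with h' | h'
      · exact hCl ⟨C', hC', hCi', h' C' hj E hEi⟩
      · exact lt_asymm (hCy' F hF) (h' C' hj F (hy hF))
    · rintro y hy ⟨C', hC', hCy'⟩
      exact ⟨⟨C', hsub hC', hCy'⟩, right_out D' hD' hDi' hDE' y hy⟩

/-- A child that is not the first one has a whole block to its left, so all its vertices are
admitted. For the first child only its own labels can serve as witnesses. -/
theorem BlockOrd.exists_side_left (hL : ∀ i, (L i).Nonempty) (hp : BlockOrd L p)
    (h : CrossAgree L p q) (i : ι) :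
    ∃ s, (∀ y ∈ inside K (L i), y ∈ offLeft K (⋃ i, L i) p → y ∈ zone K s (L i) p) ∧
      ∀ y ∈ inside K (L i), y ∈ zone K s (L i) q → y ∈ offLeft K (⋃ i, L i) q := by
  by_cases hj : ∃ j, j ≠ i ∧ ∀ C ∈ L j, ∀ D ∈ L i, p C < p D
  · obtain ⟨j, hji, hj⟩ := hj
    obtain ⟨C, hC⟩ := hL j
    exact ⟨.all, fun _ _ _ => trivial, fun y hy _ => ⟨C, Set.mem_iUnion.2 ⟨j, hC⟩, fun E hE =>
      (h j i hji C hC E (hy hE)).1 (hj C hC E (hy hE))⟩⟩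
  · refine ⟨.left, ?_, ?_⟩
    · rintro y hy ⟨C, hC, hCy⟩
      obtain ⟨j, hjC⟩ := Set.mem_iUnion.1 hC
      rcases eq_or_ne j i with rfl | hji
      · exact ⟨C, hjC, hCy⟩
      rcases hp j i hji with h' | h'
      · exact absurd ⟨j, hji, h'⟩ hj
      · obtain ⟨D, hD⟩ := hL i
        exact ⟨D, hD, fun E hE => absurd (hCy E hE) (lt_asymm (h' C hjC E (hy hE)))⟩
    · rintro y hy ⟨C, hC, hCy⟩
      exact ⟨C, Set.mem_iUnion.2 ⟨i, hC⟩, hCy⟩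

theorem BlockOrd.exists_side_zone (hL : ∀ i, (L i).Nonempty) (hp : BlockOrd L p)
    (h : CrossAgree L p q) (i : ι) (t : Side) :
    ∃ s, (∀ y ∈ inside K (L i), y ∈ zone K t (⋃ i, L i) p → y ∈ zone K s (L i) p) ∧
      ∀ y ∈ inside K (L i), y ∈ zone K s (L i) q → y ∈ zone K t (⋃ i, L i) q := by
  cases t with
  | all => exact ⟨.all, fun _ _ _ => trivial, fun _ _ _ => trivial⟩
  | left => exact hp.exists_side_left hL h i
  | right =>
    obtain ⟨s, h₁, h₂⟩ := hp.neg.exists_side_left (K := K) hL h.neg i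
    simp only [zone_neg, offLeft_neg] at h₁ h₂
    exact ⟨s.flip, h₁, h₂⟩

/-- The contribution of the child `i` to the nestings of a node is monotone in the nestings of
the child. -/
theorem BlockOrd.contribution_le [Finite V] (hK : ∀ x, (K x).Nonempty) (hL : ∀ i, (L i).Nonempty)
    (hp : BlockOrd L p) (h : CrossAgree L p q)
    (hmod : ∀ i, IsModular K (L i)) {i : ι}
    (hnu : ∀ s, nu K s (L i) p ≤ nu K s (L i) q) (t : Side) :
    chainLen (Nest K p) ((sec K L ∪ inside K (L i)) ∩ zone K t (⋃ i, L i) p) ≤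
      chainLen (Nest K q) ((sec K L ∪ inside K (L i)) ∩ zone K t (⋃ i, L i) q) := by
  classical
  refine chainLen_le fun S hS hSU => ?_
  have hin : inside K (L i) ⊆ inside K (⋃ i, L i) := fun x hx => hx.trans (Set.subset_iUnion L i)
  set A := S.filter (· ∈ inside K (L i)) with hA
  set X := S.filter (· ∉ inside K (L i)) with hX
  have hAm : ∀ y ∈ A, y ∈ S ∧ y ∈ inside K (L i) := fun y hy => Finset.mem_filter.1 hy
  have hXm : ∀ y ∈ X, y ∈ S ∧ y ∈ sec K L := fun y hy => by
    obtain ⟨h₁, h₂⟩ := Finset.mem_filter.1 hy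
    exact ⟨h₁, (hSU h₁).1.resolve_right h₂⟩
  have hcard : A.card + X.card = S.card := Finset.card_filter_add_card_filter_not _
  have hXchain : IsChain (Nest K q) (X : Set V) := by
    intro x hx y hy hxy
    exact (hS (hXm x hx).1 (hXm y hy).1 hxy).imp
      (h.nest_sec hmod (hXm x hx).2 (hXm y hy).2) (h.nest_sec hmod (hXm y hy).2 (hXm x hx).2)
  have hXU : ∀ x ∈ X, x ∈ (sec K L ∪ inside K (L i)) ∩ zone K t (⋃ i, L i) q := fun x hx =>
    ⟨Or.inl (hXm x hx).2, h.zone_sec hmod (hXm x hx).2 (hSU (hXm x hx).1).2⟩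
  have hAX : ∀ y ∈ A, ∀ x ∈ X, Nest K p y x := by
    intro y hy x hx
    have hne : y ≠ x := fun hyx => not_inside_of_sec (hXm x hx).2 (hyx ▸ (hAm y hy).2)
    refine (hS (hAm y hy).1 (hXm x hx).1 hne).resolve_right ?_
    exact hp.not_nest (hAm y hy).2 (hXm x hx).2.1 (not_inside_of_sec (hXm x hx).2)
  -- The section part X of the chain is kept. The part A inside the child is exchanged for a chain
  -- of at least the same length that is nested under X for the new positions.
  have key : ∃ A' : Finset V, IsChain (Nest K q) (A' : Set V) ∧ (∀ y ∈ A', y ∈ inside K (L i)) ∧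
      A.card ≤ A'.card ∧ (∀ y ∈ A', ∀ x ∈ X, Nest K q y x) ∧
      ∀ y ∈ A', y ∈ zone K t (⋃ i, L i) q := by
    rcases A.eq_empty_or_nonempty with hA0 | ⟨y₀, hy₀⟩
    · exact ⟨∅, by simp, by simp, by simp [hA0], by simp, by simp⟩
    have aux : ∀ s, (∀ y ∈ A, y ∈ zone K s (L i) p) →
        ∃ A' : Finset V, IsChain (Nest K q) (A' : Set V) ∧
          (∀ y ∈ A', y ∈ inside K (L i) ∧ y ∈ zone K s (L i) q) ∧ A.card ≤ A'.card := by
      intro s hs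
      obtain ⟨A', hA'₁, hA'₂, hA'₃⟩ := exists_chainLen (Nest K q)
        (inside K (L i) ∩ zone K s (L i) q)
      refine ⟨A', hA'₁, fun y hy => hA'₂ hy, ?_⟩
      rw [hA'₃]
      refine le_trans (le_chainLen (hS.mono ?_) (U := inside K (L i) ∩ zone K s (L i) p)
        fun y hy => ⟨(hAm y hy).2, hs y hy⟩) (hnu s)
      exact fun y hy => (hAm y hy).1
    rcases X.eq_empty_or_nonempty with hX0 | hXne
    · obtain ⟨s, h₁, h₂⟩ := hp.exists_side_zone (K := K) hL h i t
      obtain ⟨A', hA'₁, hA'₂, hA'₃⟩ := aux s fun y hy =>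
        h₁ y (hAm y hy).2 (hSU (hAm y hy).1).2
      exact ⟨A', hA'₁, fun y hy => (hA'₂ y hy).1, hA'₃, by simp [hX0],
        fun y hy => h₂ y (hA'₂ y hy).1 (hA'₂ y hy).2⟩
    -- Being nested in the lowest section vertex suffices: transitivity gives the other section
    -- vertices, and downward closure gives the zone.
    · obtain ⟨x, hx, hbot⟩ := hXchain.exists_bot Nest.trans hXne
      obtain ⟨s, h₁, h₂⟩ := hp.exists_side hK h hmod (hXm x hx).2 (hAm y₀ hy₀).2 (hAX y₀ hy₀ x hx)
      obtain ⟨A', hA'₁, hA'₂, hA'₃⟩ := aux s fun y hy => h₁ y (hAm y hy).2 (hAX y hy x hx)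
      have hAx : ∀ y ∈ A', Nest K q y x := fun y hy => h₂ y (hA'₂ y hy).1 (hA'₂ y hy).2
      refine ⟨A', hA'₁, fun y hy => (hA'₂ y hy).1, hA'₃, fun y hy z hz => ?_,
        fun y hy => zone_down (hXU x hx).2 (hAx y hy)⟩
      by_cases hzx : z = x
      · exact hzx ▸ hAx y hy
      · exact Nest.trans _ _ _ (hAx y hy) (hbot z hz hzx)
  obtain ⟨A', hA'₁, hA'₂, hA'₃, hA'₄, hA'₅⟩ := key
  have hdisj : Disjoint A' X := by
    rw [Finset.disjoint_left]
    exact fun y hy hyX => not_inside_of_sec (hXm y hyX).2 (hA'₂ y hy)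
  calc S.card ≤ A'.card + X.card := by omega
    _ = (A' ∪ X).card := (Finset.card_union_of_disjoint hdisj).symm
    _ ≤ _ := by
      refine le_chainLen ?_ ?_
      · intro x hx y hy hxy
        rw [Finset.mem_coe, Finset.mem_union] at hx hy
        rcases hx with hx | hx <;> rcases hy with hy | hy
        · exact hA'₁ hx hy hxy
        · exact Or.inl (hA'₄ x hx y hy)
        · exact Or.inr (hA'₄ y hy x hx)
        · exact hXchain hx hy hxy
      · intro x hx
        rw [Finset.mem_coe, Finset.mem_union] at hx
        rcases hx with hx | hx
        · exact ⟨Or.inr (hA'₂ x hx), hA'₅ x hx⟩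
        · exact hXU x hx

/-- A chain meets at most one child of a node. -/
theorem BlockOrd.chain_subset (hK : ∀ x, (K x).Nonempty) (hp : BlockOrd L p) [Nonempty ι]
    {S : Finset V} (hS : IsChain (Nest K p) (S : Set V)) (hSU : (S : Set V) ⊆ inside K (⋃ i, L i)) :
    ∃ i, (S : Set V) ⊆ sec K L ∪ inside K (L i) := by
  by_cases h : ∃ y ∈ S, ∃ i, y ∈ inside K (L i)
  · obtain ⟨y, hy, i, hyi⟩ := h
    refine ⟨i, fun x hx => ?_⟩
    by_cases hxi : x ∈ inside K (L i)
    · exact Or.inr hxi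
    refine Or.inl ⟨hSU hx, fun hxj => ?_⟩
    obtain ⟨j, hj⟩ := Set.mem_iUnion.1 hxj
    have hij : i ≠ j := by rintro rfl; exact hxi hj
    have hxy : x ≠ y := by rintro rfl; exact hxi hyi
    rcases hS hx hy hxy with h | h
    · exact hp.not_nest_of_ne hK hij.symm hj hyi h
    · exact hp.not_nest_of_ne hK hij hyi hj h
  · refine ⟨Classical.arbitrary ι, fun x hx => Or.inl ⟨hSU hx, fun hxj => ?_⟩⟩
    obtain ⟨j, hj⟩ := Set.mem_iUnion.1 hxj
    exact h ⟨x, hx, j, hj⟩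

theorem BlockOrd.exists_nu_le [Finite V] (hK : ∀ x, (K x).Nonempty) (hp : BlockOrd L p)
    [Nonempty ι] (t : Side) :
    ∃ i, nu K t (⋃ i, L i) p ≤
      chainLen (Nest K p) ((sec K L ∪ inside K (L i)) ∩ zone K t (⋃ i, L i) p) := by
  obtain ⟨S, hS, hSU, hcard⟩ := exists_chainLen (Nest K p)
    (inside K (⋃ i, L i) ∩ zone K t (⋃ i, L i) p)
  obtain ⟨i, hi⟩ := hp.chain_subset hK hS fun x hx => (hSU hx).1
  refine ⟨i, ?_⟩
  rw [nu, ← hcard]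
  exact le_chainLen hS (Set.subset_inter hi fun x hx => (hSU hx).2)

theorem node_subset (i : ι) : sec K L ∪ inside K (L i) ⊆ inside K (⋃ i, L i) := by
  rintro x (hx | hx)
  · exact hx.1
  · exact hx.trans (Set.subset_iUnion L i)

theorem contribution_le_nu [Finite V] (i : ι) (t : Side) :
    chainLen (Nest K p) ((sec K L ∪ inside K (L i)) ∩ zone K t (⋃ i, L i) p) ≤
      nu K t (⋃ i, L i) p :=
  chainLen_mono (Set.inter_subset_inter_left _ (node_subset i))

end Positions

/-! ### Choosing the orientations of the children; Q-nodes -/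

section Combine

variable {V α ι : Type*}

/-- The arrangement with blocks `L i` in the order of the keys, each block arranged by `q i`. -/
noncomputable def comb (L : ι → Set α) (key : ι → ℤ) (q : ι → α → ℝ) (C : α) : ℝ :=
  open Classical in
  if h : ∃ i, C ∈ L i then key h.choose + Real.sigmoid (q h.choose C) else 0

variable {K : V → Set α} {L : ι → Set α} {key : ι → ℤ} {q : ι → α → ℝ}

theorem comb_eq (hdisj : ∀ i j, i ≠ j → Disjoint (L i) (L j)) {i : ι} {C : α} (hC : C ∈ L i) :
    comb L key q C = key i + Real.sigmoid (q i C) := by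
  have h : ∃ i, C ∈ L i := ⟨i, hC⟩
  have hi : h.choose = i := by
    by_contra hne
    exact Set.disjoint_left.1 (hdisj _ _ hne) h.choose_spec hC
  rw [comb, dif_pos h, hi]

theorem comb_lt (hdisj : ∀ i j, i ≠ j → Disjoint (L i) (L j)) {i j : ι} (hij : key i < key j)
    {C D : α} (hC : C ∈ L i) (hD : D ∈ L j) : comb L key q C < comb L key q D := by
  rw [comb_eq hdisj hC, comb_eq hdisj hD]
  have h₁ := Real.sigmoid_lt_one (q i C)
  have h₂ := Real.sigmoid_pos (q j D)
  have h₃ : (key i : ℝ) + 1 ≤ key j := by exact_mod_cast hij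
  linarith

theorem comb_ordAgree (hdisj : ∀ i j, i ≠ j → Disjoint (L i) (L j)) (i : ι) :
    OrdAgree (L i) (comb L key q) (q i) := by
  intro C hC D hD
  rw [comb_eq hdisj hC, comb_eq hdisj hD, add_lt_add_iff_left, Real.sigmoid_lt_iff]

theorem comb_blockOrd (hdisj : ∀ i j, i ≠ j → Disjoint (L i) (L j))
    (hkey : Function.Injective key) : BlockOrd L (comb L key q) := by
  intro i j hij
  rcases lt_or_gt_of_ne (hkey.ne hij) with h | h
  · exact Or.inl fun C hC D hD => comb_lt hdisj h hC hD
  · exact Or.inr fun C hC D hD => comb_lt hdisj h hD hC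

theorem comb_crossAgree (hdisj : ∀ i j, i ≠ j → Disjoint (L i) (L j))
    (hkey : Function.Injective key) (q' : ι → α → ℝ) :
    CrossAgree L (comb L key q) (comb L key q') := by
  intro i j hij C hC D hD
  rcases lt_or_gt_of_ne (hkey.ne hij) with h | h
  · exact iff_of_true (comb_lt hdisj h hC hD) (comb_lt hdisj h hC hD)
  · exact iff_of_false (lt_asymm (comb_lt hdisj h hD hC)) (lt_asymm (comb_lt hdisj h hD hC))

/-- The positions `p`, mirrored if `b` holds. -/
def orient (b : Bool) (p : α → ℝ) : α → ℝ := if b then fun C => -p C else p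

/-- The nestings of `p` on the block `L` are at most those of `p'`, up to mirroring. -/
def Better (K : V → Set α) (L : Set α) (p p' : α → ℝ) : Prop :=
  nu K .all L p ≤ nu K .all L p' ∧
    min (nu K .left L p) (nu K .right L p) ≤ min (nu K .left L p') (nu K .right L p') ∧
    max (nu K .left L p) (nu K .right L p) ≤ max (nu K .left L p') (nu K .right L p')

/-- Comparing minima and maxima of two pairs of numbers means that one pair is dominated by the
other coordinatewise, possibly after a swap. Mirroring performs the swap. -/
theorem Better.exists_orient {M : Set α} {p p' : α → ℝ} (h : Better K M p p') :
    ∃ b, ∀ s, nu K s M (orient b p) ≤ nu K s M p' := by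
  obtain ⟨h₁, h₂, h₃⟩ := h
  by_cases h : nu K .left M p ≤ nu K .left M p' ∧ nu K .right M p ≤ nu K .right M p'
  · refine ⟨false, fun s => ?_⟩
    cases s
    exacts [h₁, h.1, h.2]
  · refine ⟨true, fun s => ?_⟩
    simp only [orient, if_true, nu_neg]
    cases s <;> simp only [Side.flip]
    · exact h₁
    · omega
    · omega

theorem Better.neg_right {M : Set α} {p p' : α → ℝ} (h : Better K M p p') :
    Better K M p fun C => -p' C := by
  simp only [Better, nu_neg, Side.flip]
  rwa [min_comm (nu K .right M p'), max_comm (nu K .right M p')]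

theorem Better.neg_left {M : Set α} {p p' : α → ℝ} (h : Better K M p p') :
    Better K M (fun C => -p C) p' := by
  simp only [Better, nu_neg, Side.flip]
  rwa [min_comm (nu K .right M p), max_comm (nu K .right M p)]

theorem Better.congr_left [Finite V] {M : Set α} {p q p' : α → ℝ} (h : Better K M p p')
    (hpq : OrdAgree M q p) : Better K M q p' := by
  simpa only [Better, hpq.nu_eq] using h

/-- For a fixed order of the children, the children can be oriented so that the overall nesting,
the nesting on the side `s` and the maximum of the nestings on both sides are minimal. -/
theorem exists_orientation [Finite V] [Nonempty ι] (hK : ∀ x, (K x).Nonempty)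
    (hL : ∀ i, (L i).Nonempty) (hdisj : ∀ i j, i ≠ j → Disjoint (L i) (L j))
    (hmod : ∀ i, IsModular K (L i)) (hkey : Function.Injective key) (q : ι → α → ℝ) (s : Side) :
    ∃ o : ι → Bool, ∀ p', CrossAgree L (comb L key q) p' → (∀ i, Better K (L i) (q i) p') →
      nu K .all (⋃ i, L i) (comb L key fun i => orient (o i) (q i)) ≤ nu K .all (⋃ i, L i) p' ∧
      nu K s (⋃ i, L i) (comb L key fun i => orient (o i) (q i)) ≤ nu K s (⋃ i, L i) p' ∧
      nu K s.flip (⋃ i, L i) (comb L key fun i => orient (o i) (q i)) ≤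
        max (nu K s (⋃ i, L i) p') (nu K s.flip (⋃ i, L i) p') := by
  set c : (α → ℝ) → ι → Side → ℕ := fun p i t =>
    chainLen (Nest K p) ((sec K L ∪ inside K (L i)) ∩ zone K t (⋃ i, L i) p) with hc
  set P : (ι → Bool) → α → ℝ := fun o => comb L key fun i => orient (o i) (q i) with hP
  have hc₁ : ∀ p i t, c p i t ≤ c p i .all := fun p i t => chainLen_zone_le _ _ _ _
  have hc₂ : ∀ p i t, c p i .all ≤ c p i t + 1 := fun p i t =>
    chainLen_zone_succ (node_subset i) _ _
  -- Each child gets the orientation whose contribution is lexicographically least in the order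
  -- overall, side `s`, opposite side.
  have hlex : ∀ i, ∃ b : Bool, ∀ b' : Bool,
      c (P fun _ => b) i .all < c (P fun _ => b') i .all ∨
      c (P fun _ => b) i .all = c (P fun _ => b') i .all ∧
        (c (P fun _ => b) i s < c (P fun _ => b') i s ∨
          c (P fun _ => b) i s = c (P fun _ => b') i s ∧
            c (P fun _ => b) i s.flip ≤ c (P fun _ => b') i s.flip) := by
    intro i
    by_contra! hcon
    obtain ⟨b₁, h₁⟩ := hcon false
    obtain ⟨b₂, h₂⟩ := hcon true
    cases b₁ <;> cases b₂ <;> omega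
  choose o ho using hlex
  -- The contribution of a child depends only on its own orientation, so the children can be treated
  -- independently.
  have hPle : ∀ o₁ o₂ : ι → Bool, ∀ i, o₁ i = o₂ i → ∀ t, c (P o₁) i t ≤ c (P o₂) i t := by
    intro o₁ o₂ i hi t
    refine (comb_blockOrd hdisj hkey).contribution_le hK hL
      (comb_crossAgree hdisj hkey _) hmod (fun s => le_of_eq ?_) t
    rw [(comb_ordAgree hdisj i).nu_eq, (comb_ordAgree hdisj i).nu_eq, hi]
  refine ⟨o, fun p' hp' hbet => ?_⟩
  have hle : ∀ i, ∃ b, ∀ t, c (P fun _ => b) i t ≤ c p' i t := by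
    intro i
    obtain ⟨b, hb⟩ := (hbet i).exists_orient
    refine ⟨b, fun t => (comb_blockOrd hdisj hkey).contribution_le hK hL ?_ hmod (fun s => ?_) t⟩
    · intro j k hjk C hC D hD
      rw [← hp' j k hjk C hC D hD]
      exact comb_crossAgree hdisj hkey _ j k hjk C hC D hD
    · rw [(comb_ordAgree hdisj i).nu_eq]
      exact hb s
  have hnu : ∀ t, ∃ i, nu K t (⋃ i, L i) (P o) ≤ c (P fun _ => o i) i t := by
    intro t
    obtain ⟨i, hi⟩ := (comb_blockOrd (q := fun i => orient (o i) (q i)) hdisj hkey).exists_nu_le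
      hK t
    exact ⟨i, hi.trans (hPle o (fun _ => o i) i rfl t)⟩
  have hnu' : ∀ i t, c p' i t ≤ nu K t (⋃ i, L i) p' := fun i t => contribution_le_nu i t
  refine ⟨?_, ?_, ?_⟩
  · obtain ⟨i, hi⟩ := hnu .all
    obtain ⟨b, hb⟩ := hle i
    have h₁ := ho i b
    have h₂ := hb .all
    have h₃ := hnu' i .all
    change nu K .all (⋃ i, L i) (P o) ≤ _
    omega
  -- If the overall contribution is strictly smaller than that of the competing orientation, the
  -- side contribution is at most the former, hence at most the latter minus one, which is bounded
  -- by the competing side contribution.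
  · obtain ⟨i, hi⟩ := hnu s
    obtain ⟨b, hb⟩ := hle i
    have h₁ := ho i b
    have h₂ := hb s
    have h₃ := hnu' i s
    have h₄ := hc₁ (P fun _ => o i) i s
    have h₅ := hc₂ (P fun _ => b) i s
    change nu K s (⋃ i, L i) (P o) ≤ _
    omega
  -- A strict gain on side `s` may cost one on the opposite side. Even then the opposite
  -- contribution is at most that of side `s` plus one, hence at most the competing value on side
  -- `s`; this is why a maximum appears.
  · obtain ⟨i, hi⟩ := hnu s.flip
    obtain ⟨b, hb⟩ := hle i
    have h₁ := ho i b
    have h₂ := hb s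
    have h₃ := hnu' i s
    have h₂' := hb s.flip
    have h₃' := hnu' i s.flip
    have h₄ := hc₁ (P fun _ => o i) i s.flip
    have h₄' := hc₂ (P fun _ => o i) i s
    have h₅ := hc₂ (P fun _ => b) i s.flip
    change nu K s.flip (⋃ i, L i) (P o) ≤ _
    omega

theorem comb_orient_agree (hdisj : ∀ i j, i ≠ j → Disjoint (L i) (L j)) (o : ι → Bool) (i : ι) :
    OrdAgree (L i) (comb L key fun i => orient (o i) (q i)) (q i) ∨
      OrdAgree (L i) (comb L key fun i => orient (o i) (q i)) (fun C => -q i C) := by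
  have h : OrdAgree (L i) (comb L key fun i => orient (o i) (q i)) (orient (o i) (q i)) :=
    comb_ordAgree hdisj i
  cases hi : o i
  · rw [hi] at h
    exact Or.inl h
  · rw [hi] at h
    exact Or.inr h

/-- Good arrangements of the children of a Q-node combine to a good arrangement of the node. -/
theorem exists_arrangement_qnode [Finite V] {n : ℕ} {L : Fin n → Set α} [Nonempty (Fin n)]
    (hK : ∀ x, (K x).Nonempty) (hL : ∀ i, (L i).Nonempty)
    (hdisj : ∀ i j, i ≠ j → Disjoint (L i) (L j)) (hmod : ∀ i, IsModular K (L i))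
    (q : Fin n → α → ℝ) :
    ∃ p : α → ℝ, (∀ i j, i < j → ∀ C ∈ L i, ∀ D ∈ L j, p C < p D) ∧
      (∀ i, OrdAgree (L i) p (q i) ∨ OrdAgree (L i) p (fun C => -q i C)) ∧
      ∀ p' : α → ℝ, ((∀ i j, i < j → ∀ C ∈ L i, ∀ D ∈ L j, p' C < p' D) ∨
          ∀ i j, i < j → ∀ C ∈ L i, ∀ D ∈ L j, p' D < p' C) →
        (∀ i, Better K (L i) (q i) p') → Better K (⋃ i, L i) p p' := by
  set key : Fin n → ℤ := fun i => (i : ℕ) with hkeydef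
  have hkey : Function.Injective key := fun i j h => Fin.ext (by simpa [hkeydef] using h)
  have hlt : ∀ q : Fin n → α → ℝ, ∀ i j, i < j → ∀ C ∈ L i, ∀ D ∈ L j,
      comb L key q C < comb L key q D := fun q i j hij C hC D hD =>
    comb_lt hdisj (by simpa [hkeydef] using hij) hC hD
  have hcross : ∀ p' : α → ℝ, (∀ i j, i < j → ∀ C ∈ L i, ∀ D ∈ L j, p' C < p' D) →
      CrossAgree L (comb L key q) p' := by
    intro p' hp' i j hij C hC D hD
    rcases lt_or_gt_of_ne hij with h | h
    · exact iff_of_true (hlt q i j h C hC D hD) (hp' i j h C hC D hD)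
    · exact iff_of_false (lt_asymm (hlt q j i h D hD C hC)) (lt_asymm (hp' j i h D hD C hC))
  obtain ⟨o₁, ho₁⟩ := exists_orientation hK hL hdisj hmod hkey q .left
  obtain ⟨o₂, ho₂⟩ := exists_orientation hK hL hdisj hmod hkey q .right
  simp only [Side.flip] at ho₁ ho₂
  have hmain : ∃ o : Fin n → Bool, ∀ p' : α → ℝ,
      (∀ i j, i < j → ∀ C ∈ L i, ∀ D ∈ L j, p' C < p' D) →
        (∀ i, Better K (L i) (q i) p') →
        Better K (⋃ i, L i) (comb L key fun i => orient (o i) (q i)) p' := by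
    -- Favouring the left side makes the left nesting least possible, and likewise for the right
    -- side. The choice with the smaller favoured value attains the least minimum, and both choices
    -- control the maximum.
    by_cases hle : nu K .left (⋃ i, L i) (comb L key fun i => orient (o₁ i) (q i)) ≤
        nu K .right (⋃ i, L i) (comb L key fun i => orient (o₂ i) (q i))
    · refine ⟨o₁, fun p' hp' hb => ?_⟩
      have h₁ := ho₁ p' (hcross p' hp') hb
      have h₂ := ho₂ p' (hcross p' hp') hb
      exact ⟨h₁.1, by omega, by omega⟩
    · refine ⟨o₂, fun p' hp' hb => ?_⟩
      have h₁ := ho₁ p' (hcross p' hp') hb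
      have h₂ := ho₂ p' (hcross p' hp') hb
      exact ⟨h₂.1, by omega, by omega⟩
  obtain ⟨o, ho⟩ := hmain
  refine ⟨comb L key fun i => orient (o i) (q i), hlt _, comb_orient_agree hdisj o, ?_⟩
  rintro p' (hp' | hp') hb
  · exact ho p' hp' hb
  · have := ho (fun C => -p' C) (fun i j hij C hC D hD => neg_lt_neg (hp' i j hij C hC D hD))
      fun i => (hb i).neg_right
    simpa using this.neg_right

end Combine

/-! ### Ordering and orienting the children of a P-node -/

section PNode

variable {V α ι : Type*} {K : V → Set α} {L : ι → Set α}

theorem inside_subset_offLeft (hL : ∀ i, (L i).Nonempty) {p : α → ℝ} {i j : ι}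
    (h : ∀ C ∈ L j, ∀ D ∈ L i, p C < p D) : inside K (L i) ⊆ offLeft K (⋃ i, L i) p := by
  intro x hx
  obtain ⟨C, hC⟩ := hL j
  exact ⟨C, Set.mem_iUnion.2 ⟨j, hC⟩, fun E hE => h C hC E (hx hE)⟩

theorem inside_subset_offRight (hL : ∀ i, (L i).Nonempty) {p : α → ℝ} {i j : ι}
    (h : ∀ C ∈ L j, ∀ D ∈ L i, p D < p C) : inside K (L i) ⊆ offRight K (⋃ i, L i) p := by
  intro x hx
  obtain ⟨C, hC⟩ := hL j
  exact ⟨C, Set.mem_iUnion.2 ⟨j, hC⟩, fun E hE => h C hC E (hx hE)⟩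

theorem inside_subset_inside (i : ι) : inside K (L i) ⊆ inside K (⋃ i, L i) :=
  fun _ hx => hx.trans (Set.subset_iUnion L i)

/-- At a P-node a vertex meeting one child and not confined to it spans the whole node. So no
section vertex lies in a one-sided zone, and none is nested in another. -/
theorem sec_eq_of_forall (hK : ∀ x, (K x).Nonempty)
    (hP : ∀ i x, (K x ∩ L i).Nonempty → ¬ K x ⊆ L i → (⋃ j, L j) ⊆ K x) {x : V}
    (hx : x ∈ sec K L) : K x = ⋃ i, L i := by
  obtain ⟨C, hC⟩ := hK x
  obtain ⟨i, hi⟩ := Set.mem_iUnion.1 (hx.1 hC)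
  exact subset_antisymm hx.1 (hP i x ⟨C, hC, hi⟩ (not_inside_of_sec hx))

theorem offLeft_mono {M M' : Set α} (h : M ⊆ M') (p : α → ℝ) :
    offLeft K M p ⊆ offLeft K M' p :=
  fun _ ⟨C, hC, hx⟩ => ⟨C, h hC, hx⟩

theorem offRight_mono {M M' : Set α} (h : M ⊆ M') (p : α → ℝ) :
    offRight K M p ⊆ offRight K M' p :=
  fun _ ⟨C, hC, hx⟩ => ⟨C, h hC, hx⟩

/-- The vertices of a block that are nested in every vertex spanning `M`. -/
def inner (K : V → Set α) (M : Set α) (p : α → ℝ) : Set V := offLeft K M p ∩ offRight K M p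

/-- With a section vertex, a chain below it extends to a longer chain. -/
theorem chainLen_inner_succ_le [Finite V] {M : Set α} {p : α → ℝ} {z : V} (hz : K z = M) :
    chainLen (Nest K p) (inside K M ∩ inner K M p) + 1 ≤ nu K .all M p := by
  subst hz
  refine chainLen_succ_le (Function.Embedding.refl V) (z := z) ?_ (fun _ _ _ _ h => h) ?_
    ⟨Set.Subset.refl _, trivial⟩ fun x hx => ⟨hx.1, trivial⟩
  · rintro x ⟨-, hx⟩ rfl
    exact Nest.irrefl x hx
  · rintro x ⟨-, hx⟩
    exact hx

/-- A bound for the overall nesting of a P-node. -/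
theorem BlockOrd.exists_nu_all_le [Finite V] [Nonempty ι] (hK : ∀ x, (K x).Nonempty)
    (hP : ∀ i x, (K x ∩ L i).Nonempty → ¬ K x ⊆ L i → (⋃ j, L j) ⊆ K x) {p : α → ℝ}
    (hp : BlockOrd L p) :
    ∃ i, nu K .all (⋃ i, L i) p ≤
      chainLen (Nest K p) (inside K (L i) ∩ inner K (⋃ i, L i) p) + 1 := by
  obtain ⟨i, hi⟩ := hp.exists_nu_le hK .all
  refine ⟨i, hi.trans (chainLen_le_succ Nest.trans ?_)⟩
  rintro x ⟨hx, -⟩ y ⟨hy, -⟩ hyx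
  have hxin := node_subset i hx
  refine ⟨?_, offLeft_mono hxin p hyx.1, offRight_mono hxin p hyx.2⟩
  rcases hy with hy | hy
  · obtain ⟨C, hC, hCy⟩ := offLeft_mono hxin p hyx.1
    rw [sec_eq_of_forall hK hP hy] at hCy
    exact absurd (hCy C hC) (lt_irrefl _)
  · exact hy

theorem BlockOrd.exists_nu_all_le_of_sec_empty [Finite V] [Nonempty ι] (hK : ∀ x, (K x).Nonempty)
    (hsec : sec K L = ∅) {p : α → ℝ} (hp : BlockOrd L p) :
    ∃ i, nu K .all (⋃ i, L i) p ≤ nu K .all (L i) p := by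
  obtain ⟨i, hi⟩ := hp.exists_nu_le hK .all
  refine ⟨i, hi.trans (chainLen_mono ?_)⟩
  rintro x ⟨hx, -⟩
  rw [hsec, Set.empty_union] at hx
  exact ⟨hx, trivial⟩

/-- The right nesting of a P-node only involves vertices of a single child. -/
theorem BlockOrd.exists_nu_left_le [Finite V] [Nonempty ι] (hK : ∀ x, (K x).Nonempty)
    (hP : ∀ i x, (K x ∩ L i).Nonempty → ¬ K x ⊆ L i → (⋃ j, L j) ⊆ K x) {p : α → ℝ}
    (hp : BlockOrd L p) :
    ∃ i, nu K .left (⋃ i, L i) p ≤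
      chainLen (Nest K p) (inside K (L i) ∩ offLeft K (⋃ i, L i) p) := by
  obtain ⟨i, hi⟩ := hp.exists_nu_le hK .left
  refine ⟨i, hi.trans (chainLen_mono ?_)⟩
  rintro x ⟨hx | hx, hx'⟩
  · obtain ⟨C, hC, hCx⟩ := hx'
    rw [sec_eq_of_forall hK hP hx] at hCx
    exact absurd (hCx C hC) (lt_irrefl _)
  · exact ⟨hx, hx'⟩

/-- The coarse bound by the overall nesting of a child is enough on the right: the arrangement of a
P-node tries to save one on the left side only. -/
theorem BlockOrd.exists_nu_right_le [Finite V] [Nonempty ι] (hK : ∀ x, (K x).Nonempty)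
    (hP : ∀ i x, (K x ∩ L i).Nonempty → ¬ K x ⊆ L i → (⋃ j, L j) ⊆ K x) {p : α → ℝ}
    (hp : BlockOrd L p) : ∃ i, nu K .right (⋃ i, L i) p ≤ nu K .all (L i) p := by
  obtain ⟨i, hi⟩ := hp.neg.exists_nu_left_le hK hP
  rw [nu_neg, nest_neg] at hi
  exact ⟨i, hi.trans (chainLen_mono fun x hx => ⟨hx.1, trivial⟩)⟩

theorem nu_child_le [Finite V] (i : ι) (p : α → ℝ) :
    nu K .all (L i) p ≤ nu K .all (⋃ i, L i) p :=
  chainLen_mono fun _ hx => ⟨inside_subset_inside i hx.1, trivial⟩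

theorem nu_left_child_le [Finite V] (i : ι) (p : α → ℝ) :
    nu K .left (L i) p ≤ nu K .left (⋃ i, L i) p :=
  chainLen_mono fun _ hx => ⟨inside_subset_inside i hx.1,
    offLeft_mono (Set.subset_iUnion L i) p hx.2⟩

theorem nu_right_child_le [Finite V] (i : ι) (p : α → ℝ) :
    nu K .right (L i) p ≤ nu K .right (⋃ i, L i) p :=
  chainLen_mono fun _ hx => ⟨inside_subset_inside i hx.1,
    offRight_mono (Set.subset_iUnion L i) p hx.2⟩

theorem nu_le_nu_left [Finite V] (hL : ∀ i, (L i).Nonempty) {p : α → ℝ} {i j : ι}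
    (h : ∀ C ∈ L j, ∀ D ∈ L i, p C < p D) :
    nu K .all (L i) p ≤ nu K .left (⋃ i, L i) p :=
  chainLen_mono fun _ hx => ⟨inside_subset_inside i hx.1, inside_subset_offLeft hL h hx.1⟩

theorem nu_le_nu_right [Finite V] (hL : ∀ i, (L i).Nonempty) {p : α → ℝ} {i j : ι}
    (h : ∀ C ∈ L j, ∀ D ∈ L i, p D < p C) :
    nu K .all (L i) p ≤ nu K .right (⋃ i, L i) p :=
  chainLen_mono fun _ hx => ⟨inside_subset_inside i hx.1, inside_subset_offRight hL h hx.1⟩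

/-- Good arrangements of the children of a P-node combine to a good arrangement of the node. -/
theorem exists_arrangement_pnode [Finite V] {n : ℕ} (hn : 2 ≤ n) {L : Fin n → Set α}
    (hK : ∀ x, (K x).Nonempty) (hL : ∀ i, (L i).Nonempty)
    (hdisj : ∀ i j, i ≠ j → Disjoint (L i) (L j))
    (hP : ∀ i x, (K x ∩ L i).Nonempty → ¬ K x ⊆ L i → (⋃ j, L j) ⊆ K x)
    (q : Fin n → α → ℝ) :
    ∃ p : α → ℝ, BlockOrd L p ∧
      (∀ i, OrdAgree (L i) p (q i) ∨ OrdAgree (L i) p (fun C => -q i C)) ∧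
      ∀ p' : α → ℝ, BlockOrd L p' →
        (∀ i, Better K (L i) (q i) p') → Better K (⋃ i, L i) p p' := by
  have : Nonempty (Fin n) := ⟨⟨0, by omega⟩⟩
  -- the nestings of the children
  have hor : ∀ i, ∃ b, nu K .left (L i) (orient b (q i)) ≤ nu K .right (L i) (orient b (q i)) := by
    intro i
    rcases le_total (nu K .left (L i) (q i)) (nu K .right (L i) (q i)) with h | h
    · exact ⟨false, h⟩
    · refine ⟨true, ?_⟩
      simpa only [orient, if_true, nu_neg, Side.flip] using h
  choose o ho using hor
  set a : Fin n → ℕ := fun i => nu K .all (L i) (orient (o i) (q i)) with ha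
  set b : Fin n → ℕ := fun i => nu K .left (L i) (orient (o i) (q i)) with hb
  have hbet' : ∀ i p', Better K (L i) (q i) p' → a i ≤ nu K .all (L i) p' ∧
      b i ≤ nu K .left (L i) p' ∧ b i ≤ nu K .right (L i) p' := by
    intro i p' h
    have h' : Better K (L i) (orient (o i) (q i)) p' := by
      cases o i
      · exact h
      · exact h.neg_left
    obtain ⟨h₁, h₂, -⟩ := h'
    have := ho i
    have hbi : b i = nu K .left (L i) (orient (o i) (q i)) := rfl
    exact ⟨h₁, by omega, by omega⟩
  have hba : ∀ i, b i ≤ a i := fun i => nu_le_all _ _ _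
  have hab : ∀ i, a i ≤ b i + 1 := fun i => nu_all_le_succ _ _ _
  obtain ⟨m, hm⟩ := Finite.exists_max a
  -- the first and the last child
  obtain ⟨i₀, hi₀⟩ : ∃ i₀, ∀ i, a i = a m → b i < a m → a i₀ = a m ∧ b i₀ < a m := by
    by_cases h : ∃ i, a i = a m ∧ b i < a m
    · obtain ⟨i, hi⟩ := h
      exact ⟨i, fun _ _ _ => hi⟩
    · exact ⟨m, fun i h₁ h₂ => absurd ⟨i, h₁, h₂⟩ h⟩
  obtain ⟨i₁, hi₁₀, hi₁⟩ : ∃ i₁, i₁ ≠ i₀ ∧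
      ∀ i, i ≠ i₀ → a i = a m → b i < a m → a i₁ = a m ∧ b i₁ < a m := by
    by_cases h : ∃ i, i ≠ i₀ ∧ a i = a m ∧ b i < a m
    · obtain ⟨i, hi, hi'⟩ := h
      exact ⟨i, hi, fun _ _ _ _ => hi'⟩
    · have : Nontrivial (Fin n) := Fin.nontrivial_iff_two_le.2 hn
      obtain ⟨i₁, hi₁⟩ := exists_ne i₀
      exact ⟨i₁, hi₁, fun i h₁ h₂ h₃ => absurd ⟨i, h₁, h₂, h₃⟩ h⟩
  -- The values -1 and n put `i₀` before and `i₁` after all other children.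
  set key : Fin n → ℤ := fun i => if i = i₀ then -1 else if i = i₁ then n else (i : ℕ) with hkeydef
  have hkey : Function.Injective key := by
    intro i j hij
    have hi := i.2
    have hj := j.2
    simp only [hkeydef] at hij
    ext
    split_ifs at hij <;> omega
  have hkey₀ : ∀ j, j ≠ i₀ → key i₀ < key j := by
    intro j hj
    simp only [hkeydef, if_true, if_neg hj]
    split_ifs <;> omega
  have hkey₁ : ∀ j, j ≠ i₁ → key j < key i₁ := by
    intro j hj
    have := j.2
    simp only [hkeydef, if_neg hi₁₀, if_true, if_neg hj]
    split_ifs <;> omega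
  -- The last child is mirrored, so that its smaller one-sided nesting faces the right end.
  set o' : Fin n → Bool := fun i => if i = i₁ then !o i else o i with ho'
  set p : α → ℝ := comb L key fun i => orient (o' i) (q i) with hp
  have hord : BlockOrd L p := comb_blockOrd hdisj hkey
  have hpi : ∀ i s, nu K s (L i) p = nu K s (L i) (orient (o' i) (q i)) := fun i s =>
    (comb_ordAgree hdisj i).nu_eq s
  have hpa : ∀ i, nu K .all (L i) p = a i := by
    intro i
    rw [hpi]
    simp only [ho', ha]
    split_ifs with h
    · cases o i <;> simp [orient, nu_neg, Side.flip]
    · rfl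
  have hp₀ : nu K .left (L i₀) p = b i₀ := by
    rw [hpi]
    simp only [ho', if_neg hi₁₀.symm, hb]
  have hp₁ : nu K .right (L i₁) p = b i₁ := by
    rw [hpi]
    simp only [ho', if_true, hb]
    cases o i₁ <;> simp [orient, nu_neg, Side.flip]
  have hoff₀ : inside K (L i₀) ∩ offLeft K (⋃ i, L i) p ⊆ inside K (L i₀) ∩ offLeft K (L i₀) p := by
    rintro x ⟨hx, C, hC, hCx⟩
    refine ⟨hx, C, ?_, hCx⟩
    obtain ⟨j, hj⟩ := Set.mem_iUnion.1 hC
    by_cases hj₀ : j = i₀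
    · exact hj₀ ▸ hj
    obtain ⟨E, hE⟩ := hK x
    exact absurd (hCx E hE) (lt_asymm (comb_lt hdisj (hkey₀ j hj₀) (hx hE) hj))
  have hoff₁ : inside K (L i₁) ∩ offRight K (⋃ i, L i) p ⊆
      inside K (L i₁) ∩ offRight K (L i₁) p := by
    rintro x ⟨hx, C, hC, hCx⟩
    refine ⟨hx, C, ?_, hCx⟩
    obtain ⟨j, hj⟩ := Set.mem_iUnion.1 hC
    by_cases hj₁ : j = i₁
    · exact hj₁ ▸ hj
    obtain ⟨E, hE⟩ := hK x
    exact absurd (hCx E hE) (lt_asymm (comb_lt hdisj (hkey₁ j hj₁) hj (hx hE)))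
  have hchain : ∀ i U, U ⊆ inside K (L i) → chainLen (Nest K p) U ≤ a i := fun i U hU => by
    rw [← hpa i]
    exact chainLen_mono fun x hx => ⟨hU hx, trivial⟩
  refine ⟨p, hord, comb_orient_agree hdisj o', fun p' hp' hbet => ?_⟩
  have hA : ∀ i, a i ≤ nu K .all (L i) p' := fun i => (hbet' i p' (hbet i)).1
  have hBl : ∀ i, b i ≤ nu K .left (L i) p' := fun i => (hbet' i p' (hbet i)).2.1
  have hBr : ∀ i, b i ≤ nu K .right (L i) p' := fun i => (hbet' i p' (hbet i)).2.2
  have hall : a m ≤ nu K .all (⋃ i, L i) p' := (hA m).trans (nu_child_le m p')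
  have hother : ∀ i : Fin n, ∃ j, j ≠ i := fun i => by
    have : Nontrivial (Fin n) := Fin.nontrivial_iff_two_le.2 hn
    exact exists_ne i
  have hleft : nu K .left (⋃ i, L i) p ≤ a m := by
    obtain ⟨i, hi⟩ := hord.exists_nu_left_le hK hP
    exact hi.trans ((hchain i _ Set.inter_subset_left).trans (hm i))
  have hright : nu K .right (⋃ i, L i) p ≤ a m := by
    obtain ⟨i, hi⟩ := hord.exists_nu_right_le hK hP
    exact hi.trans ((hpa i).le.trans (hm i))
  refine ⟨?_, ?_, ?_⟩
  · -- overall nesting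
    rcases (sec K L).eq_empty_or_nonempty with hsec | ⟨z, hz⟩
    · obtain ⟨i, hi⟩ := hord.exists_nu_all_le_of_sec_empty hK hsec
      have h₁ := hm i
      have h₂ := hpa i
      omega
    have hz' := sec_eq_of_forall hK hP hz
    obtain ⟨i, hi⟩ := hord.exists_nu_all_le hK hP
    have hle : chainLen (Nest K p) (inside K (L i) ∩ inner K (⋃ i, L i) p) ≤ a m :=
      (hchain i _ Set.inter_subset_left).trans (hm i)
    -- With a section vertex every arrangement has overall nesting at least `a m`, and the new one
    -- has at most `a m + 1`. Only if the latter is attained must every competitor be shown to have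
    -- a chain of length `a m` below the section vertex.
    by_cases hlt : chainLen (Nest K p) (inside K (L i) ∩ inner K (⋃ i, L i) p) < a m
    · omega
    replace hle : chainLen (Nest K p) (inside K (L i) ∩ inner K (⋃ i, L i) p) = a m := by omega
    have hai : a i = a m := le_antisymm (hm i) (hle ▸ hchain i _ Set.inter_subset_left)
    suffices h : a m ≤ chainLen (Nest K p') (inside K (⋃ i, L i) ∩ inner K (⋃ i, L i) p') by
      have := chainLen_inner_succ_le (p := p') hz'
      omega
    -- Here both one-sided nestings of child `i` are large in every arrangement. Some other child
    -- frees it on one side, and the nesting for the other side supplies the chain.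
    by_cases hbi : a m ≤ b i
    · obtain ⟨j, hj⟩ := hother i
      rcases hp' j i hj with h | h
      · refine (hbi.trans (hBr i)).trans (chainLen_mono fun x hx => ?_)
        exact ⟨inside_subset_inside i hx.1, inside_subset_offLeft hL h hx.1,
          offRight_mono (Set.subset_iUnion L i) _ hx.2⟩
      · refine (hbi.trans (hBl i)).trans (chainLen_mono fun x hx => ?_)
        exact ⟨inside_subset_inside i hx.1, offLeft_mono (Set.subset_iUnion L i) _ hx.2,
          inside_subset_offRight hL h hx.1⟩
    push Not at hbi
    have hi_ne₀ : i ≠ i₀ := by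
      rintro rfl
      have : chainLen (Nest K p) (inside K (L i) ∩ inner K (⋃ i, L i) p) ≤ b i := by
        rw [← hp₀]
        exact chainLen_mono fun x hx => hoff₀ ⟨hx.1, hx.2.1⟩
      omega
    have hi_ne₁ : i ≠ i₁ := by
      rintro rfl
      have : chainLen (Nest K p) (inside K (L i) ∩ inner K (⋃ i, L i) p) ≤ b i := by
        rw [← hp₁]
        exact chainLen_mono fun x hx => hoff₁ ⟨hx.1, hx.2.2⟩
      omega
    -- Now `i`, `i₀` and `i₁` are three children of maximal overall nesting. In every order one of
    -- them is in the middle, and all its vertices are nested in the section vertex.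
    have h₀ := (hi₀ i hai hbi).1
    have h₁ := (hi₁ i hi_ne₀ hai hbi).1
    have mid : ∀ j k l, a k = a m → (∀ C ∈ L j, ∀ D ∈ L k, p' C < p' D) →
        (∀ C ∈ L l, ∀ D ∈ L k, p' D < p' C) →
        a m ≤ chainLen (Nest K p') (inside K (⋃ i, L i) ∩ inner K (⋃ i, L i) p') := by
      intro j k l hk hjk hlk
      refine (hk ▸ hA k).trans (chainLen_mono fun x hx => ?_)
      exact ⟨inside_subset_inside k hx.1, inside_subset_offLeft hL hjk hx.1,
        inside_subset_offRight hL hlk hx.1⟩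
    have swap : ∀ j k, (∀ C ∈ L j, ∀ D ∈ L k, p' C < p' D) →
        ∀ C ∈ L k, ∀ D ∈ L j, p' D < p' C := fun j k h C hC D hD => h D hD C hC
    have swap' : ∀ j k, (∀ C ∈ L j, ∀ D ∈ L k, p' D < p' C) →
        ∀ C ∈ L k, ∀ D ∈ L j, p' C < p' D := fun j k h C hC D hD => h D hD C hC
    rcases hp' i i₀ hi_ne₀ with e₁ | e₁ <;> rcases hp' i i₁ hi_ne₁ with e₂ | e₂ <;>
      rcases hp' i₀ i₁ hi₁₀.symm with e₃ | e₃
    · exact mid i i₀ i₁ h₀ e₁ (swap _ _ e₃)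
    · exact mid i i₁ i₀ h₁ e₂ e₃
    · exact mid i₁ i i₀ hai (swap' _ _ e₂) (swap _ _ e₁)
    · exact mid i₁ i i₀ hai (swap' _ _ e₂) (swap _ _ e₁)
    · exact mid i₀ i i₁ hai (swap' _ _ e₁) (swap _ _ e₂)
    · exact mid i₀ i i₁ hai (swap' _ _ e₁) (swap _ _ e₂)
    · exact mid i₀ i₁ i h₁ e₃ e₂
    · exact mid i₁ i₀ i h₀ (swap' _ _ e₃) e₁
  · -- the smaller one of the right and left nestings
    -- A left nesting below `a m` is obtained exactly when `i₀` is the only child of maximal overall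
    -- nesting and has a smaller side. No arrangement does better, since its one-sided nestings are
    -- at least its overall nesting minus one.
    by_cases hone : (a i₀ = a m ∧ b i₀ < a m) ∧ ∀ i, i ≠ i₀ → a i < a m
    · obtain ⟨⟨h₀, h₁⟩, h₂⟩ := hone
      have hl : nu K .left (⋃ i, L i) p < a m := by
        obtain ⟨i, hi⟩ := hord.exists_nu_left_le hK hP
        refine hi.trans_lt ?_
        by_cases hi₀ : i = i₀
        · subst hi₀
          refine lt_of_le_of_lt (chainLen_mono hoff₀) ?_
          exact hp₀.trans_lt h₁
        · exact (hchain i _ Set.inter_subset_left).trans_lt (h₂ i hi₀)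
      have h₃ := nu_all_le_succ (K := K) .left (⋃ i, L i) p'
      have h₄ := nu_all_le_succ (K := K) .right (⋃ i, L i) p'
      omega
    · suffices h : a m ≤ nu K .left (⋃ i, L i) p' ∧ a m ≤ nu K .right (⋃ i, L i) p' by omega
      -- With two children of maximal overall nesting, one is free on the left and the other on the
      -- right. Without a child suited for an end, child `m` has both one-sided nestings equal to `a
      -- m`.
      by_cases hsp : a i₀ = a m ∧ b i₀ < a m
      · obtain ⟨j, hj, hja⟩ : ∃ j, j ≠ i₀ ∧ a m ≤ a j := by
          by_contra! hcon
          exact hone ⟨hsp, hcon⟩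
        have h₁ := hA i₀
        have h₂ := hA j
        rcases hp' j i₀ hj with h | h
        · have h₃ := nu_le_nu_left (K := K) hL h
          have h₄ := nu_le_nu_right (K := K) hL (fun C hC D hD => h D hD C hC)
          omega
        · have h₃ := nu_le_nu_right (K := K) hL h
          have h₄ := nu_le_nu_left (K := K) hL (fun C hC D hD => h D hD C hC)
          omega
      · have hbm : a m ≤ b m := by
          by_contra! hcon
          exact hsp (hi₀ m rfl hcon)
        exact ⟨(hbm.trans (hBl m)).trans (nu_left_child_le m p'),
          (hbm.trans (hBr m)).trans (nu_right_child_le m p')⟩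
  · -- the larger one of the right and left nestings
    obtain ⟨j, hj⟩ := hother m
    have h₁ := hA m
    rcases hp' j m hj with h | h
    · have := nu_le_nu_left (K := K) hL h
      omega
    · have := nu_le_nu_right (K := K) hL h
      omega

end PNode

/-! ### Arrangements of the leaves of a tree -/

namespace PQTree

variable {V α : Type*}

/-- The positions `p` of the leaves are compatible with the tree: they arrange the subtrees of each
node as blocks, for a Q-node in the given or in the reversed order. -/
def IsArr : PQTree α → (α → ℝ) → Prop
  | leaf _, _ => True
  | pnode _ c, p => (∀ i, (c i).IsArr p) ∧ BlockOrd (fun i => (c i).leaves) p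
  | qnode _ c, p => (∀ i, (c i).IsArr p) ∧
      ((∀ i j, i < j → ∀ C ∈ (c i).leaves, ∀ D ∈ (c j).leaves, p C < p D) ∨
        ∀ i j, i < j → ∀ C ∈ (c i).leaves, ∀ D ∈ (c j).leaves, p D < p C)

/-- Different subtrees of a node have different leaves. -/
def HasDisjointLeaves : PQTree α → Prop
  | leaf _ => True
  | pnode _ c => (∀ i, (c i).HasDisjointLeaves) ∧
      ∀ i j, i ≠ j → Disjoint (c i).leaves (c j).leaves
  | qnode _ c => (∀ i, (c i).HasDisjointLeaves) ∧
      ∀ i j, i ≠ j → Disjoint (c i).leaves (c j).leaves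

/-- The labels of the vertices respect the tree: a vertex with labels inside and outside a subtree
of a node has all labels of this subtree, and all labels of the node if it is a P-node. -/
def Respects (K : V → Set α) : PQTree α → Prop
  | leaf _ => True
  | pnode _ c => (∀ i, (c i).Respects K) ∧
      ∀ i x, (K x ∩ (c i).leaves).Nonempty → ¬ K x ⊆ (c i).leaves → (⋃ j, (c j).leaves) ⊆ K x
  | qnode _ c => (∀ i, (c i).Respects K) ∧ ∀ i, IsModular K (c i).leaves

theorem IsProper.leaves_nonempty {T : PQTree α} (h : T.IsProper) : T.leaves.Nonempty := by
  induction T with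
  | leaf a => exact ⟨a, rfl⟩
  | pnode n c ih =>
    obtain ⟨C, hC⟩ := ih ⟨0, by have := h.1; omega⟩ (h.2 _)
    exact ⟨C, Set.mem_iUnion.2 ⟨_, hC⟩⟩
  | qnode n c ih =>
    obtain ⟨C, hC⟩ := ih ⟨0, by have := h.1; omega⟩ (h.2 _)
    exact ⟨C, Set.mem_iUnion.2 ⟨_, hC⟩⟩

theorem blockOrd_of_lt {n : ℕ} {L : Fin n → Set α} {p : α → ℝ}
    (h : (∀ i j, i < j → ∀ C ∈ L i, ∀ D ∈ L j, p C < p D) ∨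
        ∀ i j, i < j → ∀ C ∈ L i, ∀ D ∈ L j, p D < p C) : BlockOrd L p := by
  intro i j hij
  rcases h with h | h <;> rcases lt_or_gt_of_ne hij with hlt | hlt
  · exact Or.inl (h i j hlt)
  · exact Or.inr fun C hC D hD => h j i hlt D hD C hC
  · exact Or.inr (h i j hlt)
  · exact Or.inl fun C hC D hD => h j i hlt D hD C hC

theorem IsArr.congr {T : PQTree α} {p q : α → ℝ} (hT : T.IsArr p) (h : OrdAgree T.leaves p q) :
    T.IsArr q := by
  induction T with
  | leaf a => trivial
  | pnode n c ih =>
    have hsub : ∀ i, (c i).leaves ⊆ (pnode n c).leaves := Set.subset_iUnion _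
    refine ⟨fun i => ih i (hT.1 i) (h.mono (hsub i)), fun i j hij => ?_⟩
    exact (hT.2 i j hij).imp
      (fun h' C hC D hD => (h C (hsub i hC) D (hsub j hD)).1 (h' C hC D hD))
      (fun h' C hC D hD => (h D (hsub j hD) C (hsub i hC)).1 (h' C hC D hD))
  | qnode n c ih =>
    have hsub : ∀ i, (c i).leaves ⊆ (qnode n c).leaves := Set.subset_iUnion _
    refine ⟨fun i => ih i (hT.1 i) (h.mono (hsub i)), hT.2.imp ?_ ?_⟩
    · exact fun h' i j hij C hC D hD => (h C (hsub i hC) D (hsub j hD)).1 (h' i j hij C hC D hD)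
    · exact fun h' i j hij C hC D hD => (h D (hsub j hD) C (hsub i hC)).1 (h' i j hij C hC D hD)

theorem IsArr.neg {T : PQTree α} {p : α → ℝ} (hT : T.IsArr p) : T.IsArr fun C => -p C := by
  induction T with
  | leaf a => trivial
  | pnode n c ih => exact ⟨fun i => ih i (hT.1 i), hT.2.neg⟩
  | qnode n c ih =>
    refine ⟨fun i => ih i (hT.1 i), hT.2.symm.imp ?_ ?_⟩
    · exact fun h i j hij C hC D hD => neg_lt_neg (h i j hij C hC D hD)
    · exact fun h i j hij C hC D hD => neg_lt_neg (h i j hij C hC D hD)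

theorem IsSubtree.leaves_subset {T t : PQTree α} (h : T.IsSubtree t) : T.leaves ⊆ t.leaves := by
  induction h with
  | refl => exact subset_rfl
  | pnode n c i _ ih => exact ih.trans (Set.subset_iUnion (fun i => (c i).leaves) i)
  | qnode n c i _ ih => exact ih.trans (Set.subset_iUnion (fun i => (c i).leaves) i)

theorem IsSubtree.isArr {T t : PQTree α} (h : T.IsSubtree t) {p : α → ℝ} (hp : t.IsArr p) :
    T.IsArr p := by
  induction h with
  | refl => exact hp
  | pnode n c i _ ih => exact ih (hp.1 i)
  | qnode n c i _ ih => exact ih (hp.1 i)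

theorem IsSubtree.hasDisjointLeaves {T t : PQTree α} (h : T.IsSubtree t)
    (hp : t.HasDisjointLeaves) : T.HasDisjointLeaves := by
  induction h with
  | refl => exact hp
  | pnode n c i _ ih => exact ih (hp.1 i)
  | qnode n c i _ ih => exact ih (hp.1 i)

theorem IsSubtree.trans {T T' t : PQTree α} (h : T.IsSubtree T') (h' : T'.IsSubtree t) :
    T.IsSubtree t := by
  induction h' with
  | refl => exact h
  | pnode n c i _ ih => exact .pnode _ n c i ih
  | qnode n c i _ ih => exact .qnode _ n c i ih

/-- The arrangement `p` is best possible for the subtree `T`. -/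
def IsBest (K : V → Set α) (T : PQTree α) (p : α → ℝ) : Prop :=
  ∀ p', T.IsArr p' → Better K T.leaves p p'

/-- The minimum and the maximum of the two one-sided nestings do not change under mirroring. Hence
optimality of a subtree survives if a larger node reverses it. -/
theorem IsBest.congr [Finite V] {K : V → Set α} {T : PQTree α} {p q : α → ℝ}
    (h : T.IsBest K p) (hpq : OrdAgree T.leaves q p ∨ OrdAgree T.leaves q (fun C => -p C)) :
    T.IsBest K q := by
  intro p' hp'
  rcases hpq with hpq | hpq
  · exact (h p' hp').congr_left hpq
  · exact (h p' hp').neg_left.congr_left hpq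

/-- Every tree has an arrangement that is best possible for all subtrees. -/
theorem exists_isBest [Finite V] {K : V → Set α} (hK : ∀ x, (K x).Nonempty) (t : PQTree α)
    (hprop : t.IsProper) (hdisj : t.HasDisjointLeaves) (hres : t.Respects K) :
    ∃ p, t.IsArr p ∧ ∀ T : PQTree α, T.IsSubtree t → T.IsBest K p := by
  induction t with
  | leaf a =>
    refine ⟨fun _ => 0, trivial, fun T hT p' _ => ?_⟩
    cases hT
    have : OrdAgree (leaf a).leaves (fun _ => (0 : ℝ)) p' := by
      rintro C rfl D rfl
      simp
    exact ⟨(this.nu_eq _).le, by rw [this.nu_eq, this.nu_eq], by rw [this.nu_eq, this.nu_eq]⟩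
  | pnode n c ih =>
    choose q hq hq' using fun i => ih i (hprop.2 i) (hdisj.1 i) (hres.1 i)
    obtain ⟨p, hp₁, hp₂, hp₃⟩ := exists_arrangement_pnode hprop.1 hK
      (fun i => (hprop.2 i).leaves_nonempty) hdisj.2 hres.2 q
    refine ⟨p, ⟨fun i => ?_, hp₁⟩, fun T hT => ?_⟩
    · rcases hp₂ i with h | h
      · exact (hq i).congr h.symm
      · exact (hq i).neg.congr h.symm
    · cases hT with
      | refl => exact fun p' hp' => hp₃ p' hp'.2 fun i => hq' i _ (.refl _) p' (hp'.1 i)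
      | pnode _ _ i hT =>
        exact (hq' i T hT).congr ((hp₂ i).imp (fun h => h.mono hT.leaves_subset)
          fun h => h.mono hT.leaves_subset)
  | qnode n c ih =>
    choose q hq hq' using fun i => ih i (hprop.2 i) (hdisj.1 i) (hres.1 i)
    have : Nonempty (Fin n) := ⟨⟨0, by have := hprop.1; omega⟩⟩
    obtain ⟨p, hp₁, hp₂, hp₃⟩ := exists_arrangement_qnode hK
      (fun i => (hprop.2 i).leaves_nonempty) hdisj.2 hres.2 q
    refine ⟨p, ⟨fun i => ?_, Or.inl hp₁⟩, fun T hT => ?_⟩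
    · rcases hp₂ i with h | h
      · exact (hq i).congr h.symm
      · exact (hq i).neg.congr h.symm
    · cases hT with
      | refl => exact fun p' hp' => hp₃ p' hp'.2 fun i => hq' i _ (.refl _) p' (hp'.1 i)
      | qnode _ _ i hT =>
        exact (hq' i T hT).congr ((hp₂ i).imp (fun h => h.mono hT.leaves_subset)
          fun h => h.mono hT.leaves_subset)

/-! ### Replacing the arrangement of a subtree -/

/-- The leaves of a subtree form a block in every arrangement. -/
theorem IsSubtree.block {T t : PQTree α} (h : T.IsSubtree t) {p : α → ℝ}
    (hp : t.IsArr p) : ∀ D ∈ t.leaves, D ∉ T.leaves →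
      (∀ C ∈ T.leaves, p C < p D) ∨ (∀ C ∈ T.leaves, p D < p C) := by
  induction h with
  | refl => exact fun D hD hD' => absurd hD hD'
  | pnode n c i hT ih =>
    intro D hD hDT
    obtain ⟨j, hj⟩ := Set.mem_iUnion.1 hD
    rcases eq_or_ne i j with rfl | hij
    · exact ih (hp.1 i) D hj hDT
    · exact (hp.2 i j hij).imp (fun h C hC => h C (hT.leaves_subset hC) D hj)
        fun h C hC => h C (hT.leaves_subset hC) D hj
  | qnode n c i hT ih =>
    intro D hD hDT
    obtain ⟨j, hj⟩ := Set.mem_iUnion.1 hD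
    rcases eq_or_ne i j with rfl | hij
    · exact ih (hp.1 i) D hj hDT
    · exact (blockOrd_of_lt hp.2 i j hij).imp (fun h C hC => h C (hT.leaves_subset hC) D hj)
        fun h C hC => h C (hT.leaves_subset hC) D hj

/-- The order on the leaves in `M` can be replaced by any other one. -/
theorem exists_replace {M N : Set α} {p : α → ℝ}
    (hblock : ∀ D ∈ N, D ∉ M → (∀ C ∈ M, p C < p D) ∨ (∀ C ∈ M, p D < p C)) (p' : α → ℝ) :
    ∃ q : α → ℝ, OrdAgree M q p' ∧
      ∀ C ∈ N, ∀ D ∈ N, ¬ (C ∈ M ∧ D ∈ M) → (q C < q D ↔ p C < p D) := by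
  classical
  rcases M.eq_empty_or_nonempty with rfl | ⟨C₀, hC₀⟩
  · exact ⟨p, by simp [OrdAgree], fun _ _ _ _ _ => Iff.rfl⟩
  -- The block is squeezed into the open unit interval to the right of the position of one of its
  -- members `C₀`. Labels to the left of the block stay, and all labels to its right are moved by
  -- one.
  refine ⟨fun C => if C ∈ M then p C₀ + Real.sigmoid (p' C) else
    if p C < p C₀ then p C else p C + 1, ?_, ?_⟩
  · intro C hC D hD
    simp only [if_pos hC, if_pos hD, add_lt_add_iff_left, Real.sigmoid_lt_iff]
  · intro C hC D hD hCD
    by_cases hCM : C ∈ M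
    · have hDM : D ∉ M := fun h => hCD ⟨hCM, h⟩
      have h₁ := Real.sigmoid_lt_one (p' C)
      have h₂ := Real.sigmoid_pos (p' C)
      simp only [if_pos hCM, if_neg hDM]
      rcases hblock D hD hDM with h | h
      · rw [if_neg (lt_asymm (h C₀ hC₀))]
        exact iff_of_true (by linarith [h C₀ hC₀]) (h C hCM)
      · rw [if_pos (h C₀ hC₀)]
        exact iff_of_false (by linarith [h C₀ hC₀]) (lt_asymm (h C hCM))
    · simp only [if_neg hCM]
      by_cases hDM : D ∈ M
      · have h₁ := Real.sigmoid_lt_one (p' D)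
        have h₂ := Real.sigmoid_pos (p' D)
        simp only [if_pos hDM]
        rcases hblock C hC hCM with h | h
        · rw [if_neg (lt_asymm (h C₀ hC₀))]
          exact iff_of_false (by linarith [h C₀ hC₀]) (lt_asymm (h D hDM))
        · rw [if_pos (h C₀ hC₀)]
          exact iff_of_true (by linarith [h C₀ hC₀]) (h D hDM)
      · simp only [if_neg hDM]
        split_ifs with h₁ h₂ h₂
        · rfl
        · exact iff_of_true (by linarith) (by linarith)
        · exact iff_of_false (by linarith) (by linarith)
        · exact add_lt_add_iff_right 1

/-- Of two labels below different children of a node at most one lies below T, because the children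
have disjoint leaves. So the comparisons between children are inherited from `p`, and only the child
containing T needs the induction hypothesis. -/
theorem IsSubtree.isArr_replace {T t : PQTree α} (h : T.IsSubtree t) (hdisj : t.HasDisjointLeaves)
    {p q : α → ℝ} (hp : t.IsArr p) (hq : T.IsArr q)
    (hpq : ∀ C ∈ t.leaves, ∀ D ∈ t.leaves, ¬ (C ∈ T.leaves ∧ D ∈ T.leaves) →
      (q C < q D ↔ p C < p D)) : t.IsArr q := by
  induction h with
  | refl => exact hq
  | pnode n c i hT ih =>
    have hsub : ∀ i, (c i).leaves ⊆ (PQTree.pnode n c).leaves := Set.subset_iUnion _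
    have hnot : ∀ j, j ≠ i → ∀ C ∈ (c j).leaves, C ∉ T.leaves := fun j hj C hC hCT =>
      Set.disjoint_left.1 (hdisj.2 j i hj) hC (hT.leaves_subset hCT)
    have hcross : CrossAgree (fun i => (c i).leaves) p q := by
      intro j k hjk C hC D hD
      refine (hpq C (hsub j hC) D (hsub k hD) fun hCD => ?_).symm
      by_cases hj : j = i
      · exact hnot k (fun hk => hjk (hj.trans hk.symm)) D hD hCD.2
      · exact hnot j hj C hC hCD.1
    refine ⟨fun j => ?_, fun j k hjk => (hp.2 j k hjk).imp ?_ ?_⟩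
    · by_cases hj : j = i
      · subst hj
        exact ih (hdisj.1 j) (hp.1 j) fun C hC D hD h => hpq C (hsub j hC) D (hsub j hD) h
      · exact (hp.1 j).congr fun C hC D hD =>
          (hpq C (hsub j hC) D (hsub j hD) fun h => hnot j hj C hC h.1).symm
    · exact fun h C hC D hD => (hcross j k hjk C hC D hD).1 (h C hC D hD)
    · exact fun h C hC D hD => (hcross k j hjk.symm D hD C hC).1 (h C hC D hD)
  | qnode n c i hT ih =>
    have hsub : ∀ i, (c i).leaves ⊆ (PQTree.qnode n c).leaves := Set.subset_iUnion _
    have hnot : ∀ j, j ≠ i → ∀ C ∈ (c j).leaves, C ∉ T.leaves := fun j hj C hC hCT =>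
      Set.disjoint_left.1 (hdisj.2 j i hj) hC (hT.leaves_subset hCT)
    have hcross : CrossAgree (fun i => (c i).leaves) p q := by
      intro j k hjk C hC D hD
      refine (hpq C (hsub j hC) D (hsub k hD) fun hCD => ?_).symm
      by_cases hj : j = i
      · exact hnot k (fun hk => hjk (hj.trans hk.symm)) D hD hCD.2
      · exact hnot j hj C hC hCD.1
    refine ⟨fun j => ?_, hp.2.imp ?_ ?_⟩
    · by_cases hj : j = i
      · subst hj
        exact ih (hdisj.1 j) (hp.1 j) fun C hC D hD h => hpq C (hsub j hC) D (hsub j hD) h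
      · exact (hp.1 j).congr fun C hC D hD =>
          (hpq C (hsub j hC) D (hsub j hD) fun h => hnot j hj C hC h.1).symm
    · exact fun h j k hjk C hC D hD => (hcross j k hjk.ne C hC D hD).1 (h j k hjk C hC D hD)
    · exact fun h j k hjk C hC D hD => (hcross k j hjk.ne' D hD C hC).1 (h j k hjk C hC D hD)

/-- An arrangement of a subtree extends to an arrangement of the tree. -/
theorem IsSubtree.exists_isArr {T t : PQTree α} (h : T.IsSubtree t) (hdisj : t.HasDisjointLeaves)
    {p p' : α → ℝ} (hp : t.IsArr p) (hp' : T.IsArr p') :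
    ∃ q, t.IsArr q ∧ OrdAgree T.leaves q p' ∧
      ∀ C ∈ t.leaves, ∀ D ∈ t.leaves, ¬ (C ∈ T.leaves ∧ D ∈ T.leaves) →
        (q C < q D ↔ p C < p D) := by
  obtain ⟨q, hq, hqp⟩ := exists_replace (h.block hp) p'
  exact ⟨q, h.isArr_replace hdisj hp (hp'.congr hq.symm) hqp, hq, hqp⟩

end PQTree

/-! ### Orderings and arrangements -/

section Lists

variable {α : Type*}

theorem pairwise_flatten_ofFn {n : ℕ} {g : Fin n → List α} {R : α → α → Prop} :
    (List.ofFn g).flatten.Pairwise R ↔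
      (∀ i, (g i).Pairwise R) ∧ ∀ i j, i < j → ∀ x ∈ g i, ∀ y ∈ g j, R x y := by
  rw [List.pairwise_flatten, List.pairwise_ofFn]
  simp only [List.mem_ofFn, forall_exists_index, forall_apply_eq_imp_iff]

theorem mem_flatten_ofFn {n : ℕ} {g : Fin n → List α} {a : α} :
    a ∈ (List.ofFn g).flatten ↔ ∃ i, a ∈ g i := by
  simp [List.mem_flatten, List.mem_ofFn]

namespace PQTree

theorem mem_of_mem_orderings {T : PQTree α} : ∀ {l : List α}, l ∈ T.orderings →
    ∀ a, a ∈ l ↔ a ∈ T.leaves := by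
  induction T with
  | leaf b =>
    rintro l rfl a
    simp [leaves]
  | pnode n c ih =>
    rintro l ⟨σ, f, hf, rfl⟩ a
    rw [mem_flatten_ofFn, leaves, Set.mem_iUnion,
      ← σ.exists_congr_right (q := fun i => a ∈ (c i).leaves)]
    exact exists_congr fun i => ih _ (hf _) a
  | qnode n c ih =>
    rintro l ⟨f, hf, rfl | rfl⟩ a
    · rw [mem_flatten_ofFn, leaves, Set.mem_iUnion]
      exact exists_congr fun i => ih _ (hf _) a
    · rw [mem_flatten_ofFn, leaves, Set.mem_iUnion,
        ← Fin.revPerm.exists_congr_right (q := fun i => a ∈ (c i).leaves)]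
      exact exists_congr fun i => ih _ (hf _) a

theorem orderings_nonempty (T : PQTree α) : T.orderings.Nonempty := by
  induction T with
  | leaf b => exact ⟨[b], rfl⟩
  | pnode n c ih =>
    choose f hf using ih
    exact ⟨_, 1, f, hf, rfl⟩
  | qnode n c ih =>
    choose f hf using ih
    exact ⟨_, f, hf, Or.inl rfl⟩

theorem isArr_of_pairwise {p : α → ℝ} {T : PQTree α} : ∀ {l : List α}, l ∈ T.orderings →
    l.Pairwise (fun a b => p a < p b) → T.IsArr p := by
  induction T with
  | leaf b => exact fun _ _ => trivial
  | pnode n c ih =>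
    rintro l ⟨σ, f, hf, rfl⟩ hl
    obtain ⟨h₁, h₂⟩ := pairwise_flatten_ofFn.1 hl
    refine ⟨fun i => ?_, fun i j hij => ?_⟩
    · have := h₁ (σ.symm i)
      rw [σ.apply_symm_apply] at this
      exact ih i (hf i) this
    · have hij' : σ.symm i ≠ σ.symm j := σ.symm.injective.ne hij
      rcases lt_or_gt_of_ne hij' with h | h
      · have := h₂ _ _ h
        simp only [σ.apply_symm_apply] at this
        exact Or.inl fun C hC D hD => this C ((mem_of_mem_orderings (hf i) C).2 hC) D
          ((mem_of_mem_orderings (hf j) D).2 hD)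
      · have := h₂ _ _ h
        simp only [σ.apply_symm_apply] at this
        exact Or.inr fun C hC D hD => this D ((mem_of_mem_orderings (hf j) D).2 hD) C
          ((mem_of_mem_orderings (hf i) C).2 hC)
  | qnode n c ih =>
    rintro l ⟨f, hf, rfl | rfl⟩ hl
    · obtain ⟨h₁, h₂⟩ := pairwise_flatten_ofFn.1 hl
      exact ⟨fun i => ih i (hf i) (h₁ i), Or.inl fun i j hij C hC D hD =>
        h₂ i j hij C ((mem_of_mem_orderings (hf i) C).2 hC) D
          ((mem_of_mem_orderings (hf j) D).2 hD)⟩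
    · obtain ⟨h₁, h₂⟩ := pairwise_flatten_ofFn.1 hl
      refine ⟨fun i => ih i (hf i) ?_, Or.inr fun i j hij C hC D hD => ?_⟩
      · have := h₁ i.rev
        rwa [Fin.rev_rev] at this
      · have := h₂ j.rev i.rev (Fin.rev_lt_rev.2 hij)
        simp only [Fin.rev_rev] at this
        exact this D ((mem_of_mem_orderings (hf j) D).2 hD) C
          ((mem_of_mem_orderings (hf i) C).2 hC)

theorem exists_pairwise_of_isArr {p : α → ℝ} {T : PQTree α} (hprop : T.IsProper)
    (hp : T.IsArr p) : ∃ l ∈ T.orderings, l.Pairwise (fun a b => p a < p b) := by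
  induction T with
  | leaf b => exact ⟨[b], rfl, by simp⟩
  | pnode n c ih =>
    choose f hf hf' using fun i => ih i (hprop.2 i) (hp.1 i)
    choose r hr using fun i => (hprop.2 i).leaves_nonempty
    -- The children form blocks, so sorting one representative leaf of each child sorts the blocks.
    refine ⟨_, ⟨Tuple.sort fun i => p (r i), f, hf, rfl⟩, ?_⟩
    rw [pairwise_flatten_ofFn]
    refine ⟨fun i => hf' _, fun i j hij x hx y hy => ?_⟩
    have hle := Tuple.monotone_sort (fun i => p (r i)) hij.le
    set σ := Tuple.sort fun i => p (r i)
    rw [mem_of_mem_orderings (hf _)] at hx hy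
    rcases hp.2 (σ i) (σ j) (σ.injective.ne hij.ne) with h | h
    · exact h x hx y hy
    · exact absurd hle (not_le.2 (h _ (hr _) _ (hr _)))
  | qnode n c ih =>
    choose f hf hf' using fun i => ih i (hprop.2 i) (hp.1 i)
    rcases hp.2 with h | h
    · refine ⟨_, ⟨f, hf, Or.inl rfl⟩, ?_⟩
      rw [pairwise_flatten_ofFn]
      refine ⟨fun i => hf' _, fun i j hij x hx y hy => ?_⟩
      rw [mem_of_mem_orderings (hf _)] at hx hy
      exact h i j hij x hx y hy
    · refine ⟨_, ⟨f, hf, Or.inr rfl⟩, ?_⟩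
      rw [pairwise_flatten_ofFn]
      refine ⟨fun i => hf' _, fun i j hij x hx y hy => ?_⟩
      rw [mem_of_mem_orderings (hf _)] at hx hy
      exact h _ _ (Fin.rev_lt_rev.2 hij) y hy x hx

theorem disjoint_of_nodup {n : ℕ} {c : Fin n → PQTree α} {g : Fin n → List α}
    (hg : ∀ i, g i ∈ (c i).orderings) (hnd : (List.ofFn g).flatten.Nodup) :
    ∀ i j, i ≠ j → Disjoint (c i).leaves (c j).leaves := by
  obtain ⟨-, h⟩ := pairwise_flatten_ofFn.1 hnd
  intro i j hij
  rw [Set.disjoint_left]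
  intro C hi hj
  rw [← mem_of_mem_orderings (hg _)] at hi hj
  rcases lt_or_gt_of_ne hij with hlt | hlt
  · exact h i j hlt C hi C hj rfl
  · exact h j i hlt C hj C hi rfl

/-- Any ordering of one child can be combined with fixed orderings of the other children into an
ordering of the node. Thus the absence of repetitions passes to the children, and different children
share no leaf. -/
theorem hasDisjointLeaves_of_nodup {T : PQTree α} (h : ∀ l ∈ T.orderings, l.Nodup) :
    T.HasDisjointLeaves := by
  classical
  induction T with
  | leaf b => trivial
  | pnode n c ih =>
    choose f hf using fun i => (c i).orderings_nonempty
    have key : ∀ g : Fin n → List α, (∀ i, g i ∈ (c i).orderings) →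
        (List.ofFn g).flatten.Nodup := fun g hg => h _ ⟨1, g, hg, rfl⟩
    refine ⟨fun i => ih i fun l hl => ?_, disjoint_of_nodup hf (key f hf)⟩
    have := (pairwise_flatten_ofFn.1 (key (Function.update f i l) fun j => by
      by_cases hj : j = i
      · subst hj
        simpa using hl
      · simpa [hj] using hf j)).1 i
    rwa [Function.update_self] at this
  | qnode n c ih =>
    choose f hf using fun i => (c i).orderings_nonempty
    have key : ∀ g : Fin n → List α, (∀ i, g i ∈ (c i).orderings) →
        (List.ofFn g).flatten.Nodup := fun g hg => h _ ⟨g, hg, Or.inl rfl⟩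
    refine ⟨fun i => ih i fun l hl => ?_, disjoint_of_nodup hf (key f hf)⟩
    have := (pairwise_flatten_ofFn.1 (key (Function.update f i l) fun j => by
      by_cases hj : j = i
      · subst hj
        simpa using hl
      · simpa [hj] using hf j)).1 i
    rwa [Function.update_self] at this

end PQTree

end Lists

/-! ### MPQ-trees -/

section MPQ

variable {V : Type*} {G : SimpleGraph V}

/-- The maximal cliques containing the vertex `x`. -/
def cliquesOf (G : SimpleGraph V) (x : V) : Set (Set V) := {C | IsMaxClique G C ∧ x ∈ C}

/-- The positions `p` order the maximal cliques consecutively. -/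
def IsConsecutivePos (G : SimpleGraph V) (p : Set V → ℝ) : Prop :=
  (∀ C D, IsMaxClique G C → IsMaxClique G D → p C = p D → C = D) ∧
    ∀ x C D E, IsMaxClique G C → IsMaxClique G D → IsMaxClique G E → p C ≤ p D → p D ≤ p E →
      x ∈ C → x ∈ E → x ∈ D

theorem exists_maxClique_of_isClique [Finite V] {S : Set V} (hS : G.IsClique S) :
    ∃ C, IsMaxClique G C ∧ S ⊆ C := by
  obtain ⟨C, hSC, hC⟩ := (Set.toFinite {C : Set V | G.IsClique C}).exists_le_maximal hS
  exact ⟨C, hC, hSC⟩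

theorem cliquesOf_nonempty [Finite V] (G : SimpleGraph V) (x : V) : (cliquesOf G x).Nonempty := by
  obtain ⟨C, hC, hx⟩ := exists_maxClique_of_isClique (G := G) (S := {x}) (by simp)
  exact ⟨C, hC, hx rfl⟩

theorem IsConsecutiveOrdering.isConsecutivePos {l : List (Set V)} (h : IsConsecutiveOrdering G l)
    {p : Set V → ℝ} (hl : l.Pairwise fun C D => p C < p D) : IsConsecutivePos G p := by
  obtain ⟨-, hmem, hcon⟩ := h
  rw [List.pairwise_iff_get] at hl
  have hmono : StrictMono fun i => p (l.get i) := fun i j hij => hl i j hij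
  constructor
  · intro C D hC hD hCD
    obtain ⟨i, rfl⟩ := List.mem_iff_get.1 ((hmem C).2 hC)
    obtain ⟨j, rfl⟩ := List.mem_iff_get.1 ((hmem D).2 hD)
    rw [hmono.injective hCD]
  · intro x C D E hC hD hE hCD hDE hxC hxE
    obtain ⟨i, rfl⟩ := List.mem_iff_get.1 ((hmem C).2 hC)
    obtain ⟨j, rfl⟩ := List.mem_iff_get.1 ((hmem D).2 hD)
    obtain ⟨k, rfl⟩ := List.mem_iff_get.1 ((hmem E).2 hE)
    exact hcon x i j k (hmono.le_iff_le.1 hCD) (hmono.le_iff_le.1 hDE) hxC hxE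

theorem IsConsecutivePos.exists_ordering [Finite V] {p : Set V → ℝ} (hp : IsConsecutivePos G p) :
    ∃ l, IsConsecutiveOrdering G l ∧ l.Pairwise fun C D => p C < p D := by
  classical
  obtain ⟨hinj, hcon⟩ := hp
  set r : Set V → Set V → Prop := fun C D => p C ≤ p D with hr
  have : Std.Total r := ⟨fun C D => le_total _ _⟩
  have : IsTrans (Set V) r := ⟨fun C D E h h' => le_trans h h'⟩
  set l := (Set.toFinite {C | IsMaxClique G C}).toFinset.toList.insertionSort r with hldef
  have hmem : ∀ C, C ∈ l ↔ IsMaxClique G C := fun C => by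
    simp [hldef, List.mem_insertionSort]
  have hnd : l.Nodup := (List.perm_insertionSort r _).nodup_iff.2 (Finset.nodup_toList _)
  have hle : l.Pairwise r := List.pairwise_insertionSort r _
  have hlt : l.Pairwise fun C D => p C < p D := by
    refine (List.Pairwise.and_mem.1 (hle.and hnd)).imp ?_
    rintro C D ⟨hC, hD, h₁, h₂⟩
    exact lt_of_le_of_ne h₁ fun h => h₂ (hinj C D ((hmem C).1 hC) ((hmem D).1 hD) h)
  refine ⟨l, ⟨hnd, hmem, fun x i j k hij hjk hi hk => ?_⟩, hlt⟩
  rw [List.pairwise_iff_get] at hlt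
  have hmono : StrictMono fun i => p (l.get i) := fun i j hij => hlt i j hij
  have hmax : ∀ i, IsMaxClique G (l.get i) := fun i => (hmem _).1 (List.get_mem l i)
  exact hcon x _ _ _ (hmax i) (hmax j) (hmax k) (hmono.monotone hij) (hmono.monotone hjk) hi hk

namespace IsMPQTree

variable {t : PQTree (Set V)}

/-- The defining property of the tree in terms of positions. It is used in both directions:
operations on the tree yield consecutive positions, and consecutive positions respect the tree. -/
theorem isArr_iff [Finite V] (ht : IsMPQTree G t) {p : Set V → ℝ} :
    t.IsArr p ↔ IsConsecutivePos G p := by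
  constructor
  · intro hp
    obtain ⟨l, hl, hlp⟩ := PQTree.exists_pairwise_of_isArr ht.1 hp
    exact ((ht.2 l).1 hl).isConsecutivePos hlp
  · intro hp
    obtain ⟨l, hl, hlp⟩ := hp.exists_ordering
    exact PQTree.isArr_of_pairwise ((ht.2 l).2 hl) hlp

theorem mem_leaves (ht : IsMPQTree G t) {C : Set V} : C ∈ t.leaves ↔ IsMaxClique G C := by
  obtain ⟨l, hl⟩ := t.orderings_nonempty
  rw [← PQTree.mem_of_mem_orderings hl, ((ht.2 l).1 hl).2.1]

theorem hasDisjointLeaves (ht : IsMPQTree G t) : t.HasDisjointLeaves :=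
  PQTree.hasDisjointLeaves_of_nodup fun l hl => ((ht.2 l).1 hl).1

theorem exists_isArr (ht : IsMPQTree G t) : ∃ p, t.IsArr p := by
  classical
  obtain ⟨l, hl⟩ := t.orderings_nonempty
  have hnd := ((ht.2 l).1 hl).1
  refine ⟨fun C => (l.idxOf C : ℝ), PQTree.isArr_of_pairwise hl ?_⟩
  rw [List.pairwise_iff_get]
  intro i j hij
  rw [Nat.cast_lt, List.get_eq_getElem, List.get_eq_getElem, hnd.idxOf_getElem,
    hnd.idxOf_getElem]
  exact hij

/-- The leaves of a subtree form a module of maximal cliques. -/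
theorem isModular [Finite V] (ht : IsMPQTree G t) {T : PQTree (Set V)} (hT : T.IsSubtree t) :
    IsModular (cliquesOf G) T.leaves := by
  rintro x ⟨C, ⟨hC, hxC⟩, hCT⟩ hx
  obtain ⟨D, ⟨hD, hxD⟩, hDT⟩ := Set.not_subset.1 hx
  intro E hET
  have hE := ht.mem_leaves.1 (hT.leaves_subset hET)
  refine ⟨hE, ?_⟩
  have key : ∀ p, t.IsArr p → (∀ C ∈ T.leaves, p D < p C) → x ∈ E := by
    intro p hp hDp
    -- If E lies between D and C, consecutiveness applies. Otherwise the order inside T is mirrored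
    -- while D is kept in place, which brings E between D and C.
    rcases le_total (p E) (p C) with h | h
    · exact ((ht.isArr_iff.1 hp).2 x D E C hD hE hC (hDp E hET).le h hxD hxC)
    · obtain ⟨q, hq, hq₁, hq₂⟩ :=
        hT.exists_isArr ht.hasDisjointLeaves hp (hT.isArr hp).neg
      refine (ht.isArr_iff.1 hq).2 x D E C hD hE hC ?_ ?_ hxD hxC
      · exact ((hq₂ D (ht.mem_leaves.2 hD) E (hT.leaves_subset hET) fun h => hDT h.1).2
          (hDp E hET)).le
      · rw [← not_lt, hq₁ C hCT E hET]
        simpa using h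
  obtain ⟨p, hp⟩ := ht.exists_isArr
  rcases hT.block hp D (ht.mem_leaves.2 hD) hDT with h | h
  · exact key _ hp.neg fun C hC => neg_lt_neg (h C hC)
  · exact key _ hp h

/-- A vertex with cliques below several children of a P-node is in all cliques below the node. -/
theorem leaves_pnode_subset [Finite V] (ht : IsMPQTree G t) {n : ℕ} {c : Fin n → PQTree (Set V)}
    (hT : (PQTree.pnode n c).IsSubtree t) (i : Fin n) (x : V)
    (hi : (cliquesOf G x ∩ (c i).leaves).Nonempty) (hx : ¬ cliquesOf G x ⊆ (c i).leaves) :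
    (⋃ j, (c j).leaves) ⊆ cliquesOf G x := by
  have hchild : ∀ j, IsModular (cliquesOf G) (c j).leaves := fun j =>
    ht.isModular ((PQTree.IsSubtree.pnode _ n c j (.refl _)).trans hT)
  obtain ⟨C, hC, hCi⟩ := hi
  obtain ⟨D, hD, hDi⟩ := Set.not_subset.1 hx
  by_cases hDT : D ∈ (PQTree.pnode n c).leaves
  swap
  · exact ht.isModular hT x ⟨C, hC, Set.mem_iUnion.2 ⟨i, hCi⟩⟩ fun h => hDT (h hD)
  obtain ⟨j, hDj⟩ := Set.mem_iUnion.1 hDT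
  have hji : j ≠ i := fun h => hDi (h ▸ hDj)
  have hdisj := (hT.hasDisjointLeaves ht.hasDisjointLeaves).2
  intro E hET
  obtain ⟨k, hEk⟩ := Set.mem_iUnion.1 hET
  by_cases hki : k = i
  · subst hki
    exact hchild k x ⟨C, hC, hCi⟩ hx hEk
  by_cases hkj : k = j
  · subst hkj
    exact hchild k x ⟨D, hD, hDj⟩ (fun h => Set.disjoint_left.1 (hdisj _ _ hki) (h hC) hCi) hEk
  have hE := ht.mem_leaves.1 (hT.leaves_subset hET)
  refine ⟨hE, ?_⟩
  obtain ⟨p, hp⟩ := ht.exists_isArr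
  -- The children of the P-node are permuted so that child `k` is between `i`, moved to the front,
  -- and `j`, moved to the end. Consecutiveness then puts x into E.
  set key : Fin n → ℤ := fun m => if m = i then -1 else if m = j then n else (m : ℕ) with hkeydef
  have hkey : Function.Injective key := by
    intro m m' hm
    have h₁ := m.2
    have h₂ := m'.2
    simp only [hkeydef] at hm
    ext
    split_ifs at hm <;> omega
  have hik : key i < key k := by
    simp only [hkeydef, if_true, if_neg hki, if_neg hkj]
    omega
  have hkj' : key k < key j := by
    have := k.2
    simp only [hkeydef, if_true, if_neg hki, if_neg hkj, if_neg hji]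
    omega
  set p' : Set V → ℝ := comb (fun m => (c m).leaves) key fun _ => p
  have hp' : (PQTree.pnode n c).IsArr p' :=
    ⟨fun m => ((hT.isArr hp).1 m).congr
      (comb_ordAgree (q := fun _ => p) hdisj m).symm, comb_blockOrd hdisj hkey⟩
  obtain ⟨q, hq, hqp', -⟩ := hT.exists_isArr ht.hasDisjointLeaves hp hp'
  refine (ht.isArr_iff.1 hq).2 x C E D hC.1 hE hD.1 ?_ ?_ hC.2 hD.2
  · exact ((hqp' C (Set.mem_iUnion.2 ⟨i, hCi⟩) E hET).2 (comb_lt hdisj hik hCi hEk)).le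
  · exact ((hqp' E hET D hDT).2 (comb_lt hdisj hkj' hEk hDj)).le

theorem respects_of_isSubtree [Finite V] (ht : IsMPQTree G t) {T : PQTree (Set V)}
    (hT : T.IsSubtree t) : T.Respects (cliquesOf G) := by
  induction T with
  | leaf C => trivial
  | pnode n c ih =>
    exact ⟨fun i => ih i ((PQTree.IsSubtree.pnode _ n c i (.refl _)).trans hT),
      ht.leaves_pnode_subset hT⟩
  | qnode n c ih =>
    exact ⟨fun i => ih i ((PQTree.IsSubtree.qnode _ n c i (.refl _)).trans hT),
      fun i => ht.isModular ((PQTree.IsSubtree.qnode _ n c i (.refl _)).trans hT)⟩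

/-- The vertices of a subtree are the vertices all of whose maximal cliques are leaves of the
subtree. -/
theorem vertices_eq [Finite V] (ht : IsMPQTree G t) {T : PQTree (Set V)} (hT : T.IsSubtree t) :
    T.vertices G = inside (cliquesOf G) T.leaves := by
  induction T with
  | leaf C =>
    ext x
    constructor
    · exact fun hx D hD => hx.2 D hD.1 hD.2
    · intro hx
      obtain ⟨D, hD⟩ := cliquesOf_nonempty G x
      obtain rfl : D = C := hx hD
      exact ⟨hD.2, fun E hE hxE => hx ⟨hE, hxE⟩⟩
  | pnode n c ih =>
    have ih' := fun i => ih i ((PQTree.IsSubtree.pnode _ n c i (.refl _)).trans hT)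
    simp only [PQTree.vertices, ih']
    apply subset_antisymm
    · rintro x (hx | hx)
      · exact fun D hD => Set.mem_iUnion.2 (hx.2 D hD.1 hD.2)
      · obtain ⟨i, hi⟩ := Set.mem_iUnion.1 hx
        exact hi.trans (Set.subset_iUnion (fun i => (c i).leaves) i)
    · intro x hx
      by_cases hc : ∃ i, x ∈ inside (cliquesOf G) (c i).leaves
      · exact Or.inr (Set.mem_iUnion.2 hc)
      · obtain ⟨C, hC⟩ := cliquesOf_nonempty G x
        obtain ⟨i, hi⟩ := Set.mem_iUnion.1 (hx hC)
        have hall := ht.leaves_pnode_subset hT i x ⟨C, hC, hi⟩ fun h => hc ⟨i, h⟩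
        exact Or.inl ⟨fun i D hD => (hall (Set.mem_iUnion.2 ⟨i, hD⟩)).2,
          fun D hD hxD => Set.mem_iUnion.1 (hx ⟨hD, hxD⟩)⟩
  | qnode n c ih =>
    have hsub := fun i => (PQTree.IsSubtree.qnode _ n c i (.refl _)).trans hT
    simp only [PQTree.vertices, fun i => ih i (hsub i)]
    apply subset_antisymm
    · rintro x (hx | hx)
      · obtain ⟨i, hi⟩ := Set.mem_iUnion.1 hx
        exact fun D hD => Set.mem_iUnion.2 (hi.2.2 D hD.1 hD.2)
      · obtain ⟨i, hi⟩ := Set.mem_iUnion.1 hx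
        exact hi.trans (Set.subset_iUnion (fun i => (c i).leaves) i)
    · intro x hx
      by_cases hc : ∃ i, x ∈ inside (cliquesOf G) (c i).leaves
      · exact Or.inr (Set.mem_iUnion.2 hc)
      · obtain ⟨C, hC⟩ := cliquesOf_nonempty G x
        obtain ⟨i, hi⟩ := Set.mem_iUnion.1 (hx hC)
        have hni : ¬ cliquesOf G x ⊆ (c i).leaves := fun h => hc ⟨i, h⟩
        have hall := ht.isModular (hsub i) x ⟨C, hC, hi⟩ hni
        obtain ⟨D, hD, hDi⟩ := Set.not_subset.1 hni
        obtain ⟨j, hj⟩ := Set.mem_iUnion.1 (hx hD)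
        exact Or.inl (Set.mem_iUnion.2 ⟨i, fun E hE => (hall hE).2,
          ⟨j, fun hji => hDi (hji ▸ hj), D, hj, hD.2⟩,
          fun E hE hxE => Set.mem_iUnion.1 (hx ⟨hE, hxE⟩)⟩)

end IsMPQTree

end MPQ

/-! ### Representations and their triples -/

theorem Icc_inter_Icc_nonempty_iff {a b c d : ℝ} (hab : a ≤ b) (hcd : c ≤ d) :
    (Set.Icc a b ∩ Set.Icc c d).Nonempty ↔ a ≤ d ∧ c ≤ b := by
  rw [Set.Icc_inter_Icc, Set.nonempty_Icc, sup_le_iff, le_inf_iff, le_inf_iff]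
  tauto

theorem Icc_ssubset_Icc_iff {a b c d : ℝ} (hab : a ≤ b) :
    Set.Icc a b ⊂ Set.Icc c d ↔ c ≤ a ∧ b ≤ d ∧ (c < a ∨ b < d) := by
  rw [ssubset_iff_subset_not_subset, Set.Icc_subset_Icc_iff hab]
  constructor
  · rintro ⟨⟨h₁, h₂⟩, h₃⟩
    refine ⟨h₁, h₂, ?_⟩
    by_contra! h
    exact h₃ (Set.Icc_subset_Icc h.1 h.2)
  · rintro ⟨h₁, h₂, h₃⟩
    refine ⟨⟨h₁, h₂⟩, fun h => ?_⟩
    rw [Set.Icc_subset_Icc_iff (h₁.trans (hab.trans h₂))] at h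
    rcases h₃ with h₃ | h₃
    · exact absurd h.1 (not_le.2 h₃)
    · exact absurd h.2 (not_le.2 h₃)

namespace IntervalRep

variable {V W : Type*} {G : SimpleGraph V} (R : IntervalRep G)

theorem adj_iff_le {x y : V} (hxy : x ≠ y) :
    G.Adj x y ↔ R.left x ≤ R.right y ∧ R.left y ≤ R.right x := by
  rw [R.adj_iff x y hxy, Icc_inter_Icc_nonempty_iff (R.left_le_right x) (R.left_le_right y)]

theorem not_adj_iff_lt {x y : V} (hxy : x ≠ y) :
    ¬ G.Adj x y ↔ R.right x < R.left y ∨ R.right y < R.left x := by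
  rw [R.adj_iff_le hxy, not_and_or, not_le, not_le, or_comm]

theorem nested_iff {x y : V} : R.Nested x y ↔
    R.left y ≤ R.left x ∧ R.right x ≤ R.right y ∧ (R.left y < R.left x ∨ R.right x < R.right y) :=
  Icc_ssubset_Icc_iff (R.left_le_right x)

theorem nested_trans : ∀ x y z, R.Nested x y → R.Nested y z → R.Nested x z :=
  fun _ _ _ h h' => h.trans h'

theorem nested_irrefl (x : V) : ¬ R.Nested x x := ssubset_irrefl _

theorem flip_nested : R.flip.Nested = R.Nested := by
  funext x y
  rw [nested_iff, nested_iff]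
  simp only [flip, neg_le_neg_iff, neg_lt_neg_iff, eq_iff_iff]
  tauto

/-- The vertices with an interval to the left of their own one. -/
def freeLeft : Set V := {x | ∃ y, R.right y < R.left x}

/-- The vertices with an interval to the right of their own one. -/
def freeRight : Set V := {x | ∃ y, R.right x < R.left y}

theorem flip_freeLeft : R.flip.freeLeft = R.freeRight := by
  simp [freeLeft, freeRight, flip]

theorem flip_freeRight : R.flip.freeRight = R.freeLeft := by
  simp [freeLeft, freeRight, flip]

theorem nesting_eq : R.nesting = chainLen R.Nested Set.univ := by
  simp only [nesting, chainLen, Set.subset_univ, true_and]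
  rfl

theorem nestingAt_eq (x : V) : R.nestingAt x = topLen R.Nested x := rfl

theorem graphNesting_le : graphNesting G ≤ R.nesting :=
  Nat.sInf_le ⟨R, rfl⟩

theorem flip_nesting : R.flip.nesting = R.nesting := by
  rw [nesting_eq, nesting_eq, flip_nested]

/-- The intervals of a clique of a finite graph have a common point. -/
theorem exists_mem_cliqueRegion [Finite V] {C : Set V} (hC : G.IsClique C) :
    ∃ p, p ∈ R.cliqueRegion C := by
  rcases C.eq_empty_or_nonempty with rfl | hne
  · exact ⟨0, by simp [cliqueRegion]⟩
  obtain ⟨z, hz, hmax⟩ := Set.exists_max_image C R.left (Set.toFinite C) hne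
  refine ⟨R.left z, ?_⟩
  simp only [cliqueRegion, Set.mem_iInter]
  intro v hv
  refine ⟨hmax v hv, ?_⟩
  by_cases hvz : v = z
  · exact hvz ▸ R.left_le_right v
  · exact ((R.adj_iff_le hvz).1 (hC hv hz hvz)).2

theorem mem_cliqueRegion {C : Set V} {p : ℝ} (hp : p ∈ R.cliqueRegion C) {v : V} (hv : v ∈ C) :
    R.left v ≤ p ∧ p ≤ R.right v := by
  simp only [cliqueRegion, Set.mem_iInter] at hp
  exact hp v hv

/-- The vertices outside the leftmost maximal clique are those with an interval on their left. -/
theorem forall_leftmost_iff [Finite V] (x : V) :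
    (∀ C, R.IsLeftmostClique C → x ∉ C) ↔ x ∈ R.freeLeft := by
  constructor
  · intro h
    obtain ⟨y, -, hy⟩ := Set.exists_min_image Set.univ R.right Set.finite_univ ⟨x, trivial⟩
    by_contra hx
    have hxy : R.left x ≤ R.right y := by
      by_contra! hlt
      exact hx ⟨y, hlt⟩
    -- The leftmost maximal clique consists of the intervals that contain the smallest right
    -- endpoint.
    refine h {z | R.left z ≤ R.right y} ⟨⟨?_, ?_⟩, ?_⟩ hxy
    · intro v hv w hw hvw
      exact (R.adj_iff_le hvw).2 ⟨hv.trans (hy w trivial), le_trans hw (hy v trivial)⟩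
    · intro D hD hsub v hv
      by_cases hvy : v = y
      · exact hvy ▸ R.left_le_right v
      · exact ((R.adj_iff_le hvy).1 (hD hv (hsub (R.left_le_right y)) hvy)).1
    · intro D hD hne p hp q hq
      have hpy := (R.mem_cliqueRegion hp (R.left_le_right y)).2
      obtain ⟨z, hz, hzy⟩ : ∃ z ∈ D, R.right y < R.left z := by
        by_contra! hcon
        refine hne (hD.eq_of_subset ?_ hcon)
        intro v hv w hw hvw
        exact (R.adj_iff_le hvw).2 ⟨hv.trans (hy w trivial), le_trans hw (hy v trivial)⟩
      exact hpy.trans_lt (hzy.trans_le (R.mem_cliqueRegion hq hz).1)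
  · rintro ⟨y, hy⟩ C hC hxC
    obtain ⟨D, hD, hyD⟩ := exists_maxClique_of_isClique (G := G) (S := {y}) (by simp)
    have hyD := hyD rfl
    have hyC : y ∉ C := fun hyC => by
      obtain ⟨p, hp⟩ := R.exists_mem_cliqueRegion hC.1.1
      exact absurd ((R.mem_cliqueRegion hp hxC).1.trans (R.mem_cliqueRegion hp hyC).2) (not_le.2 hy)
    have hne : D ≠ C := fun h => hyC (h ▸ hyD)
    obtain ⟨p, hp⟩ := R.exists_mem_cliqueRegion hC.1.1
    obtain ⟨q, hq⟩ := R.exists_mem_cliqueRegion hD.1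
    have h₁ := hC.2 D hD hne p hp q hq
    have h₂ := (R.mem_cliqueRegion hp hxC).1
    have h₃ := (R.mem_cliqueRegion hq hyD).2
    linarith

theorem rightNesting_eq [Finite V] : R.rightNesting = chainLen R.Nested R.freeLeft := by
  rw [rightNesting]
  simp only [forall_leftmost_iff, nestingAt_eq]
  refine sSup_topLen R.nested_trans (fun x => x ∈ R.freeLeft) ?_
  rintro x y hyx ⟨z, hz⟩
  exact ⟨z, hz.trans_le (R.nested_iff.1 hyx).1⟩

theorem flip_precedes {C D : Set V} : R.flip.Precedes C D ↔ R.Precedes D C := by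
  have h : ∀ (C : Set V) (p : ℝ), p ∈ R.flip.cliqueRegion C ↔ -p ∈ R.cliqueRegion C := by
    intro C p
    simp only [cliqueRegion, interval, flip, Set.mem_iInter, Set.mem_Icc]
    refine forall₂_congr fun _ _ => ⟨fun h => ⟨?_, ?_⟩, fun h => ⟨?_, ?_⟩⟩ <;> linarith [h.1, h.2]
  constructor
  · intro hCD p hp q hq
    have := hCD (-q) ((h C _).2 (by simpa using hq)) (-p) ((h D _).2 (by simpa using hp))
    linarith
  · intro hDC p hp q hq
    have := hDC (-q) ((h D _).1 hq) (-p) ((h C _).1 hp)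
    linarith

theorem leftNesting_eq [Finite V] : R.leftNesting = chainLen R.Nested R.freeRight := by
  rw [← flip_nested, ← flip_freeLeft, ← rightNesting_eq]
  have : ∀ C, R.IsRightmostClique C ↔ R.flip.IsLeftmostClique C := fun C => by
    simp only [IsRightmostClique, IsLeftmostClique, flip_precedes]
  simp only [leftNesting, rightNesting, this, nestingAt_eq, flip_nested]

theorem flip_rightNesting [Finite V] : R.flip.rightNesting = R.leftNesting := by
  rw [rightNesting_eq, leftNesting_eq, flip_nested, flip_freeLeft]

theorem flip_leftNesting [Finite V] : R.flip.leftNesting = R.rightNesting := by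
  rw [rightNesting_eq, leftNesting_eq, flip_nested, flip_freeRight]

/-! ### Tight representations -/

/-- Every nesting is forced by intervals meeting the larger one on both sides of the smaller
one. -/
def IsTight : Prop :=
  ∀ x y, R.Nested x y → (∃ z, R.left y ≤ R.right z ∧ R.right z < R.left x) ∧
    ∃ z, R.left z ≤ R.right y ∧ R.right x < R.left z

theorem IsTight.flip {R : IntervalRep G} (h : R.IsTight) : R.flip.IsTight := by
  intro x y hxy
  rw [flip_nested] at hxy
  obtain ⟨⟨z, hz⟩, w, hw⟩ := h x y hxy
  exact ⟨⟨w, neg_le_neg hw.1, neg_lt_neg hw.2⟩, z, neg_le_neg hz.1, neg_lt_neg hz.2⟩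

theorem IsTight.isCleaned [Finite V] {R : IntervalRep G} (h : R.IsTight) : R.IsCleaned := by
  intro x y hxy
  obtain ⟨⟨z, hz, hz'⟩, w, hw, hw'⟩ := h x y hxy
  obtain ⟨h₁, h₂, -⟩ := R.nested_iff.1 hxy
  have hx := R.left_le_right x
  have hzz := R.left_le_right z
  have hww := R.left_le_right w
  have hzy : z ≠ y := by rintro rfl; linarith
  have hwy : w ≠ y := by rintro rfl; linarith
  obtain ⟨C, hC, hzC⟩ := exists_maxClique_of_isClique (G := G) (S := {z, y}) (by
    rw [SimpleGraph.isClique_pair]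
    exact fun _ => (R.adj_iff_le hzy).2 ⟨by linarith, by linarith⟩)
  obtain ⟨D, hD, hwD⟩ := exists_maxClique_of_isClique (G := G) (S := {w, y}) (by
    rw [SimpleGraph.isClique_pair]
    exact fun _ => (R.adj_iff_le hwy).2 ⟨by linarith, by linarith⟩)
  refine ⟨C, D, hC, hD, hzC (by simp), hwD (by simp), fun E _ hxE => ⟨?_, ?_⟩⟩
  · intro p hp q hq
    have h₃ := (R.mem_cliqueRegion hp (hzC (Set.mem_insert _ _))).2
    have h₄ := (R.mem_cliqueRegion hq hxE).1
    linarith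
  · intro p hp q hq
    have h₃ := (R.mem_cliqueRegion hq (hwD (Set.mem_insert _ _))).1
    have h₄ := (R.mem_cliqueRegion hp hxE).2
    linarith

/-- By tightness every element of a chain except the top one has an interval to its right. -/
theorem IsTight.nesting_le_left [Finite V] {R : IntervalRep G} (h : R.IsTight) :
    R.nesting ≤ R.leftNesting + 1 := by
  rw [nesting_eq, leftNesting_eq]
  refine chainLen_le_succ R.nested_trans fun x _ y _ hyx => ?_
  obtain ⟨-, z, -, hz⟩ := h y x hyx
  exact ⟨z, hz⟩

theorem nestingAt_le_nesting [Finite V] (x : V) : R.nestingAt x ≤ R.nesting := by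
  rw [nesting_eq, nestingAt_eq]
  exact topLen_le trivial fun _ _ => trivial

theorem nestingAt_le_leftNesting [Finite V] {x : V} (hx : x ∈ R.freeRight) :
    R.nestingAt x ≤ R.leftNesting := by
  rw [leftNesting_eq, nestingAt_eq]
  refine topLen_le hx fun y hyx => ?_
  obtain ⟨z, hz⟩ := hx
  exact ⟨z, (R.nested_iff.1 hyx).2.1.trans_lt hz⟩

theorem nestingAt_le_rightNesting [Finite V] {x : V} (hx : x ∈ R.freeLeft) :
    R.nestingAt x ≤ R.rightNesting := by
  rw [rightNesting_eq, nestingAt_eq]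
  refine topLen_le hx fun y hyx => ?_
  obtain ⟨z, hz⟩ := hx
  exact ⟨z, hz.trans_le (R.nested_iff.1 hyx).1⟩

/-! ### Attaching paths to a representation -/

section Attach

variable {H : SimpleGraph W} {U : Set W}

/-- The representation of `attachGraph G H U` composed of representations of `G` and `H`. -/
def attach (R : IntervalRep G) (P : IntervalRep H)
    (hU : ∀ x q, q ∈ U ↔ R.left x ≤ P.right q ∧ P.left q ≤ R.right x) :
    IntervalRep (attachGraph G H U) where
  left := Sum.elim R.left P.left
  right := Sum.elim R.right P.right
  left_le_right := by
    rintro (x | q)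
    exacts [R.left_le_right x, P.left_le_right q]
  adj_iff := by
    rintro (x | p) (y | q) hne
    · exact R.adj_iff x y fun h => hne (h ▸ rfl)
    · simp only [Sum.elim_inl, Sum.elim_inr]
      rw [Icc_inter_Icc_nonempty_iff (R.left_le_right x) (P.left_le_right q)]
      exact hU x q
    · simp only [Sum.elim_inl, Sum.elim_inr]
      rw [Icc_inter_Icc_nonempty_iff (P.left_le_right p) (R.left_le_right y), and_comm]
      exact hU y p
    · exact P.adj_iff p q fun h => hne (h ▸ rfl)

/-- The rank function is ν(x) on G and k + 1 on the added vertices. Path intervals contain neither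
each other nor lie inside intervals of G, so a chain has at most one of them, on top of vertices
with ν(x) at most k. -/
theorem nesting_attach_le [Finite V] [Finite W] {R : IntervalRep G} {P : IntervalRep H}
    {hU : ∀ x q, q ∈ U ↔ R.left x ≤ P.right q ∧ P.left q ≤ R.right x} {k : ℕ}
    (hP : ∀ p q, ¬ P.Nested p q) (hPR : ∀ q x, ¬ (R.left x ≤ P.left q ∧ P.right q ≤ R.right x))
    (hk : ∀ x q, P.left q ≤ R.left x → R.right x ≤ P.right q → R.nestingAt x ≤ k)
    (hn : R.nesting ≤ k + 1) : (R.attach P hU).nesting ≤ k + 1 := by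
  rw [nesting_eq]
  refine chainLen_le_of_rank (Sum.elim R.nestingAt fun _ => k + 1) ?_ ?_
  · rintro (x | q) -
    · exact ⟨one_le_topLen _ _, (R.nestingAt_le_nesting x).trans hn⟩
    · simp
  · rintro (x | p) - (y | q) - h
    · exact topLen_lt R.nested_irrefl R.nested_trans h
    · rw [nested_iff] at h
      exact Nat.lt_succ_of_le (hk x q h.1 h.2.1)
    · rw [nested_iff] at h
      exact absurd ⟨h.1, h.2.1⟩ (hPR p y)
    · exact absurd h (hP p q)

/-- The representation of `G` contained in a representation of `attachGraph G H U`. -/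
def detach (S : IntervalRep (attachGraph G H U)) : IntervalRep G where
  left x := S.left (Sum.inl x)
  right x := S.right (Sum.inl x)
  left_le_right _ := S.left_le_right _
  adj_iff x y hxy := S.adj_iff (Sum.inl x) (Sum.inl y) fun h => hxy (Sum.inl_injective h)

theorem chainLen_detach_succ_le [Finite V] [Finite W] (S : IntervalRep (attachGraph G H U))
    {A : Set V} {u : W} (hA : ∀ x ∈ A, S.Nested (Sum.inl x) (Sum.inr u)) :
    chainLen S.detach.Nested A + 1 ≤ S.nesting := by
  rw [nesting_eq]
  exact chainLen_succ_le Function.Embedding.inl (z := Sum.inr u) (by simp) (fun _ _ _ _ h => h)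
    hA trivial fun _ _ => trivial

end Attach

/-! ### Nestings forced by attached paths -/

/-- A vertex `a` with a private neighbour covers one of the endpoints of its neighbour `u`. -/
theorem pendant {a' a u : V} (h₁ : G.Adj a' a) (h₂ : G.Adj a u) (hne : a' ≠ u)
    (h₃ : ¬ G.Adj a' u) : (R.left a < R.left u ∧ R.left u ≤ R.right a) ∨
      (R.right u < R.right a ∧ R.left a ≤ R.right u) := by
  rw [R.adj_iff_le h₁.ne] at h₁
  rw [R.adj_iff_le h₂.ne] at h₂
  rcases (R.not_adj_iff_lt hne).1 h₃ with h | h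
  · exact Or.inl ⟨by linarith, by linarith⟩
  · exact Or.inr ⟨by linarith, by linarith⟩

/-- As `a` covers the left end of u, a vertex x that meets u but not `a` starts to the right of `a`.
On the other side u reaches y, which begins after x has ended. -/
theorem pendant_left {a u x y : V} (ha : R.left a < R.left u ∧ R.left u ≤ R.right a)
    (hxu : G.Adj x u) (hyu : G.Adj y u) (hne : x ≠ a) (hxa : ¬ G.Adj x a)
    (hxy : R.right x < R.left y) : R.Nested x u := by
  rw [R.adj_iff_le hxu.ne] at hxu
  rw [R.adj_iff_le hyu.ne] at hyu
  rw [nested_iff]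
  rcases (R.not_adj_iff_lt hne).1 hxa with h | h
  · linarith
  · exact ⟨by linarith, by linarith, Or.inl (by linarith)⟩

theorem pendant_right {a u x y : V} (ha : R.right u < R.right a ∧ R.left a ≤ R.right u)
    (hxu : G.Adj x u) (hyu : G.Adj y u) (hne : x ≠ a) (hxa : ¬ G.Adj x a)
    (hxy : R.right y < R.left x) : R.Nested x u := by
  rw [← flip_nested]
  exact R.flip.pendant_left ⟨neg_lt_neg ha.1, neg_le_neg ha.2⟩ hxu hyu hne hxa (neg_lt_neg hxy)

end IntervalRep

theorem graphNesting_eq {V : Type*} {G : SimpleGraph V} {k : ℕ} (h₁ : ∃ R : IntervalRep G, R.nesting ≤ k)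
    (h₂ : ∀ R : IntervalRep G, k ≤ R.nesting) : graphNesting G = k := by
  obtain ⟨R, hR⟩ := h₁
  refine le_antisymm (R.graphNesting_le.trans hR) (le_csInf ⟨R.nesting, R, rfl⟩ ?_)
  rintro _ ⟨S, rfl⟩
  exact h₂ S

/-! ### The triple as minima of nestings -/

section Triples

open IntervalRep

variable {V : Type*} [Finite V] {G : SimpleGraph V}

theorem nesting_detach_alpha (S : IntervalRep (graphAlpha G)) :
    S.detach.nesting + 1 ≤ S.nesting := by
  rw [nesting_eq S.detach]
  refine S.chainLen_detach_succ_le (u := 2) fun x _ => ?_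
  have e₁ : (graphAlpha G).Adj (Sum.inr 0) (Sum.inr 1) := by
    simp [graphAlpha, attachGraph, SimpleGraph.pathGraph_adj]
  have e₂ : (graphAlpha G).Adj (Sum.inr 1) (Sum.inr 2) := by
    simp [graphAlpha, attachGraph, SimpleGraph.pathGraph_adj]
  have e₃ : ¬ (graphAlpha G).Adj (Sum.inr 0) (Sum.inr 2) := by
    simp [graphAlpha, attachGraph, SimpleGraph.pathGraph_adj]
  have e₄ : (graphAlpha G).Adj (Sum.inr 4) (Sum.inr 3) := by
    simp [graphAlpha, attachGraph, SimpleGraph.pathGraph_adj]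
  have e₅ : (graphAlpha G).Adj (Sum.inr 3) (Sum.inr 2) := by
    simp [graphAlpha, attachGraph, SimpleGraph.pathGraph_adj]
  have e₆ : ¬ (graphAlpha G).Adj (Sum.inr 4) (Sum.inr 2) := by
    simp [graphAlpha, attachGraph, SimpleGraph.pathGraph_adj]
  have e₇ : ¬ (graphAlpha G).Adj (Sum.inr 1) (Sum.inr 3) := by
    simp [graphAlpha, attachGraph, SimpleGraph.pathGraph_adj]
  have e₈ : ¬ (graphAlpha G).Adj (Sum.inl x) (Sum.inr 1) := by simp [graphAlpha, attachGraph]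
  have e₉ : ¬ (graphAlpha G).Adj (Sum.inl x) (Sum.inr 3) := by simp [graphAlpha, attachGraph]
  have e₀ : (graphAlpha G).Adj (Sum.inl x) (Sum.inr 2) := by simp [graphAlpha, attachGraph]
  have h₁ := S.pendant e₁ e₂ (by simp) e₃
  have h₂ := S.pendant e₄ e₅ (by simp) e₆
  rw [S.not_adj_iff_lt (by simp)] at e₇ e₈ e₉
  rw [S.adj_iff_le (by simp)] at e₀
  refine S.nested_iff.2 ?_
  have := S.left_le_right (Sum.inr 2)
  -- The vertices a and b cannot stick out at the same end of u, since they would meet. So they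
  -- cover opposite ends, and x, meeting u but neither of them, lies strictly in between.
  rcases h₁ with h₁ | h₁ <;> rcases h₂ with h₂ | h₂ <;> rcases e₇ with e₇ | e₇ <;>
    rcases e₈ with e₈ | e₈ <;> rcases e₉ with e₉ | e₉ <;>
    first
    | linarith [h₁.1, h₁.2, h₂.1, h₂.2, e₀.1, e₀.2]
    | exact ⟨by linarith [h₁.1, h₁.2, h₂.1, h₂.2, e₀.1, e₀.2],
        by linarith [h₁.1, h₁.2, h₂.1, h₂.2, e₀.1, e₀.2],
        Or.inl (by linarith [h₁.1, h₁.2, h₂.1, h₂.2, e₀.1, e₀.2])⟩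

/-- The vertex a covers one end of u, while u still has to reach all vertices of G. If it covers the
left end, all vertices with an interval to their right are nested in u; the other case gives the
right nesting. Which end is used depends on the representation, hence the minimum. -/
theorem nesting_detach_beta (S : IntervalRep (graphBeta G)) :
    min S.detach.rightNesting S.detach.leftNesting + 1 ≤ S.nesting := by
  have e₁ : (graphBeta G).Adj (Sum.inr 0) (Sum.inr 1) := by
    simp [graphBeta, attachGraph, SimpleGraph.pathGraph_adj]
  have e₂ : (graphBeta G).Adj (Sum.inr 1) (Sum.inr 2) := by
    simp [graphBeta, attachGraph, SimpleGraph.pathGraph_adj]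
  have e₃ : ¬ (graphBeta G).Adj (Sum.inr 0) (Sum.inr 2) := by
    simp [graphBeta, attachGraph, SimpleGraph.pathGraph_adj]
  have e₄ : ∀ x, ¬ (graphBeta G).Adj (Sum.inl x) (Sum.inr 1) := by simp [graphBeta, attachGraph]
  have e₅ : ∀ x, (graphBeta G).Adj (Sum.inl x) (Sum.inr 2) := by simp [graphBeta, attachGraph]
  rcases S.pendant e₁ e₂ (by simp) e₃ with h | h
  · refine le_trans (Nat.add_le_add_right (min_le_right _ _) 1) ?_
    rw [leftNesting_eq]
    refine S.chainLen_detach_succ_le (u := 2) ?_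
    rintro x ⟨y, hy⟩
    exact S.pendant_left h (e₅ x) (e₅ y) (by simp) (e₄ x) hy
  · refine le_trans (Nat.add_le_add_right (min_le_left _ _) 1) ?_
    rw [rightNesting_eq]
    refine S.chainLen_detach_succ_le (u := 2) ?_
    rintro x ⟨y, hy⟩
    exact S.pendant_right h (e₅ x) (e₅ y) (by simp) (e₄ x) hy

theorem nesting_detach_gamma (S : IntervalRep (graphGamma G)) :
    max S.detach.rightNesting S.detach.leftNesting + 1 ≤ S.nesting := by
  have e₁ : (graphGamma G).Adj (Sum.inr 0) (Sum.inr 1) := by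
    simp [graphGamma, attachGraph, SimpleGraph.pathGraph_adj]
  have e₂ : (graphGamma G).Adj (Sum.inr 1) (Sum.inr 2) := by
    simp [graphGamma, attachGraph, SimpleGraph.pathGraph_adj]
  have e₃ : ¬ (graphGamma G).Adj (Sum.inr 0) (Sum.inr 2) := by
    simp [graphGamma, attachGraph, SimpleGraph.pathGraph_adj]
  have e₁' : (graphGamma G).Adj (Sum.inr 5) (Sum.inr 4) := by
    simp [graphGamma, attachGraph, SimpleGraph.pathGraph_adj]
  have e₂' : (graphGamma G).Adj (Sum.inr 4) (Sum.inr 3) := by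
    simp [graphGamma, attachGraph, SimpleGraph.pathGraph_adj]
  have e₃' : ¬ (graphGamma G).Adj (Sum.inr 5) (Sum.inr 3) := by
    simp [graphGamma, attachGraph, SimpleGraph.pathGraph_adj]
  have e₄ : ∀ x, ¬ (graphGamma G).Adj (Sum.inl x) (Sum.inr 1) := by simp [graphGamma, attachGraph]
  have e₅ : ∀ x, (graphGamma G).Adj (Sum.inl x) (Sum.inr 2) := by simp [graphGamma, attachGraph]
  have e₄' : ∀ x, ¬ (graphGamma G).Adj (Sum.inl x) (Sum.inr 4) := by simp [graphGamma, attachGraph]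
  have e₅' : ∀ x, (graphGamma G).Adj (Sum.inl x) (Sum.inr 3) := by simp [graphGamma, attachGraph]
  have e₆ : (graphGamma G).Adj (Sum.inr 2) (Sum.inr 3) := by
    simp [graphGamma, attachGraph, SimpleGraph.pathGraph_adj]
  have e₇ : ¬ (graphGamma G).Adj (Sum.inr 1) (Sum.inr 3) := by
    simp [graphGamma, attachGraph, SimpleGraph.pathGraph_adj]
  have e₈ : ¬ (graphGamma G).Adj (Sum.inr 2) (Sum.inr 4) := by
    simp [graphGamma, attachGraph, SimpleGraph.pathGraph_adj]
  have h₁ := S.pendant e₁ e₂ (by simp) e₃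
  have h₂ := S.pendant e₁' e₂' (by simp) e₃'
  rw [S.not_adj_iff_lt (by simp)] at e₇ e₈
  rw [S.adj_iff_le (by simp)] at e₆
  rw [← max_add_add_right, rightNesting_eq, leftNesting_eq]
  -- If a and b covered the same end of u and v, respectively, then the adjacency of u and v would
  -- force a to meet v or b to meet u. With opposite ends, one of u, v contains the vertices free on
  -- the left and the other those free on the right.
  rcases h₁ with h₁ | h₁ <;> rcases h₂ with h₂ | h₂
  · exfalso
    rcases e₇ with e₇ | e₇ <;> rcases e₈ with e₈ | e₈ <;>
      linarith [h₁.1, h₁.2, h₂.1, h₂.2, e₆.1, e₆.2]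
  · refine max_le (S.chainLen_detach_succ_le (u := 3) ?_) (S.chainLen_detach_succ_le (u := 2) ?_)
    · rintro x ⟨y, hy⟩
      exact S.pendant_right h₂ (e₅' x) (e₅' y) (by simp) (e₄' x) hy
    · rintro x ⟨y, hy⟩
      exact S.pendant_left h₁ (e₅ x) (e₅ y) (by simp) (e₄ x) hy
  · refine max_le (S.chainLen_detach_succ_le (u := 2) ?_) (S.chainLen_detach_succ_le (u := 3) ?_)
    · rintro x ⟨y, hy⟩
      exact S.pendant_right h₁ (e₅ x) (e₅ y) (by simp) (e₄ x) hy
    · rintro x ⟨y, hy⟩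
      exact S.pendant_left h₂ (e₅' x) (e₅' y) (by simp) (e₄' x) hy
  · exfalso
    rcases e₇ with e₇ | e₇ <;> rcases e₈ with e₈ | e₈ <;>
      linarith [h₁.1, h₁.2, h₂.1, h₂.2, e₆.1, e₆.2]

/-- Bounds for the endpoints of a representation, and points close to its right and left end. -/
theorem IntervalRep.exists_bounds (R : IntervalRep G) (hne : ∀ x y, R.right x ≠ R.left y) :
    ∃ M r l : ℝ, 0 ≤ M ∧ l ≤ r ∧ -M ≤ r ∧ r ≤ M ∧ -M ≤ l ∧ l ≤ M ∧ (∀ x, -M ≤ R.left x) ∧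
      (∀ x, R.right x ≤ M) ∧ (∀ x, R.left x ≤ r) ∧ (∀ x, l ≤ R.right x) ∧
      (∀ x, R.right x ≤ r → x ∈ R.freeRight) ∧ ∀ x, l ≤ R.left x → x ∈ R.freeLeft := by
  rcases isEmpty_or_nonempty V with hV | hV
  · refine ⟨0, 0, 0, ?_⟩
    simp
  obtain ⟨a, ha⟩ := Finite.exists_min R.left
  obtain ⟨b, hb⟩ := Finite.exists_max R.right
  obtain ⟨c, hc⟩ := Finite.exists_max R.left
  obtain ⟨d, hd⟩ := Finite.exists_min R.right
  have hac := ha c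
  have hdb := hd b
  have hcr := R.left_le_right c
  have hdl := R.left_le_right d
  have had := ha d
  have hbc := hb c
  have h₁ := neg_abs_le (R.left a)
  have h₂ := le_abs_self (R.right b)
  have h₁' := abs_nonneg (R.left a)
  have h₂' := abs_nonneg (R.right b)
  set M := |R.left a| + |R.right b| with hM
  have hMl : ∀ x, -M ≤ R.left x := fun x => by linarith [ha x]
  have hMr : ∀ x, R.right x ≤ M := fun x => by linarith [hb x]
  -- The natural points are the largest left and the smallest right endpoint; an interval ending
  -- weakly before the former does so strictly by `hne`. If all intervals overlap in a proper
  -- segment, its midpoint serves for both, as no interval ends before it or starts after it.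
  rcases le_or_gt (R.right d) (R.left c) with h | h
  · refine ⟨M, R.left c, R.right d, by linarith, h, by linarith, by linarith, by linarith,
      by linarith, hMl, hMr, hc, hd, fun x hx => ⟨c, ?_⟩, fun x hx => ⟨d, ?_⟩⟩
    · exact lt_of_le_of_ne hx (hne x c)
    · exact lt_of_le_of_ne hx (hne d x)
  · refine ⟨M, (R.left c + R.right d) / 2, (R.left c + R.right d) / 2, by linarith, le_rfl,
      by linarith, by linarith, by linarith, by linarith, hMl, hMr, fun x => by linarith [hc x],
      fun x => by linarith [hd x], fun x hx => ?_, fun x hx => ?_⟩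
    · linarith [hd x]
    · linarith [hc x]

/-- A representation given by endpoints. -/
def IntervalRep.ofLE {W : Type*} {H : SimpleGraph W} (l r : W → ℝ) (h : ∀ v, l v ≤ r v)
    (hadj : ∀ x y, x ≠ y → (H.Adj x y ↔ l x ≤ r y ∧ l y ≤ r x)) : IntervalRep H where
  left := l
  right := r
  left_le_right := h
  adj_iff x y hxy := by rw [hadj x y hxy, Icc_inter_Icc_nonempty_iff (h x) (h y)]

/-- Endpoints in the appropriate order represent a path. -/
theorem exists_pathRep {n : ℕ} {l r : Fin n → ℝ} (hl : StrictMono l) (hr : StrictMono r)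
    (hlr : ∀ i, l i ≤ r i) (h₁ : ∀ i j : Fin n, (i : ℕ) + 1 = j → l j ≤ r i)
    (h₂ : ∀ i j : Fin n, (i : ℕ) + 2 = j → r i < l j) :
    ∃ P : IntervalRep (SimpleGraph.pathGraph n), P.left = l ∧ P.right = r ∧
      ∀ p q, ¬ P.Nested p q := by
  have key : ∀ i j : Fin n, i < j → ((i : ℕ) + 1 = j ↔ l j ≤ r i) := by
    intro i j hij
    refine ⟨h₁ i j, fun h => ?_⟩
    by_contra hne
    have hlt : (i : ℕ) + 2 ≤ j := by
      have : (i : ℕ) < j := hij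
      omega
    have hk : (i : ℕ) + 2 < n := hlt.trans_lt j.2
    have h₃ := h₂ i ⟨i + 2, hk⟩ rfl
    have h₄ : l ⟨i + 2, hk⟩ ≤ l j := hl.monotone hlt
    linarith
  refine ⟨.ofLE l r hlr fun i j hij => ?_, rfl, rfl, fun i j hij => ?_⟩
  · rw [SimpleGraph.pathGraph_adj]
    rcases lt_or_gt_of_ne hij with h | h
    · rw [key i j h, or_iff_left_of_imp fun h' => ?_, iff_and_self]
      · exact fun _ => (hlr i).trans (hr h).le
      · have : (i : ℕ) < j := h
        omega
    · rw [key j i h, or_iff_right_of_imp fun h' => ?_, iff_self_and]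
      · exact fun _ => (hlr j).trans (hr h).le
      · have : (j : ℕ) < i := h
        omega
  · have hne : i ≠ j := by rintro rfl; exact IntervalRep.nested_irrefl _ i hij
    rw [nested_iff] at hij
    rcases lt_or_gt_of_ne hne with h | h
    · exact absurd hij.1 (not_le.2 (hl h))
    · exact absurd hij.2.1 (not_le.2 (hr h))

theorem IntervalRep.exists_rep_alpha (R : IntervalRep G)
    (hne : ∀ x y, R.right x ≠ R.left y) :
    ∃ S : IntervalRep (graphAlpha G), S.nesting ≤ R.nesting + 1 := by
  obtain ⟨M, -, -, hM, -, -, -, -, -, hMl, hMr, -, -, -, -⟩ := R.exists_bounds hne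
  -- All of G lives in [-M, M]. The interval of u is [-M - 2, M + 2], and the two attached paths lie
  -- outside [-M, M] on either side.
  obtain ⟨P, hPl, hPr, hP⟩ := exists_pathRep (n := 5)
    (l := ![-M - 6, -M - 4, -M - 2, M + 1, M + 3]) (r := ![-M - 3, -M - 1, M + 2, M + 4, M + 6])
    (by rw [Fin.strictMono_iff_lt_succ]; intro i; fin_cases i <;> simp <;> linarith)
    (by rw [Fin.strictMono_iff_lt_succ]; intro i; fin_cases i <;> simp <;> linarith)
    (by intro i; fin_cases i <;> simp <;> linarith)
    (by intro i j h; fin_cases i <;> fin_cases j <;> simp at h ⊢ <;> linarith)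
    (by intro i j h; fin_cases i <;> fin_cases j <;> simp at h ⊢ <;> linarith)
  refine ⟨R.attach P ?_, nesting_attach_le hP ?_ ?_ ?_⟩
  · intro x q
    have h₁ := hMl x
    have h₂ := hMr x
    have h₃ := R.left_le_right x
    rw [hPl, hPr]
    fin_cases q
    · exact iff_of_false (by simp) fun (h : _ ≤ -M - 3 ∧ _) => by linarith [h.1]
    · exact iff_of_false (by simp) fun (h : _ ≤ -M - 1 ∧ _) => by linarith [h.1]
    · exact iff_of_true (by simp) (show _ ≤ M + 2 ∧ -M - 2 ≤ _ from ⟨by linarith, by linarith⟩)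
    · exact iff_of_false (by simp) fun (h : _ ∧ M + 1 ≤ _) => by linarith [h.2]
    · exact iff_of_false (by simp) fun (h : _ ∧ M + 3 ≤ _) => by linarith [h.2]
  · intro q x h
    have h₁ := hMl x
    have h₂ := hMr x
    rw [hPl, hPr] at h
    fin_cases q
    · linarith [show _ ≤ -M - 6 from h.1]
    · linarith [show _ ≤ -M - 4 from h.1]
    · linarith [show _ ≤ -M - 2 from h.1]
    · linarith [show M + 4 ≤ _ from h.2]
    · linarith [show M + 6 ≤ _ from h.2]
  · exact fun x _ _ _ => R.nestingAt_le_nesting x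
  · omega

theorem IntervalRep.IsTight.exists_rep_beta {R : IntervalRep G} (hR : R.IsTight)
    (hne : ∀ x y, R.right x ≠ R.left y) :
    ∃ S : IntervalRep (graphBeta G), S.nesting ≤ R.leftNesting + 1 := by
  obtain ⟨M, ρ, -, hM, -, hρ₁, hρ₂, -, -, hMl, hMr, hlρ, -, hρ, -⟩ := R.exists_bounds hne
  -- The interval of u ends at `ρ`. This is far enough to meet all vertices of G, and so early that
  -- only vertices with an interval to their right are contained in u.
  obtain ⟨P, hPl, hPr, hP⟩ := exists_pathRep (n := 3)
    (l := ![-M - 6, -M - 4, -M - 2]) (r := ![-M - 3, -M - 1, ρ])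
    (by rw [Fin.strictMono_iff_lt_succ]; intro i; fin_cases i <;> simp <;> linarith)
    (by rw [Fin.strictMono_iff_lt_succ]; intro i; fin_cases i <;> simp <;> linarith)
    (by intro i; fin_cases i <;> simp <;> linarith)
    (by intro i j h; fin_cases i <;> fin_cases j <;> simp at h ⊢ <;> linarith)
    (by intro i j h; fin_cases i <;> fin_cases j <;> simp at h ⊢ <;> linarith)
  refine ⟨R.attach P ?_, nesting_attach_le hP ?_ ?_ hR.nesting_le_left⟩
  · intro x q
    have h₁ := hMl x
    have h₃ := R.left_le_right x
    have h₄ := hlρ x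
    rw [hPl, hPr]
    fin_cases q
    · exact iff_of_false (by simp) fun (h : _ ≤ -M - 3 ∧ _) => by linarith [h.1]
    · exact iff_of_false (by simp) fun (h : _ ≤ -M - 1 ∧ _) => by linarith [h.1]
    · exact iff_of_true (by simp) (show _ ≤ ρ ∧ -M - 2 ≤ _ from ⟨by linarith, by linarith⟩)
  · intro q x h
    have h₁ := hMl x
    rw [hPl, hPr] at h
    fin_cases q
    · linarith [show _ ≤ -M - 6 from h.1]
    · linarith [show _ ≤ -M - 4 from h.1]
    · linarith [show _ ≤ -M - 2 from h.1]
  · intro x q _ h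
    have h₁ := hMl x
    have h₃ := R.left_le_right x
    rw [hPr] at h
    fin_cases q
    · linarith [show _ ≤ -M - 3 from h]
    · linarith [show _ ≤ -M - 1 from h]
    · exact R.nestingAt_le_leftNesting (hρ x h)

theorem IntervalRep.IsTight.exists_rep_gamma {R : IntervalRep G} (hR : R.IsTight)
    (hne : ∀ x y, R.right x ≠ R.left y) :
    ∃ S : IntervalRep (graphGamma G), S.nesting ≤ max R.rightNesting R.leftNesting + 1 := by
  obtain ⟨M, ρ, l, hM, hlρ', hρ₁, hρ₂, hl₁, hl₂, hMl, hMr, hlρ, hlr, hρ, hl⟩ :=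
    R.exists_bounds hne
  -- The interval of u ends at `ρ` and that of v starts at `l`. They overlap since l ≤ ρ; u contains
  -- only vertices free on the right, and v only vertices free on the left.
  obtain ⟨P, hPl, hPr, hP⟩ := exists_pathRep (n := 6)
    (l := ![-M - 6, -M - 4, -M - 2, l, M + 1, M + 3])
    (r := ![-M - 3, -M - 1, ρ, M + 2, M + 4, M + 6])
    (by rw [Fin.strictMono_iff_lt_succ]; intro i; fin_cases i <;> simp <;> linarith)
    (by rw [Fin.strictMono_iff_lt_succ]; intro i; fin_cases i <;> simp <;> linarith)
    (by intro i; fin_cases i <;> simp <;> linarith)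
    (by intro i j h; fin_cases i <;> fin_cases j <;> simp at h ⊢ <;> linarith)
    (by intro i j h; fin_cases i <;> fin_cases j <;> simp at h ⊢ <;> linarith)
  refine ⟨R.attach P ?_, nesting_attach_le hP ?_ ?_
    (hR.nesting_le_left.trans (Nat.add_le_add_right (le_max_right _ _) 1))⟩
  · intro x q
    have h₁ := hMl x
    have h₂ := hMr x
    have h₃ := R.left_le_right x
    have h₄ := hlρ x
    have h₅ := hlr x
    rw [hPl, hPr]
    fin_cases q
    · exact iff_of_false (by simp) fun (h : _ ≤ -M - 3 ∧ _) => by linarith [h.1]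
    · exact iff_of_false (by simp) fun (h : _ ≤ -M - 1 ∧ _) => by linarith [h.1]
    · exact iff_of_true (by simp) (show _ ≤ ρ ∧ -M - 2 ≤ _ from ⟨by linarith, by linarith⟩)
    · exact iff_of_true (by simp) (show _ ≤ M + 2 ∧ l ≤ _ from ⟨by linarith, by linarith⟩)
    · exact iff_of_false (by simp) fun (h : _ ∧ M + 1 ≤ _) => by linarith [h.2]
    · exact iff_of_false (by simp) fun (h : _ ∧ M + 3 ≤ _) => by linarith [h.2]
  · intro q x h
    have h₁ := hMl x
    have h₂ := hMr x
    rw [hPl, hPr] at h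
    fin_cases q
    · linarith [show _ ≤ -M - 6 from h.1]
    · linarith [show _ ≤ -M - 4 from h.1]
    · linarith [show _ ≤ -M - 2 from h.1]
    · linarith [show M + 2 ≤ _ from h.2]
    · linarith [show M + 4 ≤ _ from h.2]
    · linarith [show M + 6 ≤ _ from h.2]
  · intro x q h h'
    have h₁ := hMl x
    have h₂ := hMr x
    have h₃ := R.left_le_right x
    rw [hPl] at h
    rw [hPr] at h'
    fin_cases q
    · linarith [show _ ≤ -M - 3 from h']
    · linarith [show _ ≤ -M - 1 from h']
    · exact (R.nestingAt_le_leftNesting (hρ x h')).trans (le_max_right _ _)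
    · exact (R.nestingAt_le_rightNesting (hl x h)).trans (le_max_left _ _)
    · linarith [show M + 1 ≤ _ from h]
    · linarith [show M + 3 ≤ _ from h]

/-- A tight representation minimizing the overall nesting, and the minimum and the maximum of the
right and the left nesting, is minimal, up to mirroring. -/
theorem IntervalRep.IsTight.isMinimalRep {R : IntervalRep G} (hR : R.IsTight)
    (hne : ∀ x y, R.right x ≠ R.left y)
    (hopt : ∀ S : IntervalRep G, R.nesting ≤ S.nesting ∧
      min R.rightNesting R.leftNesting ≤ min S.rightNesting S.leftNesting ∧
      max R.rightNesting R.leftNesting ≤ max S.rightNesting S.leftNesting) :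
    R.IsMinimalRep ∨ R.flip.IsMinimalRep := by
  have hα : tripleAlpha G = R.nesting := by
    rw [tripleAlpha, graphNesting_eq (R.exists_rep_alpha hne) fun S =>
      (Nat.add_le_add_right (hopt S.detach).1 1).trans (nesting_detach_alpha S)]
    rfl
  have hne' : ∀ x y, R.flip.right x ≠ R.flip.left y := fun x y h => hne y x (neg_injective h).symm
  have hβ : tripleBeta G = min R.rightNesting R.leftNesting := by
    have hex : ∃ S : IntervalRep (graphBeta G),
        S.nesting ≤ min R.rightNesting R.leftNesting + 1 := by
      rcases min_choice R.rightNesting R.leftNesting with h | h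
      · rw [h, ← flip_leftNesting]
        exact hR.flip.exists_rep_beta hne'
      · rw [h]
        exact hR.exists_rep_beta hne
    rw [tripleBeta, graphNesting_eq hex fun S =>
      (Nat.add_le_add_right (hopt S.detach).2.1 1).trans (nesting_detach_beta S)]
    rfl
  have hγ : tripleGamma G = max R.rightNesting R.leftNesting := by
    rw [tripleGamma, graphNesting_eq (hR.exists_rep_gamma hne) fun S =>
      (Nat.add_le_add_right (hopt S.detach).2.2 1).trans (nesting_detach_gamma S)]
    rfl
  rcases le_total R.rightNesting R.leftNesting with h | h
  · refine Or.inl ⟨hR.isCleaned, hα.symm, ?_, ?_⟩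
    · rw [hβ, min_eq_left h]
    · rw [hγ, max_eq_right h]
  · refine Or.inr ⟨hR.flip.isCleaned, by rw [flip_nesting, hα], ?_, ?_⟩
    · rw [hβ, min_eq_right h, flip_rightNesting]
    · rw [hγ, max_eq_left h, flip_leftNesting]

end Triples

/-! ### Representations of the graph of a subtree -/

section Blocks

variable {V : Type*} {G : SimpleGraph V} {L : Set (Set V)} {p : Set V → ℝ}

/-- A vertex of a block outside a clique of the block has a non-neighbour in this clique that also
belongs to the block. -/
theorem exists_not_adj [Finite V] (hL : ∀ C ∈ L, IsMaxClique G C)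
    (hmod : IsModular (cliquesOf G) L) {x : V} (hx : x ∈ inside (cliquesOf G) L) {C : Set V}
    (hC : C ∈ L) (hxC : x ∉ C) :
    ∃ y ∈ inside (cliquesOf G) L, y ∈ C ∧ x ≠ y ∧ ¬ G.Adj x y := by
  obtain ⟨y, hyC, hxy, hadj⟩ : ∃ y ∈ C, x ≠ y ∧ ¬ G.Adj x y := by
    by_contra! hcon
    refine hxC ((hL C hC).2 (y := insert x C) ?_ (Set.subset_insert x C) (Set.mem_insert x C))
    exact (SimpleGraph.isClique_insert.2 ⟨(hL C hC).1, hcon⟩)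
  refine ⟨y, ?_, hyC, hxy, hadj⟩
  by_contra hy
  obtain ⟨E, hE⟩ := cliquesOf_nonempty G x
  -- A vertex of C from outside the block is in all cliques of the block, by modularity, and would
  -- thus be adjacent to x.
  have hyE := (hmod y ⟨C, ⟨hL C hC, hyC⟩, hC⟩ hy (hx hE)).2
  exact hadj (hE.1.1 hE.2 hyE hxy)

/-- A vertex contained in some but not all cliques of a block belongs to the block. -/
theorem mem_inside_of_notMem (hL : ∀ C ∈ L, IsMaxClique G C)
    (hmod : IsModular (cliquesOf G) L) {x : V} {C D : Set V} (hC : C ∈ L) (hD : D ∈ L)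
    (hxC : x ∈ C) (hxD : x ∉ D) : x ∈ inside (cliquesOf G) L := by
  by_contra hx
  exact hxD (hmod x ⟨C, ⟨hL C hC, hxC⟩, hC⟩ hx hD).2

namespace IntervalRep

/-- The position of every clique of the block is a point in all intervals of the clique. -/
def Realizes (R : IntervalRep (G.induce (inside (cliquesOf G) L))) (p : Set V → ℝ) : Prop :=
  ∀ C ∈ L, ∀ v : inside (cliquesOf G) L, (v : V) ∈ C → R.left v ≤ p C ∧ p C ≤ R.right v

variable {R : IntervalRep (G.induce (inside (cliquesOf G) L))}

theorem Realizes.flip (h : R.Realizes p) : R.flip.Realizes fun C => -p C :=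
  fun C hC v hv => ⟨neg_le_neg (h C hC v hv).2, neg_le_neg (h C hC v hv).1⟩

/-- A clique to the left of all cliques of x contains a non-neighbour z of x from the block. The
interval of z meets the position of this clique, so it lies entirely to the left of x. This turns
forced nestings into strict inequalities of endpoints. -/
theorem Realizes.exists_left [Finite V] (hL : ∀ C ∈ L, IsMaxClique G C)
    (hmod : IsModular (cliquesOf G) L) (h : R.Realizes p) (x : inside (cliquesOf G) L)
    {C : Set V} (hC : C ∈ L) (hCx : ∀ E ∈ cliquesOf G x, p C < p E) :
    ∃ z : inside (cliquesOf G) L, (z : V) ∈ C ∧ R.right z < R.left x := by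
  have hxC : (x : V) ∉ C := fun hxC => lt_irrefl _ (hCx C ⟨hL C hC, hxC⟩)
  obtain ⟨z, hz, hzC, hxz, hadj⟩ := exists_not_adj hL hmod x.2 hC hxC
  refine ⟨⟨z, hz⟩, hzC, ?_⟩
  have hne : x ≠ ⟨z, hz⟩ := fun h => hxz (congrArg Subtype.val h)
  have hadj' : ¬ (G.induce (inside (cliquesOf G) L)).Adj x ⟨z, hz⟩ := hadj
  rw [R.not_adj_iff_lt hne] at hadj'
  refine hadj'.resolve_left fun hlt => ?_
  obtain ⟨E, hE⟩ := cliquesOf_nonempty G (x : V)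
  have h₁ := (h E (x.2 hE) x hE.2).2
  have h₂ := (h C hC ⟨z, hz⟩ hzC).1
  linarith [hCx E hE]

theorem Realizes.freeLeft_eq [Finite V] (hL : ∀ C ∈ L, IsMaxClique G C)
    (hmod : IsModular (cliquesOf G) L) (h : R.Realizes p) :
    R.freeLeft = {x : inside (cliquesOf G) L | (x : V) ∈ offLeft (cliquesOf G) L p} := by
  ext x
  constructor
  · rintro ⟨y, hy⟩
    obtain ⟨C, hC⟩ := cliquesOf_nonempty G (y : V)
    refine ⟨C, y.2 hC, fun E hE => ?_⟩
    have h₁ := (h C (y.2 hC) y hC.2).2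
    have h₂ := (h E (x.2 hE) x hE.2).1
    linarith
  · rintro ⟨C, hC, hCx⟩
    obtain ⟨z, -, hz⟩ := h.exists_left hL hmod x hC hCx
    exact ⟨z, hz⟩

theorem Realizes.freeRight_eq [Finite V] (hL : ∀ C ∈ L, IsMaxClique G C)
    (hmod : IsModular (cliquesOf G) L) (h : R.Realizes p) :
    R.freeRight = {x : inside (cliquesOf G) L | (x : V) ∈ offRight (cliquesOf G) L p} := by
  rw [← flip_freeLeft, h.flip.freeLeft_eq hL hmod, offLeft_neg]

theorem Realizes.exists_of_nest [Finite V] (hL : ∀ C ∈ L, IsMaxClique G C)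
    (hmod : IsModular (cliquesOf G) L) (h : R.Realizes p) {x y : inside (cliquesOf G) L}
    (hxy : Nest (cliquesOf G) p x y) : ∃ z, R.left y ≤ R.right z ∧ R.right z < R.left x := by
  obtain ⟨C, hC, hCx⟩ := hxy.1
  obtain ⟨z, hzC, hz⟩ := h.exists_left hL hmod x (y.2 hC) hCx
  exact ⟨z, (h C (y.2 hC) y hC.2).1.trans (h C (y.2 hC) z hzC).2, hz⟩

theorem Realizes.exists_of_nest' [Finite V] (hL : ∀ C ∈ L, IsMaxClique G C)
    (hmod : IsModular (cliquesOf G) L) (h : R.Realizes p) {x y : inside (cliquesOf G) L}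
    (hxy : Nest (cliquesOf G) p x y) : ∃ z, R.left z ≤ R.right y ∧ R.right x < R.left z := by
  rw [← nest_neg] at hxy
  obtain ⟨z, hz₁, hz₂⟩ := h.flip.exists_of_nest hL hmod hxy
  exact ⟨z, neg_le_neg_iff.1 hz₁, neg_lt_neg_iff.1 hz₂⟩

theorem Realizes.nested [Finite V] (hL : ∀ C ∈ L, IsMaxClique G C)
    (hmod : IsModular (cliquesOf G) L) (h : R.Realizes p) {x y : inside (cliquesOf G) L}
    (hxy : Nest (cliquesOf G) p x y) : R.Nested x y := by
  obtain ⟨z, hz₁, hz₂⟩ := h.exists_of_nest hL hmod hxy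
  obtain ⟨w, hw₁, hw₂⟩ := h.exists_of_nest' hL hmod hxy
  rw [nested_iff]
  exact ⟨by linarith, by linarith, Or.inl (by linarith)⟩

theorem Realizes.isTight [Finite V] (hL : ∀ C ∈ L, IsMaxClique G C)
    (hmod : IsModular (cliquesOf G) L) (h : R.Realizes p)
    (hR : ∀ x y, R.Nested x y → Nest (cliquesOf G) p x y) : R.IsTight :=
  fun x y hxy => ⟨h.exists_of_nest hL hmod (hR x y hxy), h.exists_of_nest' hL hmod (hR x y hxy)⟩

/-- Forced nestings are present in every representation with these positions, so the nestings
computed from positions are lower bounds. -/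
theorem Realizes.nu_le [Finite V] (hL : ∀ C ∈ L, IsMaxClique G C)
    (hmod : IsModular (cliquesOf G) L) (h : R.Realizes p) :
    nu (cliquesOf G) .all L p ≤ R.nesting ∧ nu (cliquesOf G) .left L p ≤ R.rightNesting ∧
      nu (cliquesOf G) .right L p ≤ R.leftNesting := by
  rw [nesting_eq, rightNesting_eq, leftNesting_eq, h.freeLeft_eq hL hmod, h.freeRight_eq hL hmod]
  simp only [nu, ← chainLen_subtype]
  exact ⟨chainLen_mono_rel (Set.subset_univ _) fun x _ y _ => h.nested hL hmod,
    chainLen_mono_rel subset_rfl fun x _ y _ => h.nested hL hmod,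
    chainLen_mono_rel subset_rfl fun x _ y _ => h.nested hL hmod⟩

theorem Realizes.le_nu [Finite V] (hL : ∀ C ∈ L, IsMaxClique G C)
    (hmod : IsModular (cliquesOf G) L) (h : R.Realizes p)
    (hR : ∀ x y, R.Nested x y → Nest (cliquesOf G) p x y) :
    R.nesting ≤ nu (cliquesOf G) .all L p ∧ R.rightNesting ≤ nu (cliquesOf G) .left L p ∧
      R.leftNesting ≤ nu (cliquesOf G) .right L p := by
  rw [nesting_eq, rightNesting_eq, leftNesting_eq, h.freeLeft_eq hL hmod, h.freeRight_eq hL hmod]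
  simp only [nu, ← chainLen_subtype]
  exact ⟨chainLen_mono_rel (fun _ _ => trivial) fun x _ y _ => hR x y,
    chainLen_mono_rel subset_rfl fun x _ y _ => hR x y,
    chainLen_mono_rel subset_rfl fun x _ y _ => hR x y⟩

theorem exists_realizes [Finite V] (hL : ∀ C ∈ L, IsMaxClique G C)
    (R : IntervalRep (G.induce (inside (cliquesOf G) L))) : ∃ p, R.Realizes p := by
  have : ∀ C, ∃ a : ℝ, C ∈ L → ∀ v : inside (cliquesOf G) L, (v : V) ∈ C →
      R.left v ≤ a ∧ a ≤ R.right v := by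
    intro C
    by_cases hC : C ∈ L
    · obtain ⟨a, ha⟩ := R.exists_mem_cliqueRegion (C := {v | (v : V) ∈ C}) fun v hv w hw hvw =>
        (hL C hC).1 hv hw fun h => hvw (Subtype.ext h)
      exact ⟨a, fun _ v hv => R.mem_cliqueRegion ha hv⟩
    · exact ⟨0, fun h => absurd h hC⟩
  choose p hp using this
  exact ⟨p, hp⟩

/-- Different cliques of a block have different positions. -/
theorem Realizes.injOn [Finite V] (hL : ∀ C ∈ L, IsMaxClique G C)
    (hmod : IsModular (cliquesOf G) L) (h : R.Realizes p) {C D : Set V} (hC : C ∈ L) (hD : D ∈ L)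
    (hCD : p C = p D) : C = D := by
  refine (hL C hC).eq_of_subset (hL D hD).1 fun x hxC => ?_
  by_contra hxD
  have hx := mem_inside_of_notMem hL hmod hC hD hxC hxD
  obtain ⟨z, hz, hzD, hxz, hadj⟩ := exists_not_adj hL hmod hx hD hxD
  have hne : (⟨x, hx⟩ : inside (cliquesOf G) L) ≠ ⟨z, hz⟩ := fun h => hxz (congrArg Subtype.val h)
  have h₁ := h C hC ⟨x, hx⟩ hxC
  have h₂ := h D hD ⟨z, hz⟩ hzD
  exact hadj ((R.adj_iff_le hne).2 ⟨by linarith, by linarith⟩)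

/-- Otherwise the clique D contains a non-neighbour of x in the block. Its interval contains the
position of D, which the interval of x also covers. -/
theorem Realizes.mem_of_le [Finite V] (hL : ∀ C ∈ L, IsMaxClique G C)
    (hmod : IsModular (cliquesOf G) L) (h : R.Realizes p) {C D E : Set V} (hC : C ∈ L) (hD : D ∈ L)
    (hE : E ∈ L) (hCD : p C ≤ p D) (hDE : p D ≤ p E) {x : V} (hx : x ∈ inside (cliquesOf G) L)
    (hxC : x ∈ C) (hxE : x ∈ E) : x ∈ D := by
  by_contra hxD
  obtain ⟨z, hz, hzD, hxz, hadj⟩ := exists_not_adj hL hmod hx hD hxD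
  have hne : (⟨x, hx⟩ : inside (cliquesOf G) L) ≠ ⟨z, hz⟩ := fun h => hxz (congrArg Subtype.val h)
  have h₁ := h C hC ⟨x, hx⟩ hxC
  have h₂ := h D hD ⟨z, hz⟩ hzD
  have h₃ := h E hE ⟨x, hx⟩ hxE
  exact hadj ((R.adj_iff_le hne).2 ⟨by linarith, by linarith⟩)

/-- The positions of cliques in a representation of the graph of a subtree are an arrangement of
this subtree. -/
theorem Realizes.isArr [Finite V] {t T : PQTree (Set V)} (ht : IsMPQTree G t)
    (hT : T.IsSubtree t) {R : IntervalRep (G.induce (inside (cliquesOf G) T.leaves))}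
    (h : R.Realizes p) : T.IsArr p := by
  have hmod := ht.isModular hT
  have hL : ∀ C ∈ T.leaves, IsMaxClique G C := fun C hC => ht.mem_leaves.1 (hT.leaves_subset hC)
  obtain ⟨p₀, hp₀⟩ := ht.exists_isArr
  have hblock := hT.block hp₀
  -- The order of the cliques in R is transplanted into an arrangement of the whole tree. If the
  -- result is consecutive on G, then the MPQ-tree admits it, and in particular T admits the order
  -- inside the block.
  obtain ⟨q, hq, hqp⟩ := PQTree.exists_replace hblock p
  obtain ⟨hinj, hcon⟩ := ht.isArr_iff.1 hp₀
  have hle : ∀ C D, IsMaxClique G C → IsMaxClique G D → ¬ (C ∈ T.leaves ∧ D ∈ T.leaves) →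
      q C ≤ q D → p₀ C ≤ p₀ D := by
    intro C D hC hD hCD hle
    rw [← not_lt] at hle ⊢
    rwa [← hqp D (ht.mem_leaves.2 hD) C (ht.mem_leaves.2 hC) fun h => hCD ⟨h.2, h.1⟩]
  have hle' : ∀ C ∈ T.leaves, ∀ D ∈ T.leaves, q C ≤ q D → p C ≤ p D := by
    intro C hC D hD hle
    rw [← not_lt] at hle ⊢
    rwa [← hq D hD C hC]
  have hqcon : IsConsecutivePos G q := by
    constructor
    · intro C D hC hD hCD
      by_cases hboth : C ∈ T.leaves ∧ D ∈ T.leaves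
      · exact h.injOn hL hmod hboth.1 hboth.2
          (le_antisymm (hle' C hboth.1 D hboth.2 hCD.le) (hle' D hboth.2 C hboth.1 hCD.ge))
      · exact hinj C D hC hD (le_antisymm (hle C D hC hD hboth hCD.le)
          (hle D C hD hC (fun h => hboth ⟨h.2, h.1⟩) hCD.ge))
    · intro x C D E hC hD hE hCD hDE hxC hxE
      by_cases hx : x ∈ inside (cliquesOf G) T.leaves
      · have hCT := hx ⟨hC, hxC⟩
        have hET := hx ⟨hE, hxE⟩
        by_cases hDT : D ∈ T.leaves
        · exact h.mem_of_le hL hmod hCT hDT hET (hle' C hCT D hDT hCD) (hle' D hDT E hET hDE) hx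
            hxC hxE
        · have h₁ := hle C D hC hD (fun h => hDT h.2) hCD
          have h₂ := hle D E hD hE (fun h => hDT h.1) hDE
          -- A clique outside the block cannot lie between two cliques of the block.
          rcases hblock D (ht.mem_leaves.2 hD) hDT with h' | h'
          · exact absurd (h' E hET) (not_lt.2 h₂)
          · exact absurd (h' C hCT) (not_lt.2 h₁)
      -- If D and one of C, E are in the block, then x, which does not belong to the block, has all
      -- cliques of the block by modularity. In the other cases the relevant comparisons are those
      -- of `p₀`.
      · by_cases hDT : D ∈ T.leaves
        · by_cases hCT : C ∈ T.leaves
          · exact (hmod x ⟨C, ⟨hC, hxC⟩, hCT⟩ hx hDT).2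
          by_cases hET : E ∈ T.leaves
          · exact (hmod x ⟨E, ⟨hE, hxE⟩, hET⟩ hx hDT).2
          exact hcon x C D E hC hD hE (hle C D hC hD (fun h => hCT h.1) hCD)
            (hle D E hD hE (fun h => hET h.2) hDE) hxC hxE
        · exact hcon x C D E hC hD hE (hle C D hC hD (fun h => hDT h.2) hCD)
            (hle D E hD hE (fun h => hDT h.1) hDE) hxC hxE
  exact (hT.isArr (ht.isArr_iff.2 hqcon)).congr hq

end IntervalRep

/-! ### Representations with prescribed clique positions -/

/-- Positions can be replaced by natural numbers. -/
theorem exists_rank {α : Type*} [Finite α] (p : α → ℝ) :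
    ∃ k : α → ℕ, ∀ C D, p C < p D ↔ k C < k D := by
  classical
  have := Fintype.ofFinite α
  have key : ∀ C D, p C < p D → (Finset.univ.filter fun E => p E < p C).card <
      (Finset.univ.filter fun E => p E < p D).card := by
    intro C D hCD
    refine Finset.card_lt_card ⟨fun E hE => ?_, fun hsub => ?_⟩
    · simp only [Finset.mem_filter, Finset.mem_univ, true_and] at hE ⊢
      exact hE.trans hCD
    · have := hsub (Finset.mem_filter.2 ⟨Finset.mem_univ C, hCD⟩)
      simp at this
  refine ⟨fun C => (Finset.univ.filter fun E => p E < p C).card, fun C D => ⟨key C D, fun h => ?_⟩⟩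
  by_contra! hDC
  rcases hDC.lt_or_eq with hlt | heq
  · exact lt_asymm h (key D C hlt)
  · simp only [heq, lt_irrefl] at h

/-- Consecutive positions are realized by a representation without unforced nestings. -/
theorem IsConsecutivePos.exists_rep [Finite V] {k : Set V → ℕ}
    (hk : IsConsecutivePos G fun C => k C) :
    ∃ R : IntervalRep G, (∀ x y, R.right x ≠ R.left y) ∧
      (∀ C, IsMaxClique G C → ∀ v ∈ C, R.left v ≤ k C ∧ (k C : ℝ) ≤ R.right v) ∧
      ∀ x y, R.Nested x y → Nest (cliquesOf G) (fun C => k C) x y := by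
  obtain ⟨m, hm⟩ : ∃ m, ∀ C, k C ≤ m := by
    obtain ⟨m, hm⟩ := (Set.finite_range k).bddAbove
    exact ⟨m, fun C => hm ⟨C, rfl⟩⟩
  choose lo hlo hlo' using fun x =>
    Set.exists_min_image (cliquesOf G x) k (Set.toFinite _) (cliquesOf_nonempty G x)
  choose hi hhi hhi' using fun x =>
    Set.exists_max_image (cliquesOf G x) k (Set.toFinite _) (cliquesOf_nonempty G x)
  -- All perturbations `ε * k C` stay below 1/4, so they cannot change the order of endpoints at
  -- different integer positions.
  set ε : ℝ := 1 / (4 * (m + 1)) with hε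
  have hε₀ : 0 < ε := by positivity
  have hεm : ε * (m + 1) = 1 / 4 := by
    rw [hε]
    field_simp
  have hsmall : ∀ j : ℕ, j ≤ m → 0 ≤ ε * j ∧ ε * j < 1 / 4 := by
    intro j hj
    have hj' : (j : ℝ) ≤ m := by exact_mod_cast hj
    exact ⟨by positivity, by nlinarith⟩
  have hlohi : ∀ x, k (lo x) ≤ k (hi x) := fun x => hlo' x _ (hhi x)
  -- Every interval covers the range of its cliques, with ties broken against nesting: among
  -- vertices with the same first clique the one ending later also starts later, and among those
  -- with the same last clique the one starting later also ends later. The shift by 1/4 keeps left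
  -- endpoints below the integer position.
  set l : V → ℝ := fun x => k (lo x) - 1 / 4 + ε * k (hi x) with hl
  set r : V → ℝ := fun x => k (hi x) + ε * k (lo x) with hr
  have hl₁ : ∀ x, l x < k (lo x) := fun x => by
    have := (hsmall _ (hm (hi x))).2
    simp only [hl]
    linarith
  have hl₂ : ∀ x, (k (lo x) : ℝ) - 1 / 4 ≤ l x := fun x => by
    have := (hsmall _ (hm (hi x))).1
    simp only [hl]
    linarith
  have hr₁ : ∀ x, (k (hi x) : ℝ) ≤ r x := fun x => by
    have := (hsmall _ (hm (lo x))).1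
    simp only [hr]
    linarith
  have hr₂ : ∀ x, r x < k (hi x) + 1 / 4 := fun x => by
    have := (hsmall _ (hm (lo x))).2
    simp only [hr]
    linarith
  have hlr : ∀ x, l x ≤ r x := fun x => by
    have h₁ := hl₁ x
    have h₂ := hr₁ x
    have : (k (lo x) : ℝ) ≤ k (hi x) := by exact_mod_cast hlohi x
    linarith
  have hlr_iff : ∀ x y, l x ≤ r y ↔ k (lo x) ≤ k (hi y) := by
    intro x y
    constructor
    · intro h
      have h₁ := hl₂ x
      have h₂ := hr₂ y
      have : (k (lo x) : ℝ) < k (hi y) + 1 := by linarith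
      exact Nat.lt_succ_iff.1 (by exact_mod_cast this)
    · intro h
      have : (k (lo x) : ℝ) ≤ k (hi y) := by exact_mod_cast h
      linarith [hl₁ x, hr₁ y]
  have hadj_of : ∀ x y, x ≠ y → k (lo x) ≤ k (lo y) → k (lo y) ≤ k (hi x) → G.Adj x y := by
    intro x y hxy h₁ h₂
    have hx : x ∈ lo y := hk.2 x (lo x) (lo y) (hi x) (hlo x).1 (hlo y).1 (hhi x).1
      (Nat.cast_le.2 h₁) (Nat.cast_le.2 h₂) (hlo x).2 (hhi x).2
    exact (hlo y).1.1 hx (hlo y).2 hxy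
  let R : IntervalRep G := .ofLE l r hlr fun x y hxy => by
    rw [hlr_iff, hlr_iff]
    constructor
    · intro h
      obtain ⟨C, hC, hxyC⟩ := exists_maxClique_of_isClique (G := G) (S := {x, y}) (by
        rw [SimpleGraph.isClique_pair]
        exact fun _ => h)
      have hx : C ∈ cliquesOf G x := ⟨hC, hxyC (by simp)⟩
      have hy : C ∈ cliquesOf G y := ⟨hC, hxyC (by simp)⟩
      exact ⟨(hlo' x C hx).trans (hhi' y C hy), (hlo' y C hy).trans (hhi' x C hx)⟩
    · rintro ⟨h₁, h₂⟩
      rcases le_total (k (lo x)) (k (lo y)) with h | h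
      · exact hadj_of x y hxy h h₂
      · exact (hadj_of y x hxy.symm h h₁).symm
  refine ⟨R, fun x y hxy => ?_, fun C hC v hv => ⟨?_, ?_⟩, fun x y hxy => ?_⟩
  · have hxy' : r x = l y := hxy
    have h₁ := hr₁ x
    have h₂ := hl₁ y
    have h₃ := hr₂ x
    have h₄ := hl₂ y
    have h₅ : k (hi x) < k (lo y) := by
      have : (k (hi x) : ℝ) < k (lo y) := by linarith
      exact_mod_cast this
    have h₆ : (k (hi x) : ℝ) + 1 ≤ k (lo y) := by exact_mod_cast h₅
    linarith
  · have : (k (lo v) : ℝ) ≤ k C := by exact_mod_cast hlo' v C ⟨hC, hv⟩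
    exact (hl₁ v).le.trans this
  · have : (k C : ℝ) ≤ k (hi v) := by exact_mod_cast hhi' v C ⟨hC, hv⟩
    exact this.trans (hr₁ v)
  · rw [R.nested_iff] at hxy
    obtain ⟨h₁, h₂, h₃⟩ : l y ≤ l x ∧ r x ≤ r y ∧ (l y < l x ∨ r x < r y) := hxy
    have hlo₁ : k (lo y) ≤ k (lo x) := by
      have : (k (lo y) : ℝ) < k (lo x) + 1 := by linarith [hl₂ y, hl₁ x]
      exact Nat.lt_succ_iff.1 (by exact_mod_cast this)
    have hhi₁ : k (hi x) ≤ k (hi y) := by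
      have : (k (hi x) : ℝ) < k (hi y) + 1 := by linarith [hr₂ y, hr₁ x]
      exact Nat.lt_succ_iff.1 (by exact_mod_cast this)
    simp only [hl, hr] at h₁ h₂ h₃
    -- With equal first cliques, the left endpoints force the last cliques to coincide as well, so
    -- the intervals would be equal.
    have hlo₂ : k (lo y) < k (lo x) := by
      refine lt_of_le_of_ne hlo₁ fun heq => ?_
      rw [heq] at h₁ h₂ h₃
      have h₄ : (k (hi x) : ℝ) ≤ k (hi y) := by exact_mod_cast hhi₁
      have h₅ : (k (hi y) : ℝ) ≤ k (hi x) := le_of_mul_le_mul_left (by linarith) hε₀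
      have h₆ : (k (hi x) : ℝ) = k (hi y) := le_antisymm h₄ h₅
      rw [h₆] at h₃
      simp at h₃
    have hhi₂ : k (hi x) < k (hi y) := by
      refine lt_of_le_of_ne hhi₁ fun heq => ?_
      rw [heq] at h₂
      have h₅ : (k (lo x) : ℝ) ≤ k (lo y) := le_of_mul_le_mul_left (by linarith) hε₀
      exact absurd hlo₂ (not_lt.2 (by exact_mod_cast h₅))
    refine ⟨⟨lo y, hlo y, fun E hE => ?_⟩, hi y, hhi y, fun E hE => ?_⟩
    · exact Nat.cast_lt.2 (hlo₂.trans_le (hlo' x E hE))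
    · exact Nat.cast_lt.2 ((hhi' x E hE).trans_lt hhi₂)

theorem IntervalRep.restrict_nesting [Finite V] (R : IntervalRep G) (A : Set V) :
    (R.restrict A).nesting = chainLen R.Nested A := by
  rw [nesting_eq, ← Set.inter_univ A, ← chainLen_subtype, Set.inter_univ]
  rfl

end Blocks

/-! ### Proof of the lemma -/

theorem mainTheorem4 {V : Type*} [Finite V] (G : SimpleGraph V) (hG : IsIntervalGraph G)
    (t : PQTree (Set V)) (ht : IsMPQTree G t) :
    ∃ R : IntervalRep G, R.IsCleaned ∧ R.nesting = graphNesting G ∧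
      ∀ T : PQTree (Set V), T.IsSubtree t →
        (R.restrict (T.vertices G)).IsMinimalRep ∨
          (R.flip.restrict (T.vertices G)).IsMinimalRep := by
  -- A single arrangement that is best for all subtrees is realized by a single representation. Its
  -- restrictions then inherit optimality for every subtree at once.
  obtain ⟨p, hp, hbest⟩ := t.exists_isBest (K := cliquesOf G) (cliquesOf_nonempty G) ht.1
    ht.hasDisjointLeaves (ht.respects_of_isSubtree (.refl t))
  obtain ⟨k, hk⟩ := exists_rank p
  have hpk : ∀ L : Set (Set V), OrdAgree L (fun C => (k C : ℝ)) p := fun L C _ D _ => by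
    rw [hk, Nat.cast_lt]
  have hka : t.IsArr fun C => (k C : ℝ) := hp.congr (hpk _).symm
  obtain ⟨R, hne, hreal, hnest⟩ := (ht.isArr_iff.1 hka).exists_rep
  have hL : ∀ T : PQTree (Set V), T.IsSubtree t → ∀ C ∈ T.leaves, IsMaxClique G C :=
    fun T hT C hC => ht.mem_leaves.1 (hT.leaves_subset hC)
  have hreal' : ∀ T : PQTree (Set V), T.IsSubtree t →
      (R.restrict (inside (cliquesOf G) T.leaves)).Realizes fun C => (k C : ℝ) :=
    fun T hT C hC v hv => hreal C (hL T hT C hC) v hv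
  have hnest' : ∀ (T : PQTree (Set V)) (x y : inside (cliquesOf G) T.leaves),
      (R.restrict (inside (cliquesOf G) T.leaves)).Nested x y →
        Nest (cliquesOf G) (fun C => (k C : ℝ)) x y :=
    fun T x y hxy => hnest x y hxy
  have htight : ∀ T : PQTree (Set V), T.IsSubtree t →
      (R.restrict (inside (cliquesOf G) T.leaves)).IsTight :=
    fun T hT => (hreal' T hT).isTight (hL T hT) (ht.isModular hT) (hnest' T)
  have hopt : ∀ T : PQTree (Set V), T.IsSubtree t →
      ∀ S : IntervalRep (G.induce (inside (cliquesOf G) T.leaves)),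
        (R.restrict (inside (cliquesOf G) T.leaves)).nesting ≤ S.nesting ∧
        min (R.restrict (inside (cliquesOf G) T.leaves)).rightNesting
          (R.restrict (inside (cliquesOf G) T.leaves)).leftNesting ≤
            min S.rightNesting S.leftNesting ∧
        max (R.restrict (inside (cliquesOf G) T.leaves)).rightNesting
          (R.restrict (inside (cliquesOf G) T.leaves)).leftNesting ≤
            max S.rightNesting S.leftNesting := by
    intro T hT S
    -- The competitor S induces an arrangement of T. The nestings of the restriction of R are at
    -- most those computed from its positions, these are at most those of the arrangement of S, up
    -- to mirroring, and the latter are at most the nestings of S.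
    obtain ⟨p', hp'⟩ := S.exists_realizes (hL T hT)
    obtain ⟨h₁, h₂, h₃⟩ := (hbest T hT p' (hp'.isArr ht hT)).congr_left (hpk T.leaves)
    obtain ⟨h₄, h₅, h₆⟩ := (hreal' T hT).le_nu (hL T hT) (ht.isModular hT) (hnest' T)
    obtain ⟨h₇, h₈, h₉⟩ := hp'.nu_le (hL T hT) (ht.isModular hT)
    refine ⟨by omega, by omega, by omega⟩
  have hall : inside (cliquesOf G) t.leaves = Set.univ :=
    Set.eq_univ_of_forall fun x C hC => ht.mem_leaves.2 hC.1
  have hRtight : R.IsTight := by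
    intro x y hxy
    have hmem : ∀ x, x ∈ inside (cliquesOf G) t.leaves := fun x => hall ▸ trivial
    obtain ⟨⟨z, hz⟩, w, hw⟩ := htight t (.refl t) ⟨x, hmem x⟩ ⟨y, hmem y⟩ hxy
    exact ⟨⟨z, hz⟩, w, hw⟩
  refine ⟨R, hRtight.isCleaned, ?_, fun T hT => ?_⟩
  · refine (graphNesting_eq ⟨R, le_rfl⟩ fun S => ?_).symm
    have := (hopt t (.refl t) (S.restrict _)).1
    rwa [IntervalRep.restrict_nesting, IntervalRep.restrict_nesting, hall,
      ← IntervalRep.nesting_eq, ← IntervalRep.nesting_eq] at this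
  · rw [ht.vertices_eq hT]
    exact (htight T hT).isMinimalRep (fun x y => hne x y) (hopt T hT)
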